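/- Let $\mathcal R$ be a real closed field with a nontrivial valuation $\mathrm{val}:\mathcal R^*\to\mathbb R$, put $\nu=-\mathrm{val}$, and assume that $\nu$ is compatible with the order, i.e. $0<a<b$ implies $\nu(a)\le\nu(b)$. Let $\mathcal C=\mathcal R(\mathrm i)$ with $\mathrm i^2=-1$, with complex conjugation $\overline{a+\mathrm i b}=a-\mathrm i b$ and with $\nu$ extended by $\nu(a+\mathrm i b)=\max\{\nu(a),\nu(b)\}$ (where $\nu(0)=-\infty$). Let $\mathcal K=\mathcal R$ or $\mathcal K=\mathcal C$ and let $n$ be a positive integer. For a set $X\subseteq\mathcal K^N$ let $\nu(X)\subseteq\mathbb R^N$ be the set of coordinatewise $\nu$-values of the points of $X$ with all coordinates nonzero, and let $\mathrm{trop}(X)=\overline{\nu(X)}$ be its Euclidean closure. - $\mathrm{PM}_n^+(\mathcal K)\subseteq\mathcal R^{2^{[n]}}$ is the set of vectors $(A_S)_{S\subseteq[n]}$ of principal minors ($A_\varnothing=1$) of $n\times n$ positive definite symmetric (if $\mathcal K=\mathcal R$), respectively Hermitian (if $\mathcal K=\mathcal C$), matrices $A$ over $\mathcal K$, positive definite meaning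 that all principal minors are positive; $\mathrm{cone}(\mathrm{PM}_n^+(\mathcal K))=\{\lambda a:\lambda\in\mathcal K,\ a\in\mathrm{PM}_n^+(\mathcal K)\}\subseteq\mathcal K^{2^{[n]}}$. - $\mathrm{Gr}_{\mathcal K}(n,2n)\subseteq\mathcal K^{\binom{[2n]}{n}}$ is the set of all vectors of Plücker coordinates (with arbitrary nonzero scaling) of $n$-dimensional subspaces of $\mathcal K^{2n}$. - $\mathrm{Fl}_{\mathcal K}(n)\subseteq\mathcal K^{2^{[n]}}$, the complete affine flag variety, is the set of vectors $(q_S)_{S\subseteq[n]}$ for which there is a complete flag $L_0\subset L_1\subset\dots\subset L_n=\mathcal K^n$ with $\dim L_k=k$ such that, for each $k=0,\dots,n$, $(q_S)_{|S|=k}$ is a vector of Plücker coordinates of $L_k$ (each scaled independently by a nonzero scalar). - $\mathcal L_n\subseteq\mathbb R^{\binom{[2n]}{n}}$ is the subspace of all $p$ with $p(C)=p(D)$ whenever $C\cap[n]=D\cap[n]$. It is identified with $\mathbb R^{2^{[n]}}$ by sending $p$ to $S\mapsto p(S\cup T)$, for any $T\subseteq\{n+1,\dots,2n\}$ with $|T|=n-|S|$.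 - $\mathrm{SUBMOD}_n\subseteq\mathbb R^{2^{[n]}}$ is the cone of functions $F$ with $F(S\cap T)+F(S\cup T)\le F(S)+F(T)$ for all $S,T\subseteq[n]$. Then $$\nu(\mathrm{cone}(\mathrm{PM}_n^+(\mathcal K)))=\nu(\mathrm{Gr}_{\mathcal K}(n,2n))\cap\mathcal L_n=\nu(\mathrm{Fl}_{\mathcal K}(n))\cap\mathrm{SUBMOD}_n$$ and $$\mathrm{trop}(\mathrm{cone}(\mathrm{PM}_n^+(\mathcal K)))=\mathrm{trop}(\mathrm{Gr}_{\mathcal K}(n,2n))\cap\mathcal L_n=\mathrm{trop}(\mathrm{Fl}_{\mathcal K}(n))\cap\mathrm{SUBMOD}_n.$$ -/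

import Mathlib

/-! ### Valued fields and coordinatewise valuation -/

/-- The set `ν(X) ⊆ ℝ^ι`, where `ν = -val` on nonzero elements, of coordinatewise values of those
points of `X ⊆ K^ι` all of whose coordinates are nonzero.  Here `val : K → ℝ ∪ {∞}` takes the value
`∞` exactly at `0`, so that `val (x i) = -(w i)` with `w i` real forces `x i ≠ 0`. -/
def nuImage {K ι : Type*} (val : K → WithTop ℝ) (X : Set (ι → K)) : Set (ι → ℝ) :=
  {w | ∃ x ∈ X, ∀ i, val (x i) = ((-(w i) : ℝ) : WithTop ℝ)}

/-- The tropicalization `trop(X)`: the Euclidean closure of `ν(X)`. -/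
def tropicalization {K ι : Type*} (val : K → WithTop ℝ) (X : Set (ι → K)) : Set (ι → ℝ) :=
  closure (nuImage val X)

/-- In an ordered field `-1` is not a square; this makes `R(i)` below a field. -/
instance factNegOneNotSquare {R : Type*} [Field R] [LinearOrder R] [IsStrictOrderedRing R] :
    Fact (∀ r : R, r ^ 2 ≠ (-1) + 0 * r) :=
  ⟨fun r h => by nlinarith [sq_nonneg r]⟩

/-- The extension `R(i)`, `i² = -1`, with elements `z = z.re + i * z.im`.  Its `star` operation is
complex conjugation `a + i b ↦ a - i b`. -/
abbrev Cx (R : Type*) [Field R] : Type _ := QuadraticAlgebra R (-1) 0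

/-- The extension of `val` to `R(i)`: `val (a + i b) = min (val a) (val b)`, equivalently
`ν (a + i b) = max (ν a) (ν b)`. -/
def cxVal {R : Type*} [Field R] (val : R → WithTop ℝ) (z : Cx R) : WithTop ℝ :=
  min (val z.re) (val z.im)

/-! ### Principal minors of positive definite matrices -/

/-- The principal minor `A_S` (equal to `1` for `S = ∅`). -/
def principalMinor {K : Type*} [CommRing K] {n : ℕ} (A : Matrix (Fin n) (Fin n) K)
    (S : Finset (Fin n)) : K :=
  (A.submatrix (fun i : S => (i : Fin n)) (fun i : S => (i : Fin n))).det

/-- Principal-minor vectors of positive definite symmetric `n × n` matrices over `R`; a symmetric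
matrix is positive definite if all of its principal minors are positive. -/
def PMReal (R : Type*) [Field R] [LinearOrder R] (n : ℕ) : Set (Finset (Fin n) → R) :=
  {a | ∃ A : Matrix (Fin n) (Fin n) R, A.IsSymm ∧
    ∀ S, 0 < a S ∧ principalMinor A S = a S}

/-- Principal-minor vectors in `R^(2^[n])` of positive definite Hermitian `n × n` matrices over
`R(i)`; a Hermitian matrix is positive definite if all of its principal minors (which lie in `R`)
are positive. -/
def PMComplex (R : Type*) [Field R] [LinearOrder R] (n : ℕ) : Set (Finset (Fin n) → R) :=
  {a | ∃ A : Matrix (Fin n) (Fin n) (Cx R), A.IsHermitian ∧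
    ∀ S, 0 < a S ∧ principalMinor A S = algebraMap R (Cx R) (a S)}

/-- `cone(P) = {c a : c ∈ K, a ∈ P} ⊆ K^ι`, for a set `P ⊆ R^ι` and an extension `K` of `R`. -/
def coneOver {R ι : Type*} (K : Type*) [CommRing R] [CommRing K] [Algebra R K]
    (P : Set (ι → R)) : Set (ι → K) :=
  {x | ∃ c : K, ∃ a ∈ P, x = fun i => c * algebraMap R K (a i)}

/-! ### Grassmannian and flag variety -/

/-- The `k`-element subsets of `[m]`. -/
abbrev KSubset (m k : ℕ) : Type := {S : Finset (Fin m) // S.card = k}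

/-- The maximal minor of a `k × m` matrix on the columns in `S`, taken in increasing order. -/
def maxMinor {K : Type*} [CommRing K] {k m : ℕ} (M : Matrix (Fin k) (Fin m) K)
    (S : KSubset m k) : K :=
  (M.submatrix id (S.1.orderEmbOfFin S.2)).det

/-- `p` is a vector of Plücker coordinates of the `k`-dimensional subspace `L ⊆ K^m`: up to a
nonzero scalar, it is the vector of maximal minors of a matrix whose rows form a basis of `L`. -/
def IsPluckerVector {K : Type*} [Field K] {k m : ℕ} (L : Submodule K (Fin m → K))
    (p : KSubset m k → K) : Prop :=
  ∃ M : Matrix (Fin k) (Fin m) K, LinearIndependent K (fun i => M i) ∧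
    Submodule.span K (Set.range fun i => M i) = L ∧
    ∃ c : K, c ≠ 0 ∧ ∀ S, p S = c * maxMinor M S

/-- The Grassmannian of `k`-dimensional subspaces of `K^m` in its Plücker embedding (as the set of
all vectors of Plücker coordinates). -/
def grassmannian (K : Type*) [Field K] (k m : ℕ) : Set (KSubset m k → K) :=
  {p | ∃ L : Submodule K (Fin m → K), IsPluckerVector L p}

/-- The complete affine flag variety: vectors `(q_S)` such that for some complete flag
`L_0 ⊆ L_1 ⊆ ⋯ ⊆ L_n` in `K^n` with `dim L_k = k`, each `(q_S : |S| = k)` is a vector of Plücker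
coordinates of `L_k`.  The components for different `k` are scaled independently. -/
def affineFlagVariety (K : Type*) [Field K] (n : ℕ) : Set (Finset (Fin n) → K) :=
  {q | ∃ L : Fin (n + 1) → Submodule K (Fin n → K), Monotone L ∧
    ∀ k : Fin (n + 1), IsPluckerVector (k := (k : ℕ)) (L k) (fun S => q S.1)}

/-! ### The linear space `L_n` and the submodular cone -/

/-- `C ∩ [n]` for `C ⊆ [2n]`, as a subset of `[n]`. -/
def lowPart {n : ℕ} (C : Finset (Fin (n + n))) : Finset (Fin n) :=
  Finset.univ.filter fun i => Fin.castAdd n i ∈ C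

/-- The subspace `L_n` of all `p : binom([2n], n) → ℝ` such that `p C = p D` whenever
`C ∩ [n] = D ∩ [n]`. -/
def spaceL (n : ℕ) : Submodule ℝ (KSubset (n + n) n → ℝ) where
  carrier := {p | ∀ C D : KSubset (n + n) n, lowPart C.1 = lowPart D.1 → p C = p D}
  add_mem' := fun hp hq C D h => by simp [hp C D h, hq C D h]
  zero_mem' := fun _ _ _ => rfl
  smul_mem' := fun c p hp C D h => by simp [hp C D h]

/-- The `n`-subset `S ∪ T` of `[2n]`, with `T = {n + j : j ∉ S}`. -/
def fillUp {n : ℕ} (S : Finset (Fin n)) : KSubset (n + n) n :=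
  ⟨(S.map (Fin.castAddEmb n)).disjUnion (Sᶜ.map (Fin.natAddEmb n)) (by
      rw [Finset.disjoint_left]
      intro x hx hy
      simp only [Finset.mem_map] at hx hy
      obtain ⟨a, _, rfl⟩ := hx
      obtain ⟨b, _, hb⟩ := hy
      have := congrArg Fin.val hb
      simp at this
      omega),
    by
      rw [Finset.card_disjUnion, Finset.card_map, Finset.card_map, Finset.card_add_card_compl,
        Fintype.card_fin]⟩

theorem lowPart_fillUp {n : ℕ} (S : Finset (Fin n)) : lowPart (fillUp S).1 = S := by
  ext i
  simp only [lowPart, fillUp, Finset.mem_filter, Finset.mem_univ, true_and,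
    Finset.mem_disjUnion, Finset.mem_map]
  constructor
  · rintro (⟨a, ha, h⟩ | ⟨b, _, h⟩)
    · have := congrArg Fin.val h
      simp at this
      rwa [← Fin.ext this]
    · have := congrArg Fin.val h
      simp at this
      omega
  · exact fun h => Or.inl ⟨i, h, rfl⟩

/-- The identification `φ : L_n ≅ ℝ^(2^[n])`, `φ p S = p (S ∪ T)` for any `T ⊆ {n+1, …, 2n}` of
size `n - |S|`.  Its inverse sends `w` to `C ↦ w (C ∩ [n])`. -/
def phiL (n : ℕ) : spaceL n ≃ₗ[ℝ] (Finset (Fin n) → ℝ) where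
  toFun p S := p.1 (fillUp S)
  map_add' _ _ := rfl
  map_smul' _ _ := rfl
  invFun w := ⟨fun C => w (lowPart C.1), fun _ _ h => congrArg w h⟩
  left_inv p := by
    ext C
    exact p.2 _ _ (lowPart_fillUp _)
  right_inv w := by
    funext S
    exact congrArg w (lowPart_fillUp S)

/-- The set `X ∩ L_n`, viewed as a subset of `ℝ^(2^[n])` through `φ`. -/
def interL {n : ℕ} (X : Set (KSubset (n + n) n → ℝ)) : Set (Finset (Fin n) → ℝ) :=
  phiL n '' {p : spaceL n | (p : KSubset (n + n) n → ℝ) ∈ X}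

/-- The cone `SUBMOD_n` of submodular functions on `2^[n]`. -/
def submodularCone (n : ℕ) : Set (Finset (Fin n) → ℝ) :=
  {F | ∀ S T : Finset (Fin n), F (S ∩ T) + F (S ∪ T) ≤ F S + F T}

/-! ### Real closed fields: `R(i)` is algebraically closed -/

section AlgClosed

open Polynomial IntermediateField

variable {R : Type*} [Field R] [LinearOrder R] [IsStrictOrderedRing R]

/-! Write `w` for the valuation on `K`, where `K` is `R` or `R(i)`. All three sets are compared with
one notion, `IsUniform`: `F` is uniform if some square matrix `B` has, up to a common shift, value
`-F(S)` on every minor with column set `S`, whatever its rows.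

Grassmannian: a point with nonzero coordinates is the row space of some `[B | 1]`, whose maximal
minors are, up to sign, the minors of `B`. Lying in `L_n` says that their values do not depend on
the rows, so the middle set consists of the uniform `F`.

Mixing (`exists_generic_mixing`): nonzero integers have value `0`, so the residue field has
characteristic zero. Hence some integer matrix `U` makes every minor of `U * B` attain the least
value among the minors of `B` on the same columns.

Flags: the leading rows of a uniform matrix span a flag, and the ultrametric inequality in the
three-term determinant identity gives submodularity. Conversely, a uniform matrix with rows in `L_k`
is enlarged by a vector of `L_{k+1}` vanishing on the first `k` columns. Submodularity and the
three-term identity bound the new minors from below (`le_minorVal_of_submodular`), and mixing makes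
the enlarged matrix uniform (`exists_uniform_rows`).

Positive definite matrices: by Cholesky `A = Bᴴ * B`, and by Cauchy–Binet `A_S` is a sum of norms of
minors of `B`. Nonnegative terms do not cancel, so `v(A_S)` is twice the least value of a minor on
the columns `S`. After mixing, `F` comes from the cone iff `F / 2` is uniform. What remains is that
`F` is uniform iff `F / 2` is.

That last equivalence is the deep part. Uniformity prescribes the values of finitely many integral
polynomials, so it suffices to move such values between `R` with a rescaled valuation and `R` itself
(`exists_point_val_eq`). For this, a countable subfield containing the given points is embedded in
an ultrapower of `R`, preserving signs and values. Transcendental elements are added by saturation.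
For algebraic ones, roots exist because the signature of a trace form counts real embeddings. The
complex case reduces to real and imaginary parts.

For closures, mixing moves a Grassmannian point near `L_n` into `L_n`, and a flag point near a
submodular function becomes submodular after subtracting a small multiple of the strictly
supermodular function `|S|²`. Only this perturbation needs a nontrivial valuation. -/

theorem Cx.isSquare [IsRealClosed R] (z : Cx R) : IsSquare z := by
  obtain ⟨a, b⟩ := z
  obtain ⟨N, hN⟩ := IsSquare.of_nonneg (show 0 ≤ a ^ 2 + b ^ 2 by positivity)
  wlog hN0 : 0 ≤ N generalizing N
  · exact this (-N) (by rw [hN]; ring) (by linarith)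
  have haN : |a| ≤ N := abs_le_of_sq_le_sq (by nlinarith [sq_nonneg b]) hN0
  obtain ⟨h1, h2⟩ := abs_le.1 haN
  -- Real and imaginary part of the root up to sign: `u² - w² = a` and `2uw = ±b`, the sign being
  -- settled by the two cases below.
  obtain ⟨u, hu⟩ := IsSquare.of_nonneg (show 0 ≤ (N + a) / 2 by linarith)
  obtain ⟨w, hw⟩ := IsSquare.of_nonneg (show 0 ≤ (N - a) / 2 by linarith)
  have huw : (2 * u * w) ^ 2 = b ^ 2 := by
    have : (2 * u * w) ^ 2 = 4 * (u * u) * (w * w) := by ring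
    rw [this, ← hu, ← hw]; linear_combination -hN
  rcases sq_eq_sq_iff_eq_or_eq_neg.1 huw with h | h
  · refine ⟨⟨u, w⟩, ?_⟩
    ext
    · simp; linear_combination hu - hw
    · simp; linear_combination -h
  · refine ⟨⟨u, -w⟩, ?_⟩
    ext
    · simp; linear_combination hu - hw
    · simp; linear_combination h

/-- Minimal polynomials have odd degree, hence a root in `R`, and an irreducible polynomial with a
root is linear. -/
theorem finrank_eq_one_of_odd [IsRealClosed R] {L : Type*} [Field L] [Algebra R L]
    [FiniteDimensional R L] (h : Odd (Module.finrank R L)) : Module.finrank R L = 1 := by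
  rw [Algebra.finrank_eq_one_iff_bijective_algebraMap]
  refine ⟨(algebraMap R L).injective, fun x => ?_⟩
  have hint : IsIntegral R x := Algebra.IsIntegral.isIntegral x
  have hdvd : (minpoly R x).natDegree ∣ Module.finrank R L := by
    rw [← IntermediateField.adjoin.finrank hint]
    exact ⟨_, (Module.finrank_mul_finrank R R⟮x⟯ L).symm⟩
  obtain ⟨r, hr⟩ := IsRealClosed.exists_isRoot_of_odd_natDegree (Odd.of_dvd_nat h hdvd)
  exact minpoly.mem_range_of_degree_eq_one R x
    (degree_eq_one_of_irreducible_of_root (minpoly.irreducible hint) hr)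

/-- Artin's argument: the fixed field of a Sylow 2-subgroup has odd degree over `R`, so the whole
degree is a power of two. A proper extension of `R(i)` would then contain a quadratic one,
impossible as every element of `R(i)` is a square. -/
theorem finrank_cx_eq_one [IsRealClosed R] {L : Type*} [Field L] [Algebra R L]
    [FiniteDimensional R L] [IsGalois R L] [Algebra (Cx R) L] [IsScalarTower R (Cx R) L] :
    Module.finrank (Cx R) L = 1 := by
  classical
  have hpow : ∃ k, Module.finrank R L = 2 ^ k := by
    let P : Sylow 2 (Gal(L/R)) := default
    have h1 : Module.finrank (fixedField (P : Subgroup Gal(L/R))) L = Nat.card P :=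
      finrank_fixedField_eq_card _
    obtain ⟨k, hk⟩ := IsPGroup.iff_card.1 P.2
    have h2 := Module.finrank_mul_finrank R (fixedField (P : Subgroup Gal(L/R))) L
    have h3 : Nat.card P * (P : Subgroup Gal(L/R)).index = Module.finrank R L := by
      rw [← IsGalois.card_aut_eq_finrank]; exact Subgroup.card_mul_index _
    have h4 : Module.finrank R (fixedField (P : Subgroup Gal(L/R))) =
        (P : Subgroup Gal(L/R)).index := by
      have h0 : 0 < Nat.card P := Nat.card_pos
      rw [h1, ← h3, mul_comm] at h2
      exact Nat.eq_of_mul_eq_mul_left h0 h2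
    have h5 : Odd (Module.finrank R (fixedField (P : Subgroup Gal(L/R)))) := by
      rw [h4, ← Nat.not_even_iff_odd, even_iff_two_dvd]
      exact P.not_dvd_index
    rw [finrank_eq_one_of_odd h5, one_mul, h1] at h2
    exact ⟨k, by rw [← h2]; exact hk⟩
  obtain ⟨k, hk⟩ := hpow
  have : FiniteDimensional (Cx R) L := FiniteDimensional.right R (Cx R) L
  have : IsGalois (Cx R) L := IsGalois.tower_top_of_isGalois R (Cx R) L
  have hdvd : Module.finrank (Cx R) L ∣ 2 ^ k :=
    ⟨Module.finrank R (Cx R), by rw [← hk, mul_comm]; exact (Module.finrank_mul_finrank R (Cx R) L).symm⟩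
  obtain ⟨j, -, hj⟩ := (Nat.dvd_prime_pow Nat.prime_two).1 hdvd
  rcases j with _ | j
  · simpa using hj
  exfalso
  obtain ⟨N, hN⟩ := Sylow.exists_subgroup_card_pow_prime (G := Gal(L/(Cx R))) 2 (n := j)
    (by rw [IsGalois.card_aut_eq_finrank, hj]; exact pow_dvd_pow 2 (Nat.le_succ j))
  have h1 : Module.finrank (fixedField N) L = 2 ^ j := by
    rw [finrank_fixedField_eq_card, hN]
  have h2 : Module.finrank (Cx R) (fixedField N) = 2 := by
    have := Module.finrank_mul_finrank (Cx R) (fixedField N) L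
    rw [h1, hj, pow_succ, mul_comm] at this
    exact Nat.eq_of_mul_eq_mul_left (by positivity) this
  have h3 : ¬ Function.Surjective (algebraMap (Cx R) (fixedField N)) := fun h => by
    have := Algebra.finrank_eq_one_iff_bijective_algebraMap.2
      ⟨(algebraMap (Cx R) (fixedField N)).injective, h⟩
    omega
  refine h3 fun x => ?_
  have hint : IsIntegral (Cx R) x := Algebra.IsIntegral.isIntegral x
  have hle : (minpoly (Cx R) x).natDegree ≤ 2 := h2 ▸ minpoly.natDegree_le x
  have h0 : 0 < (minpoly (Cx R) x).natDegree := minpoly.natDegree_pos hint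
  rcases (show (minpoly (Cx R) x).natDegree = 1 ∨ (minpoly (Cx R) x).natDegree = 2 by omega)
    with hd | hd
  · exact minpoly.mem_range_of_degree_eq_one _ x ((degree_eq_iff_natDegree_eq_of_pos one_pos).2 hd)
  have hm : (minpoly (Cx R) x).coeff 2 = 1 := by rw [← hd]; exact minpoly.monic hint
  have hx := minpoly.aeval (Cx R) x
  rw [aeval_eq_sum_range, hd] at hx
  simp only [Finset.sum_range_succ, Finset.sum_range_zero, hm] at hx
  simp only [Algebra.smul_def] at hx
  generalize (minpoly (Cx R) x).coeff 0 = q at hx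
  generalize (minpoly (Cx R) x).coeff 1 = p at hx
  obtain ⟨d, hd⟩ := Cx.isSquare (p ^ 2 / 4 - q)
  have h4 : (x + algebraMap (Cx R) _ (p / 2)) ^ 2 = (algebraMap (Cx R) _ d) ^ 2 := by
    rw [← map_pow, sq d, ← hd]
    simp only [map_sub, map_div₀, map_pow, map_ofNat]
    simp only [map_one] at hx
    linear_combination hx
  rcases sq_eq_sq_iff_eq_or_eq_neg.1 h4 with h | h
  · exact ⟨d - p / 2, by rw [map_sub]; linear_combination -h⟩
  · exact ⟨-d - p / 2, by rw [map_sub, map_neg]; linear_combination -h⟩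

theorem splits_map_cx [IsRealClosed R] (f : R[X]) : (f.map (algebraMap R (Cx R))).Splits := by
  by_cases hf : f = 0
  · simp [hf]
  -- The extra factor puts a square root of `-1` into the splitting field, so that `R(i)` maps to
  -- it.
  let g : R[X] := f * (X ^ 2 + 1)
  have hq : (X ^ 2 + 1 : R[X]) ≠ 0 := by
    intro h; simpa using congrArg (Polynomial.eval 0) h
  let L := g.SplittingField
  have hsp : (g.map (algebraMap R L)).Splits := SplittingField.splits g
  have : Normal R L := Normal.of_isSplittingField g
  have : IsGalois R L := ⟨⟩
  have hg : g.map (algebraMap R L) ≠ 0 := by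
    exact Polynomial.map_ne_zero (mul_ne_zero hf hq)
  have hsq : ((X ^ 2 + 1 : R[X]).map (algebraMap R L)).Splits :=
    hsp.of_dvd hg (Polynomial.map_dvd _ (dvd_mul_left _ _))
  have hsf : (f.map (algebraMap R L)).Splits :=
    hsp.of_dvd hg (Polynomial.map_dvd _ (dvd_mul_right _ _))
  obtain ⟨u, hu⟩ := hsq.exists_eval_eq_zero (by
    rw [Polynomial.degree_map]
    have : (X ^ 2 + 1 : R[X]).degree = 2 := by compute_degree!
    simp [this])
  simp at hu
  let φ : Cx R →ₐ[R] L := QuadraticAlgebra.lift ⟨u, by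
    rw [neg_smul, one_smul, zero_smul]; linear_combination hu⟩
  let _ : Algebra (Cx R) L := φ.toRingHom.toAlgebra
  have : IsScalarTower R (Cx R) L := IsScalarTower.of_algebraMap_eq fun r => (φ.commutes r).symm
  have hb := Algebra.finrank_eq_one_iff_bijective_algebraMap.1 (finrank_cx_eq_one (R := R) (L := L))
  let e : Cx R ≃+* L := RingEquiv.ofBijective _ hb
  have : (f.map (algebraMap R (Cx R))) = (f.map (algebraMap R L)).map (e.symm : L →+* Cx R) := by
    rw [Polynomial.map_map]
    congr 1
    ext1 r
    simp only [RingHom.comp_apply, RingHom.coe_coe]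
    rw [eq_comm, RingEquiv.symm_apply_eq]
    exact IsScalarTower.algebraMap_apply R (Cx R) L r
  rw [this]
  exact hsf.map _

/-- A root of an irreducible `p` is integral over `R`, so `p` divides a polynomial with coefficients
in `R`, which splits over `R(i)`. -/
instance Cx.isAlgClosed [IsRealClosed R] : IsAlgClosed (Cx R) := by
  refine IsAlgClosed.of_exists_root _ fun p hm hp => ?_
  let Ω := AlgebraicClosure (Cx R)
  obtain ⟨x, hx⟩ := IsAlgClosed.exists_aeval_eq_zero Ω p (by
    exact (Polynomial.degree_pos_of_irreducible hp).ne')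
  have hint : IsIntegral R x := by
    have h1 : IsIntegral (Cx R) x := Algebra.IsIntegral.isIntegral x
    exact isIntegral_trans x h1
  have hs := splits_map_cx (minpoly R x)
  have hne : (minpoly R x).map (algebraMap R (Cx R)) ≠ 0 :=
    Polynomial.map_ne_zero (minpoly.ne_zero hint)
  have hd : p ∣ (minpoly R x).map (algebraMap R (Cx R)) := by
    rw [minpoly.eq_of_irreducible_of_monic hp hx hm]
    exact minpoly.dvd_map_of_isScalarTower R (Cx R) x
  have := hs.of_dvd hne hd
  obtain ⟨y, hy⟩ := this.exists_eval_eq_zero (Polynomial.degree_pos_of_irreducible hp).ne'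
  exact ⟨y, hy⟩

end AlgClosed

/-! ### Signatures of trace forms and roots in real closed extensions -/

section TraceForm

open Polynomial

/-- A dimension count, used as in Sylvester's law of inertia: `P` holds the coordinates where a
diagonal form has one sign, `S` indexes the linear forms to be killed. -/
theorem exists_ne_zero_forall_eq_zero {K ι κ : Type*} [Field K] [Fintype ι] [DecidableEq ι]
    (P : Finset ι) (S : Finset κ) (h : S.card < P.card) (f : κ → (ι → K) →ₗ[K] K) :
    ∃ t : ι → K, t ≠ 0 ∧ (∀ i ∉ P, t i = 0) ∧ ∀ k ∈ S, f k t = 0 := by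
  let ext : (P → K) →ₗ[K] (ι → K) :=
    { toFun := fun u i => if hi : i ∈ P then u ⟨i, hi⟩ else 0
      map_add' := fun u v => by ext i; by_cases hi : i ∈ P <;> simp [hi]
      map_smul' := fun c u => by ext i; by_cases hi : i ∈ P <;> simp [hi] }
  let g : (P → K) →ₗ[K] (S → K) := LinearMap.pi fun k => (f k).comp ext
  have hk := LinearMap.ker_ne_bot_of_finrank_lt (f := g) (by simpa using h)
  obtain ⟨u, hu, hu0⟩ := Submodule.exists_mem_ne_zero_of_ne_bot hk
  refine ⟨ext u, fun h0 => hu0 ?_, fun i hi => by simp [ext, hi], fun k hk' => ?_⟩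
  · ext i
    have := congrFun h0 i
    simpa [ext] using this
  · exact congrFun (LinearMap.mem_ker.1 hu) ⟨k, hk'⟩

variable {E L K : Type*} [Field E] [Field L] [Algebra E L] [Field K] [LinearOrder K]
  [IsStrictOrderedRing K] [Algebra E K]

/-- The complex conjugate of an embedding into `K(i)`. -/
def conjEmbedding (σ : L →ₐ[E] Cx K) : L →ₐ[E] Cx K :=
  { (starRingEnd (Cx K)).comp σ.toRingHom with
    commutes' := fun r => by
      have : σ (algebraMap E L r) = algebraMap E (Cx K) r := σ.commutes r
      simp only [RingHom.toMonoidHom_eq_coe, OneHom.toFun_eq_coe, MonoidHom.toOneHom_coe,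
        MonoidHom.coe_coe, RingHom.comp_apply, AlgHom.toRingHom_eq_coe, RingHom.coe_coe, this,
        starRingEnd_apply]
      rw [IsScalarTower.algebraMap_apply E K (Cx K)]
      ext <;> simp }

theorem conjEmbedding_apply (σ : L →ₐ[E] Cx K) (x : L) : conjEmbedding σ x = star (σ x) := rfl

theorem re_conjEmbedding (σ : L →ₐ[E] Cx K) (x : L) : (conjEmbedding σ x).re = (σ x).re := by
  simp [conjEmbedding_apply]

theorem im_conjEmbedding (σ : L →ₐ[E] Cx K) (x : L) : (conjEmbedding σ x).im = -(σ x).im := by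
  simp [conjEmbedding_apply]

theorem conjEmbedding_conjEmbedding (σ : L →ₐ[E] Cx K) : conjEmbedding (conjEmbedding σ) = σ := by
  ext x <;> simp [conjEmbedding_apply]

variable {ι : Type*} [Fintype ι] (b : ι → L)

theorem re_linearCombination_conj (σ : L →ₐ[E] Cx K) (t : ι → K) :
    (Fintype.linearCombination K (fun i => conjEmbedding σ (b i)) t).re =
      (Fintype.linearCombination K (fun i => σ (b i)) t).re := by
  have h : ∀ z : Cx K, z.re = QuadraticAlgebra.reₗ (-1) 0 z := fun _ => rfl
  simp only [Fintype.linearCombination_apply, h, map_sum]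
  refine Finset.sum_congr rfl fun i _ => ?_
  rw [← h, ← h, QuadraticAlgebra.re_smul, QuadraticAlgebra.re_smul, re_conjEmbedding]

theorem im_linearCombination_conj (σ : L →ₐ[E] Cx K) (t : ι → K) :
    (Fintype.linearCombination K (fun i => conjEmbedding σ (b i)) t).im =
      -(Fintype.linearCombination K (fun i => σ (b i)) t).im := by
  have h : ∀ z : Cx K, z.im = QuadraticAlgebra.imₗ (-1) 0 z := fun _ => rfl
  simp only [Fintype.linearCombination_apply, h, map_sum, ← Finset.sum_neg_distrib]
  refine Finset.sum_congr rfl fun i _ => ?_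
  rw [← h, ← h, QuadraticAlgebra.im_smul, QuadraticAlgebra.im_smul, im_conjEmbedding]
  simp

variable [FiniteDimensional E L] [CharZero E] [IsRealClosed K]

/-- The trace is the sum over the embeddings into `K(i)`, so orthogonality of the `b i` isolates the
coordinate `t j`. -/
theorem sum_embeddings_mul (hb : ∀ i j, i ≠ j → Algebra.trace E L (b i * b j) = 0)
    (t : ι → K) (j : ι) :
    ∑ σ : L →ₐ[E] Cx K, Fintype.linearCombination K (fun i => σ (b i)) t * σ (b j) =
      algebraMap K (Cx K) (algebraMap E K (Algebra.trace E L (b j * b j)) * t j) := by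
  classical
  simp only [Fintype.linearCombination_apply, Finset.sum_mul]
  rw [Finset.sum_comm]
  rw [Finset.sum_eq_single j]
  · rw [map_mul, ← IsScalarTower.algebraMap_apply E K (Cx K), trace_eq_sum_embeddings (Cx K),
      Finset.sum_mul]
    refine Finset.sum_congr rfl fun σ _ => ?_
    rw [map_mul, Algebra.smul_def]; ring
  · intro i _ hij
    have : ∀ σ : L →ₐ[E] Cx K, (t i • σ (b i)) * σ (b j) = algebraMap K (Cx K) (t i) * σ (b i * b j) := by
      intro σ; rw [map_mul, Algebra.smul_def]; ring
    simp only [this]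
    rw [← Finset.mul_sum, ← trace_eq_sum_embeddings (Cx K), hb i j hij]; simp
  · simp

theorem sum_embeddings_sq (hb : ∀ i j, i ≠ j → Algebra.trace E L (b i * b j) = 0) (t : ι → K) :
    ∑ σ : L →ₐ[E] Cx K, (Fintype.linearCombination K (fun i => σ (b i)) t) ^ 2 =
      algebraMap K (Cx K) (∑ j, algebraMap E K (Algebra.trace E L (b j * b j)) * t j ^ 2) := by
  have : ∀ σ : L →ₐ[E] Cx K, (Fintype.linearCombination K (fun i => σ (b i)) t) ^ 2 =
      ∑ j, algebraMap K (Cx K) (t j) * 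
        (Fintype.linearCombination K (fun i => σ (b i)) t * σ (b j)) := by
    intro σ
    conv_lhs => rw [sq, Fintype.linearCombination_apply K (fun i => σ (b i)), Finset.mul_sum]
    refine Finset.sum_congr rfl fun j _ => ?_
    rw [← Fintype.linearCombination_apply K (fun i => σ (b i)), Algebra.smul_def]; ring
  simp only [this]
  rw [Finset.sum_comm, map_sum]
  refine Finset.sum_congr rfl fun j _ => ?_
  rw [← Finset.mul_sum, sum_embeddings_mul b hb, ← map_mul]
  congr 1; ring

/-- The signature becomes visible here: a real embedding contributes one square, a conjugate pair
contributes twice a difference of two squares. -/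
theorem sum_trace_sq_eq (hb : ∀ i j, i ≠ j → Algebra.trace E L (b i * b j) = 0) (t : ι → K) :
    ∑ j, algebraMap E K (Algebra.trace E L (b j * b j)) * t j ^ 2 =
      ∑ σ : L →ₐ[E] Cx K, (((Fintype.linearCombination K (fun i => σ (b i)) t).re) ^ 2 -
        ((Fintype.linearCombination K (fun i => σ (b i)) t).im) ^ 2) := by
  have h := congrArg (QuadraticAlgebra.reₗ (-1) 0) (sum_embeddings_sq b hb t)
  rw [map_sum] at h
  refine Eq.trans (Eq.symm ?_) (h.symm.trans ?_)
  · rfl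
  · refine Finset.sum_congr rfl fun σ _ => ?_
    change (_ ^ 2 : Cx K).re = _
    rw [sq, QuadraticAlgebra.re_mul]; ring

theorem eq_zero_of_linearCombination_eq_zero
    (hb : ∀ i j, i ≠ j → Algebra.trace E L (b i * b j) = 0)
    (hb0 : ∀ i, Algebra.trace E L (b i * b i) ≠ 0) (t : ι → K)
    (ht : ∀ σ : L →ₐ[E] Cx K, Fintype.linearCombination K (fun i => σ (b i)) t = 0) : t = 0 := by
  ext j
  have h := sum_embeddings_mul b hb t j
  simp only [ht, zero_mul, Finset.sum_const_zero] at h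
  have h2 := (map_eq_zero (algebraMap K (Cx K))).1 h.symm
  simpa [hb0 j] using h2

/-- If the primitive element `a` has no real embedding, at most half of the diagonal entries of the
trace form are nonnegative. -/
theorem card_nonneg_le (hb : ∀ i j, i ≠ j → Algebra.trace E L (b i * b j) = 0)
    (hb0 : ∀ i, Algebra.trace E L (b i * b i) ≠ 0) (a : L)
    (ha : ∀ σ : L →ₐ[E] Cx K, (σ a).im ≠ 0) :
    (Finset.univ.filter fun i => 0 ≤ algebraMap E K (Algebra.trace E L (b i * b i))).card ≤
      (Finset.univ.filter fun σ : L →ₐ[E] Cx K => 0 < (σ a).im).card := by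
  classical
  by_contra! hlt
  -- Otherwise some nonzero `t`, supported on the nonnegative entries, makes every embedded
  -- combination purely imaginary. The form is then both nonnegative and minus a sum of squares at
  -- `t`.
  obtain ⟨t, ht0, htP, htS⟩ := exists_ne_zero_forall_eq_zero _ _ hlt
    (fun σ : L →ₐ[E] Cx K => (QuadraticAlgebra.reₗ (-1) 0).comp
      (Fintype.linearCombination K (fun i => σ (b i))))
  have hre : ∀ σ : L →ₐ[E] Cx K, (Fintype.linearCombination K (fun i => σ (b i)) t).re = 0 := by
    intro σ
    rcases lt_or_gt_of_ne (ha σ) with h | h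
    · rw [← re_linearCombination_conj]
      exact htS _ (by simpa [im_conjEmbedding] using h)
    · exact htS σ (by simpa using h)
  have h := sum_trace_sq_eq b hb t
  have h1 : 0 ≤ ∑ j, algebraMap E K (Algebra.trace E L (b j * b j)) * t j ^ 2 := by
    refine Finset.sum_nonneg fun j _ => ?_
    by_cases hj : 0 ≤ algebraMap E K (Algebra.trace E L (b j * b j))
    · positivity
    · rw [htP j (by simpa using hj)]; simp
  rw [h] at h1
  simp only [hre] at h1
  have h2 : ∑ σ : L →ₐ[E] Cx K,
      (Fintype.linearCombination K (fun i => σ (b i)) t).im ^ 2 = 0 := by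
    refine le_antisymm ?_ (Finset.sum_nonneg fun _ _ => sq_nonneg _)
    simpa using h1
  rw [Finset.sum_eq_zero_iff_of_nonneg fun _ _ => sq_nonneg _] at h2
  refine ht0 (eq_zero_of_linearCombination_eq_zero b hb hb0 t fun σ => ?_)
  ext
  · simpa using hre σ
  · simpa using h2 σ (Finset.mem_univ _)

/-- At most as many diagonal entries of the trace form are nonpositive as there are
pairs of complex conjugate embeddings. -/
theorem card_nonpos_le (hb : ∀ i j, i ≠ j → Algebra.trace E L (b i * b j) = 0)
    (hb0 : ∀ i, Algebra.trace E L (b i * b i) ≠ 0) (a : L)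
    (ha : ∀ σ τ : L →ₐ[E] Cx K, σ a = τ a → σ = τ) :
    (Finset.univ.filter fun i => algebraMap E K (Algebra.trace E L (b i * b i)) ≤ 0).card ≤
      (Finset.univ.filter fun σ : L →ₐ[E] Cx K => 0 < (σ a).im).card := by
  classical
  by_contra! hlt
  obtain ⟨t, ht0, htP, htS⟩ := exists_ne_zero_forall_eq_zero _ _ hlt
    (fun σ : L →ₐ[E] Cx K => (QuadraticAlgebra.imₗ (-1) 0).comp
      (Fintype.linearCombination K (fun i => σ (b i))))
  have him : ∀ σ : L →ₐ[E] Cx K, (Fintype.linearCombination K (fun i => σ (b i)) t).im = 0 := by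
    intro σ
    rcases lt_trichotomy (σ a).im 0 with h | h | h
    · rw [← neg_eq_zero, ← im_linearCombination_conj]
      exact htS _ (by simpa [im_conjEmbedding] using h)
    -- An embedding that is real on `a` is its own conjugate, so its combination has no imaginary
    -- part and imposes no condition.
    · have : conjEmbedding σ = σ := ha _ _ (by
        ext
        · rw [re_conjEmbedding]
        · rw [im_conjEmbedding, h, neg_zero])
      have h2 := im_linearCombination_conj b σ t
      rw [this] at h2
      linarith
    · exact htS σ (by simpa using h)
  have h := sum_trace_sq_eq b hb t
  have h1 : ∑ j, algebraMap E K (Algebra.trace E L (b j * b j)) * t j ^ 2 ≤ 0 := by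
    refine Finset.sum_nonpos fun j _ => ?_
    by_cases hj : algebraMap E K (Algebra.trace E L (b j * b j)) ≤ 0
    · exact mul_nonpos_of_nonpos_of_nonneg hj (sq_nonneg _)
    · rw [htP j (by simpa using hj)]; simp
  rw [h] at h1
  simp only [him] at h1
  have h2 : ∑ σ : L →ₐ[E] Cx K,
      (Fintype.linearCombination K (fun i => σ (b i)) t).re ^ 2 = 0 := by
    refine le_antisymm ?_ (Finset.sum_nonneg fun _ _ => sq_nonneg _)
    simpa using h1
  rw [Finset.sum_eq_zero_iff_of_nonneg fun _ _ => sq_nonneg _] at h2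
  refine ht0 (eq_zero_of_linearCombination_eq_zero b hb hb0 t fun σ => ?_)
  ext
  · simpa using h2 σ (Finset.mem_univ _)
  · simpa using him σ

theorem card_im_pos_add_le (a : L) :
    2 * (Finset.univ.filter fun σ : L →ₐ[E] Cx K => 0 < (σ a).im).card +
      (Finset.univ.filter fun σ : L →ₐ[E] Cx K => (σ a).im = 0).card = Module.finrank E L := by
  classical
  have h1 : (Finset.univ.filter fun σ : L →ₐ[E] Cx K => (σ a).im < 0).card =
      (Finset.univ.filter fun σ : L →ₐ[E] Cx K => 0 < (σ a).im).card := by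
    refine Finset.card_bij' (fun σ _ => conjEmbedding σ) (fun σ _ => conjEmbedding σ) ?_ ?_ ?_ ?_
    · intro σ hσ; simpa [im_conjEmbedding] using hσ
    · intro σ hσ; simpa [im_conjEmbedding] using hσ
    · intro σ _; exact conjEmbedding_conjEmbedding σ
    · intro σ _; exact conjEmbedding_conjEmbedding σ
  rw [← AlgHom.card E L (Cx K), ← Finset.card_univ, two_mul]
  nth_rewrite 1 [← h1]
  rw [← Finset.card_union_of_disjoint, ← Finset.card_union_of_disjoint]
  · congr 1
    ext σ
    simp only [Finset.mem_union, Finset.mem_filter, Finset.mem_univ, true_and, iff_true]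
    rcases lt_trichotomy (σ a).im 0 with h | h | h <;> simp [h]
  · rw [Finset.disjoint_left]
    intro σ hσ h2
    simp only [Finset.mem_union, Finset.mem_filter, Finset.mem_univ, true_and] at hσ h2
    rcases hσ with h | h <;> exact absurd h2 (by first | exact h.ne | exact h.ne')
  · rw [Finset.disjoint_left]
    intro σ hσ h2
    simp only [Finset.mem_filter, Finset.mem_univ, true_and] at hσ h2
    exact absurd hσ h2.not_gt

end TraceForm

/-! ### Roots in real closed extensions, by comparing signatures -/

section RealRoots

open Polynomial IntermediateField

/-- Over an ordered field, whether an irreducible polynomial has a root in a real closed extension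
does not depend on the extension. -/
theorem exists_aeval_minpoly_eq_zero {E F K : Type*} [Field E] [Field F] [Field K] [CharZero E]
    [LinearOrder F] [IsStrictOrderedRing F] [IsRealClosed F]
    [LinearOrder K] [IsStrictOrderedRing K] [IsRealClosed K] [Algebra E F] [Algebra E K]
    (hsign : ∀ c : E, 0 < algebraMap E F c → 0 < algebraMap E K c) (x : F) (hx : IsIntegral E x) :
    ∃ y : K, aeval y (minpoly E x) = 0 := by
  classical
  by_contra! hno
  let L := E⟮x⟯
  have : FiniteDimensional E L := adjoin.finiteDimensional hx
  let a : L := AdjoinSimple.gen E x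
  have hmin : minpoly E a = minpoly E x := minpoly_gen E x
  have haK : ∀ σ : L →ₐ[E] Cx K, (σ a).im ≠ 0 := by
    intro σ h
    apply hno (σ a).re
    have h1 : σ a = algebraMap K (Cx K) (σ a).re := by ext <;> simp [h]
    have h2 : aeval (σ a) (minpoly E x) = 0 := by
      rw [← hmin, aeval_algHom_apply, minpoly.aeval, map_zero]
    rw [h1, aeval_algebraMap_apply] at h2
    exact (map_eq_zero (algebraMap K (Cx K))).1 h2
  have haF : ∀ σ τ : L →ₐ[E] Cx F, σ a = τ a → σ = τ := by
    intro σ τ h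
    exact IntermediateField.algHom_ext_of_eq_adjoin E rfl fun x1 hx1 => by
      obtain rfl := hx1
      exact h
  let : Invertible (2 : E) := invertibleOfNonzero two_ne_zero
  obtain ⟨v, hv⟩ := LinearMap.BilinForm.exists_orthogonal_basis (K := E) (V := L)
    (B := Algebra.traceForm E L) ⟨fun x y => (Algebra.traceForm_isSymm E (S := L)).eq x y⟩
  have hb : ∀ i j, i ≠ j → Algebra.trace E L (v i * v j) = 0 := fun i j hij => hv hij
  have hb0 : ∀ i, Algebra.trace E L (v i * v i) ≠ 0 := fun i =>
    hv.not_isOrtho_basis_self_of_separatingLeft (traceForm_nondegenerate E L).1 i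
  -- Without a root in `K`, at most half of the diagonal entries are nonnegative in `K`. In `F` the
  -- inclusion is a real embedding, so strictly fewer than half are nonpositive. Since positivity
  -- passes from `F` to `K`, these counts cannot cover the whole basis.
  have h1 := card_nonneg_le (K := K) v hb hb0 a haK
  have h2 := card_nonpos_le (K := F) v hb hb0 a haF
  have h3 := card_im_pos_add_le (K := K) (E := E) a
  have h4 := card_im_pos_add_le (K := F) (E := E) a
  have h5 : 0 < (Finset.univ.filter fun σ : L →ₐ[E] Cx F => (σ a).im = 0).card := by
    refine Finset.card_pos.2 ⟨(IsScalarTower.toAlgHom E F (Cx F)).comp L.val, ?_⟩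
    simp
  have h6 : (Finset.univ.filter fun i => 0 ≤ algebraMap E F (Algebra.trace E L (v i * v i))).card
      ≤ (Finset.univ.filter fun i => 0 ≤ algebraMap E K (Algebra.trace E L (v i * v i))).card := by
    refine Finset.card_le_card fun i hi => ?_
    simp only [Finset.mem_filter, Finset.mem_univ, true_and] at hi ⊢
    refine (hsign _ (lt_of_le_of_ne hi ?_)).le
    exact fun h => hb0 i ((map_eq_zero (algebraMap E F)).1 h.symm)
  have h7 : Module.finrank E L ≤
      (Finset.univ.filter fun i => 0 ≤ algebraMap E F (Algebra.trace E L (v i * v i))).card +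
      (Finset.univ.filter fun i => algebraMap E F (Algebra.trace E L (v i * v i)) ≤ 0).card := by
    refine le_trans ?_ (Finset.card_union_le _ _)
    rw [show (Finset.univ.filter fun i => 0 ≤ algebraMap E F (Algebra.trace E L (v i * v i))) ∪
      (Finset.univ.filter fun i => algebraMap E F (Algebra.trace E L (v i * v i)) ≤ 0) = Finset.univ
      from ?_]
    · simp
    · ext i
      simpa using le_total _ _
  omega

end RealRoots

/-! ### Valuations compatible with the order -/

section OrderCompatible

/-- A valuation on an ordered field is compatible with the order if it decreases on positive
elements. -/
def OrderCompatible {R : Type*} [Field R] [LinearOrder R] (v : AddValuation R (WithTop ℝ)) : Prop :=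
  ∀ a b : R, 0 < a → a < b → v b ≤ v a

theorem AddValuation.map_abs {R : Type*} [Field R] [LinearOrder R]
    (v : AddValuation R (WithTop ℝ)) (a : R) : v |a| = v a := by
  rcases abs_choice a with h | h <;> rw [h]
  exact v.map_neg a

variable {R : Type*} [Field R] [LinearOrder R] [IsStrictOrderedRing R]
  {v : AddValuation R (WithTop ℝ)}

theorem OrderCompatible.le_of_abs_le (hv : OrderCompatible v) {a b : R} (h : |a| ≤ |b|) :
    v b ≤ v a := by
  rw [← v.map_abs a, ← v.map_abs b]
  rcases (abs_nonneg a).eq_or_lt with h0 | h0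
  · rw [← h0, v.map_zero]; exact le_top
  · rcases h.eq_or_lt with h1 | h1
    · rw [h1]
    · exact hv _ _ h0 h1

theorem OrderCompatible.abs_lt_abs (hv : OrderCompatible v) {a b : R} (h : v b < v a) : |a| < |b| := by
  by_contra! h1
  exact absurd (hv.le_of_abs_le h1) h.not_ge

/-- Nonnegative elements do not cancel: the sum dominates both summands. -/
theorem OrderCompatible.map_add (hv : OrderCompatible v) {a b : R} (ha : 0 ≤ a) (hb : 0 ≤ b) :
    v (a + b) = min (v a) (v b) := by
  refine le_antisymm (le_min ?_ ?_) (v.map_add a b) <;> apply hv.le_of_abs_le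
  · rw [abs_of_nonneg ha, abs_of_nonneg (add_nonneg ha hb)]; linarith
  · rw [abs_of_nonneg hb, abs_of_nonneg (add_nonneg ha hb)]; linarith

/-- A sum of ones cannot cancel. Thus the residue characteristic is zero, as generic mixing
requires. -/
theorem OrderCompatible.map_natCast (hv : OrderCompatible v) {m : ℕ} (hm : m ≠ 0) :
    v (m : R) = 0 := by
  induction m with
  | zero => exact absurd rfl hm
  | succ m ih =>
    rcases eq_or_ne m 0 with rfl | h
    · simp
    · rw [Nat.cast_succ, hv.map_add (Nat.cast_nonneg m) zero_le_one, ih h, v.map_one, min_self]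

theorem OrderCompatible.map_ratCast (hv : OrderCompatible v) {q : ℚ} (hq : q ≠ 0) :
    v (q : R) = 0 := by
  have h1 : v (q.den : R) = 0 := hv.map_natCast q.den_ne_zero
  have h2 : v (q.num : R) = 0 := by
    rcases Int.natAbs_eq q.num with h | h <;> rw [h]
    · rw [Int.cast_natCast]; exact hv.map_natCast (by simpa using hq)
    · rw [Int.cast_neg, Int.cast_natCast, v.map_neg]; exact hv.map_natCast (by simpa using hq)
  have h3 : (q : R) * q.den = q.num := by
    rw [← Rat.cast_natCast, ← Rat.cast_mul, Rat.mul_den_eq_num, Rat.cast_intCast]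
  have := congrArg v h3
  rwa [v.map_mul, h1, h2, add_zero] at this

theorem OrderCompatible.map_half (hv : OrderCompatible v) (a : R) : v (a / 2) = v a := by
  have h2 : v (2 : R) = 0 := by simpa using hv.map_natCast (m := 2) two_ne_zero
  have := v.map_mul (a / 2) 2
  rw [div_mul_cancel₀ _ two_ne_zero, h2, add_zero] at this
  exact this.symm

/-- The term of smaller value is larger in absolute value and decides the sign. -/
theorem OrderCompatible.pos_of_add_pos (hv : OrderCompatible v) {a b : R} (h : v b < v a) :
    0 < a + b ↔ 0 < b := by
  have h1 := hv.abs_lt_abs h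
  constructor
  · intro h2
    by_contra! h3
    rw [abs_of_nonpos h3] at h1
    have := (abs_lt.1 h1).2
    linarith
  · intro h2
    rw [abs_of_pos h2] at h1
    have := (abs_lt.1 h1).1
    linarith

end OrderCompatible

/-! ### Extending order- and value-preserving configurations by one point -/

section OnePoint

variable {F R : Type*} [Field F] [LinearOrder F] [IsStrictOrderedRing F]
  [Field R] [LinearOrder R] [IsStrictOrderedRing R]
  {v' : AddValuation F (WithTop ℝ)} {v : AddValuation R (WithTop ℝ)}

/-- A finite configuration of points that preserves order and valuations of differences
can be extended by one more point. -/
theorem exists_onePoint_extension (hv' : OrderCompatible v') (hv : OrderCompatible v)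
    (hrange : ∀ a : F, ∃ b : R, v b = v' a) {ι : Type*} (s : Finset ι) (ξ : ι → F) (ρ : ι → R)
    (hlt : ∀ i ∈ s, ∀ j ∈ s, ξ i < ξ j → ρ i < ρ j)
    (hval : ∀ i ∈ s, ∀ j ∈ s, v (ρ i - ρ j) = v' (ξ i - ξ j)) (x : F) (hx : ∀ i ∈ s, x ≠ ξ i) :
    ∃ y : R, ∀ i ∈ s, (ξ i < x → ρ i < y) ∧ (x < ξ i → y < ρ i) ∧ v (y - ρ i) = v' (x - ξ i) := by
  classical
  rcases s.eq_empty_or_nonempty with rfl | hs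
  · exact ⟨0, by simp⟩
  have hle : ∀ i ∈ s, ∀ j ∈ s, ξ i ≤ ξ j → ρ i ≤ ρ j := by
    intro i hi j hj h
    rcases h.eq_or_lt with h | h
    · have := hval i hi j hj
      rw [h, sub_self, v'.map_zero, v.top_iff, sub_eq_zero] at this
      exact this.le
    · exact (hlt i hi j hj h).le
  -- `c` is a closest point to `x` in the valuation metric, and `γ` is the value of the difference
  -- for all closest points.
  obtain ⟨c, hcs, hc⟩ := s.exists_max_image (fun i => v' (x - ξ i)) hs
  set γ := v' (x - ξ c) with hγ
  obtain ⟨r0, hr0⟩ := hrange (x - ξ c)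
  have hγt : γ ≠ ⊤ := (v'.ne_top_iff).2 (sub_ne_zero.2 (hx c hcs))
  let r := |r0|
  have hr : v r = γ := by rw [v.map_abs, hr0]
  have hrpos : 0 < r := abs_pos.2 ((v.ne_top_iff).1 (by rw [hr0]; exact hγt))
  let A := s.filter fun i => v' (x - ξ i) = γ ∧ ξ i < x
  let B := s.filter fun i => v' (x - ξ i) = γ ∧ x < ξ i
  have key : ∃ y, (∀ i ∈ A, ρ i < y ∧ v (y - ρ i) = γ) ∧ (∀ i ∈ B, y < ρ i ∧ v (y - ρ i) = γ) := by
    have hAup : ∀ a ∈ A, (∀ i ∈ A, ξ i ≤ ξ a) → ∀ y, ρ a < y → v (y - ρ a) = γ →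
        ∀ i ∈ A, ρ i < y ∧ v (y - ρ i) = γ := by
      intro a ha hmax y hy hyv i hi
      have h1 := hmax i hi
      simp only [A, Finset.mem_filter] at ha hi
      have h2 := hle i hi.1 a ha.1 h1
      refine ⟨h2.trans_lt hy, ?_⟩
      rw [show y - ρ i = (y - ρ a) + (ρ a - ρ i) by ring,
        hv.map_add (sub_nonneg.2 hy.le) (sub_nonneg.2 h2), hyv, hval a ha.1 i hi.1]
      refine min_eq_left ?_
      rw [show ξ a - ξ i = (x - ξ i) - (x - ξ a) by ring]
      exact v'.map_le_sub hi.2.1.ge ha.2.1.ge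
    have hBdown : ∀ b ∈ B, (∀ i ∈ B, ξ b ≤ ξ i) → ∀ y, y < ρ b → v (y - ρ b) = γ →
        ∀ i ∈ B, y < ρ i ∧ v (y - ρ i) = γ := by
      intro a ha hmax y hy hyv i hi
      have h1 := hmax i hi
      simp only [B, Finset.mem_filter] at ha hi
      have h2 := hle a ha.1 i hi.1 h1
      refine ⟨hy.trans_le h2, ?_⟩
      rw [v.map_sub_swap, show ρ i - y = (ρ a - y) + (ρ i - ρ a) by ring,
        hv.map_add (sub_nonneg.2 hy.le) (sub_nonneg.2 h2), v.map_sub_swap, hyv, hval i hi.1 a ha.1]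
      refine min_eq_left ?_
      rw [show ξ i - ξ a = (x - ξ a) - (x - ξ i) by ring]
      exact v'.map_le_sub ha.2.1.ge hi.2.1.ge
    -- `A` and `B` are the closest points to the left and to the right of `x`. If one is empty, the
    -- new point lies at distance `r` beyond the extreme point of the other. Otherwise the midpoint
    -- of the inner neighbours works, since their difference already has value `γ`.
    rcases A.eq_empty_or_nonempty with hA | hA <;> rcases B.eq_empty_or_nonempty with hB | hB
    · exfalso
      rcases lt_or_gt_of_ne (hx c hcs) with h | h
      · have : c ∈ B := by simp [B, hcs, h, hγ]
        simp [hB] at this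
      · have : c ∈ A := by simp [A, hcs, h, hγ]
        simp [hA] at this
    · obtain ⟨b, hb, hbmin⟩ := B.exists_min_image ξ hB
      refine ⟨ρ b - r, by simp [hA], hBdown b hb hbmin _ (by linarith) ?_⟩
      rw [show ρ b - r - ρ b = -r by ring, v.map_neg, hr]
    · obtain ⟨a, ha, hamax⟩ := A.exists_max_image ξ hA
      refine ⟨ρ a + r, hAup a ha hamax _ (by linarith) ?_, by simp [hB]⟩
      rw [show ρ a + r - ρ a = r by ring, hr]
    · obtain ⟨a, ha, hamax⟩ := A.exists_max_image ξ hA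
      obtain ⟨b, hb, hbmin⟩ := B.exists_min_image ξ hB
      have ha' := ha
      have hb' := hb
      simp only [A, B, Finset.mem_filter] at ha' hb'
      have h1 : ρ a < ρ b := hlt a ha'.1 b hb'.1 (ha'.2.2.trans hb'.2.2)
      have h2 : v (ρ b - ρ a) = γ := by
        rw [hval b hb'.1 a ha'.1, show ξ b - ξ a = (ξ b - x) + (x - ξ a) by ring,
          hv'.map_add (sub_nonneg.2 hb'.2.2.le) (sub_nonneg.2 ha'.2.2.le), v'.map_sub_swap,
          hb'.2.1, ha'.2.1, min_self]
      refine ⟨(ρ a + ρ b) / 2, hAup a ha hamax _ (by linarith) ?_,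
        hBdown b hb hbmin _ (by linarith) ?_⟩
      · rw [show (ρ a + ρ b) / 2 - ρ a = (ρ b - ρ a) / 2 by ring, hv.map_half, h2]
      · rw [show (ρ a + ρ b) / 2 - ρ b = (ρ a - ρ b) / 2 by ring, hv.map_half, v.map_sub_swap, h2]
  obtain ⟨y, hyA, hyB⟩ := key
  have hγeq : ∀ i ∈ s, v' (x - ξ i) = γ →
      (ξ i < x → ρ i < y) ∧ (x < ξ i → y < ρ i) ∧ v (y - ρ i) = v' (x - ξ i) := by
    intro i hi h
    rcases lt_or_gt_of_ne (hx i hi) with h1 | h1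
    · have := hyB i (by simp [B, hi, h, h1])
      exact ⟨fun h2 => absurd h2 h1.not_gt, fun _ => this.1, this.2.trans h.symm⟩
    · have := hyA i (by simp [A, hi, h, h1])
      exact ⟨fun _ => this.1, fun h2 => absurd h2 h1.not_gt, this.2.trans h.symm⟩
  refine ⟨y, fun i hi => ?_⟩
  rcases (hc i hi).eq_or_lt with h | h
  · exact hγeq i hi h
  change v' (x - ξ i) < v' (x - ξ c) at h
  have hyc := (hγeq c hcs rfl).2.2
  -- A point that is not closest cannot tell `x` from `c`: sign and value of the difference are the
  -- same for both, in the source and in the target.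
  have h1 : v' (ξ c - ξ i) = v' (x - ξ i) := by
    rw [show ξ c - ξ i = (x - ξ i) - (x - ξ c) by ring]
    exact v'.map_sub_eq_of_lt_left h
  have h2 : v (ρ c - ρ i) = v' (x - ξ i) := (hval c hcs i hi).trans h1
  have h3 : v (ρ c - ρ i) < v (y - ρ c) := by rw [h2, hyc]; exact h
  have hdec : y - ρ i = (y - ρ c) + (ρ c - ρ i) := by ring
  have hdec2 : ρ i - y = (ρ c - y) + (ρ i - ρ c) := by ring
  refine ⟨fun h4 => ?_, fun h4 => ?_, ?_⟩
  · rw [← sub_pos, hdec, hv.pos_of_add_pos h3, sub_pos]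
    refine hlt i hi c hcs ?_
    have := hv'.pos_of_add_pos (a := x - ξ c) (b := ξ c - ξ i) (by rw [h1]; exact h)
    rw [show x - ξ c + (ξ c - ξ i) = x - ξ i by ring, sub_pos, sub_pos] at this
    exact this.1 h4
  · rw [← sub_pos, hdec2, hv.pos_of_add_pos (by rwa [v.map_sub_swap, v.map_sub_swap _ y]), sub_pos]
    refine hlt c hcs i hi ?_
    have := hv'.pos_of_add_pos (a := ξ c - x) (b := ξ i - ξ c)
      (by rw [v'.map_sub_swap, h1, v'.map_sub_swap _ x]; exact h)
    rw [show ξ c - x + (ξ i - ξ c) = ξ i - x by ring, sub_pos, sub_pos] at this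
    exact this.1 h4
  · rw [hdec, v.map_add_eq_of_lt_right h3, h2]

open Filter in
/-- Saturation of the ultrapower: the one-point extension of countable configurations. -/
theorem exists_onePoint_extension_hyperfilter (hv' : OrderCompatible v') (hv : OrderCompatible v)
    (hrange : ∀ a : F, ∃ b : R, v b = v' a) {E : Type*} [Countable E] [Nonempty E] (ξ : E → F)
    (ρ : E → ℕ → R) (hlt : ∀ i j, ξ i < ξ j → ∀ᶠ n in (hyperfilter ℕ : Filter ℕ), ρ i n < ρ j n)
    (hval : ∀ i j, ∀ᶠ n in (hyperfilter ℕ : Filter ℕ), v (ρ i n - ρ j n) = v' (ξ i - ξ j)) (x : F)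
    (hx : ∀ i, x ≠ ξ i) :
    ∃ y : ℕ → R, ∀ i, ∀ᶠ n in (hyperfilter ℕ : Filter ℕ),
      (ξ i < x → ρ i n < y n) ∧ (x < ξ i → y n < ρ i n) ∧ v (y n - ρ i n) = v' (x - ξ i) := by
  classical
  obtain ⟨enc, henc⟩ := exists_surjective_nat E
  let good : ℕ → ℕ → Prop := fun n k => ∀ i ∈ Finset.range k, ∀ j ∈ Finset.range k,
    (ξ (enc i) < ξ (enc j) → ρ (enc i) n < ρ (enc j) n) ∧
      v (ρ (enc i) n - ρ (enc j) n) = v' (ξ (enc i) - ξ (enc j))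
  have hgood : ∀ k, ∀ᶠ n in (hyperfilter ℕ : Filter ℕ), good n k := by
    intro k
    refine (Filter.eventually_all_finset _).2 fun i _ => (Filter.eventually_all_finset _).2
      fun j _ => ?_
    refine Filter.Eventually.and ?_ (hval _ _)
    by_cases h : ξ (enc i) < ξ (enc j)
    · exact (hlt _ _ h).mono fun n hn _ => hn
    · exact Filter.Eventually.of_forall fun n hn => absurd hn h
  -- Coordinate `n` handles the longest initial segment, of length at most `n`, on which the `n`-th
  -- representatives copy the configuration faithfully. Each fixed segment is covered for almost all
  -- `n`.
  have hsol : ∀ n, ∃ y : R, ∀ i ∈ Finset.range (Nat.findGreatest (good n) n),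
      (ξ (enc i) < x → ρ (enc i) n < y) ∧ (x < ξ (enc i) → y < ρ (enc i) n) ∧
        v (y - ρ (enc i) n) = v' (x - ξ (enc i)) := by
    intro n
    have hg : good n (Nat.findGreatest (good n) n) :=
      Nat.findGreatest_spec (P := good n) (Nat.zero_le n) (by simp [good])
    exact exists_onePoint_extension hv' hv hrange _ (fun i => ξ (enc i)) (fun i => ρ (enc i) n)
      (fun i hi j hj => (hg i hi j hj).1) (fun i hi j hj => (hg i hi j hj).2) x (fun i _ => hx _)
  choose y hy using hsol
  refine ⟨y, fun e => ?_⟩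
  obtain ⟨i, rfl⟩ := henc e
  have hcof : ∀ᶠ n in (hyperfilter ℕ : Filter ℕ), i + 1 ≤ n :=
    (Filter.eventually_ge_atTop (i + 1)).filter_mono Nat.hyperfilter_le_atTop
  filter_upwards [hgood (i + 1), hcof] with n h1 h2
  exact hy n i (Finset.mem_range.2 (Nat.le_findGreatest h2 h1))

end OnePoint

/-! ### Ultrapowers of real closed fields -/

section GermRealClosed

open Filter Polynomial

/-- Łoś's theorem by hand: square roots and roots of odd-degree polynomials are chosen
coordinatewise, with `0` on the negligible set where the hypothesis fails. -/
instance Filter.Germ.isRealClosed {α R : Type*} [Field R] [LinearOrder R] [IsStrictOrderedRing R]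
    [IsRealClosed R] (U : Ultrafilter α) : IsRealClosed (Germ (U : Filter α) R) := by
  refine IsRealClosed.of_linearOrderedField ?_ ?_
  · intro x hx
    induction x using Germ.inductionOn with
    | _ f =>
    have h1 : ∀ᶠ n in (U : Filter α), 0 ≤ f n := Germ.coe_le.1 hx
    choose g hg using fun n => show ∃ r, 0 ≤ f n → f n = r * r by
      by_cases h : 0 ≤ f n
      · obtain ⟨r, hr⟩ := IsSquare.of_nonneg h
        exact ⟨r, fun _ => hr⟩
      · exact ⟨0, fun h' => absurd h' h⟩
    exact ⟨(g : Germ (U : Filter α) R), Germ.coe_eq.2 (h1.mono fun n hn => hg n hn)⟩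
  · intro p hp
    choose c hc using fun k => Quotient.exists_rep (p.coeff k)
    have hlead : ∀ᶠ n in (U : Filter α), c p.natDegree n ≠ 0 := by
      have h0 : p.coeff p.natDegree ≠ 0 := by
        rw [coeff_natDegree, leadingCoeff_ne_zero]
        rintro rfl
        simp at hp
      rw [← hc] at h0
      refine Ultrafilter.eventually_not.2 fun h => h0 (Germ.coe_eq.2 h)
    let q : α → R[X] := fun n => ∑ k ∈ Finset.range (p.natDegree + 1), monomial k (c k n)
    have hq : ∀ n, c p.natDegree n ≠ 0 → (q n).natDegree = p.natDegree := by
      intro n hn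
      refine natDegree_eq_of_le_of_coeff_ne_zero ?_ ?_
      · refine natDegree_sum_le_of_forall_le _ _ fun k hk => ?_
        exact (natDegree_monomial_le _).trans (Nat.lt_succ_iff.1 (Finset.mem_range.1 hk))
      · simpa [q, finsetSum_coeff, coeff_monomial] using hn
    choose x hx using fun n => show ∃ x, c p.natDegree n ≠ 0 → (q n).IsRoot x by
      by_cases h : c p.natDegree n ≠ 0
      · obtain ⟨x, hx⟩ := IsRealClosed.exists_isRoot_of_odd_natDegree (f := q n)
          (by rw [hq n h]; exact hp)
        exact ⟨x, fun _ => hx⟩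
      · exact ⟨0, fun h' => absurd h' h⟩
    refine ⟨(x : Germ (U : Filter α) R), ?_⟩
    rw [IsRoot, eval_eq_sum_range]
    have h1 : ∀ k, p.coeff k = Germ.coeRingHom (U : Filter α) (c k) := fun k => (hc k).symm
    have h2 : (x : Germ (U : Filter α) R) = Germ.coeRingHom (U : Filter α) x := rfl
    simp only [h1, h2, ← map_mul, ← map_pow, ← map_sum]
    refine Germ.coe_eq.2 (hlead.mono fun n hn => ?_)
    have h3 := hx n hn
    rw [IsRoot] at h3
    simpa [q, eval_finsetSum] using h3

end GermRealClosed

/-! ### Embedding countable valued ordered fields in an ultrapower -/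

section Match

open Filter

/-- The ultrapower of `R` along the hyperfilter on `ℕ`. -/
abbrev Ultrapower (R : Type*) : Type _ := Germ (hyperfilter ℕ : Filter ℕ) R

/-- `r` in the ultrapower has the same sign and the same value as `a`. -/
def SignValMatch {F R : Type*} [Field F] [LinearOrder F] [Field R] [LinearOrder R]
    (v' : AddValuation F (WithTop ℝ)) (v : AddValuation R (WithTop ℝ)) (a : F) (r : Ultrapower R) :
    Prop :=
  (0 < a → 0 < r) ∧ (a < 0 → r < 0) ∧ r.LiftPred fun t => v t = v' a

section

variable {F R : Type*} [Field F] [LinearOrder F] [Field R] [LinearOrder R]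
  {v' : AddValuation F (WithTop ℝ)} {v : AddValuation R (WithTop ℝ)}

theorem SignValMatch.zero : SignValMatch v' v 0 0 :=
  ⟨fun h => absurd h (lt_irrefl _), fun h => absurd h (lt_irrefl _),
    Eventually.of_forall fun _ => by simp⟩

theorem SignValMatch.ne_zero {a : F} {r : Ultrapower R} (h : SignValMatch v' v a r) (ha : a ≠ 0) : r ≠ 0 := by
  rcases lt_or_gt_of_ne ha with h1 | h1
  · exact (h.2.1 h1).ne
  · exact (h.1 h1).ne'

end

variable {F R : Type*} [Field F] [LinearOrder F] [IsStrictOrderedRing F]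
  [Field R] [LinearOrder R] [IsStrictOrderedRing R]
  {v' : AddValuation F (WithTop ℝ)} {v : AddValuation R (WithTop ℝ)}

namespace SignValMatch

theorem mul {a b : F} {r s : Ultrapower R} (h1 : SignValMatch v' v a r)
    (h2 : SignValMatch v' v b s) : SignValMatch v' v (a * b) (r * s) := by
  refine ⟨fun h => ?_, fun h => ?_, ?_⟩
  · rcases pos_and_pos_or_neg_and_neg_of_mul_pos h with ⟨ha, hb⟩ | ⟨ha, hb⟩
    · exact mul_pos (h1.1 ha) (h2.1 hb)
    · exact mul_pos_of_neg_of_neg (h1.2.1 ha) (h2.2.1 hb)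
  · rcases mul_neg_iff.1 h with ⟨ha, hb⟩ | ⟨ha, hb⟩
    · exact mul_neg_of_pos_of_neg (h1.1 ha) (h2.2.1 hb)
    · exact mul_neg_of_neg_of_pos (h1.2.1 ha) (h2.1 hb)
  · have h3 := h1.2.2
    have h4 := h2.2.2
    induction r using Germ.inductionOn with | _ f =>
    induction s using Germ.inductionOn with | _ g =>
    have h3' : ∀ᶠ n in (hyperfilter ℕ : Filter ℕ), v (f n) = v' a := h3
    have h4' : ∀ᶠ n in (hyperfilter ℕ : Filter ℕ), v (g n) = v' b := h4
    change ∀ᶠ n in (hyperfilter ℕ : Filter ℕ), v (f n * g n) = v' (a * b)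
    filter_upwards [h3', h4'] with n h5 h6
    rw [v.map_mul, v'.map_mul, h5, h6]

theorem inv {a : F} {r : Ultrapower R} (h : SignValMatch v' v a r) :
    SignValMatch v' v a⁻¹ r⁻¹ := by
  refine ⟨fun h1 => inv_pos.2 (h.1 (inv_pos.1 h1)), fun h1 => inv_lt_zero.2 (h.2.1 (inv_lt_zero.1 h1)),
    ?_⟩
  have h3 := h.2.2
  induction r using Germ.inductionOn with | _ f =>
  have h3' : ∀ᶠ n in (hyperfilter ℕ : Filter ℕ), v (f n) = v' a := h3
  change ∀ᶠ n in (hyperfilter ℕ : Filter ℕ), v (f n)⁻¹ = v' a⁻¹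
  filter_upwards [h3'] with n h5
  rw [v.map_inv, v'.map_inv, h5]

/-- Matching is not additive in general, but squares are nonnegative and cannot cancel. This covers
the irreducible quadratic factors. -/
theorem sq_add_sq (hv' : OrderCompatible v') (hv : OrderCompatible v) {a b : F}
    {r s : Ultrapower R} (h1 : SignValMatch v' v a r) (h2 : SignValMatch v' v b s) :
    SignValMatch v' v (a ^ 2 + b ^ 2) (r ^ 2 + s ^ 2) := by
  refine ⟨fun h => ?_, fun h => absurd h (not_lt.2 (by positivity)), ?_⟩
  · by_cases ha : a = 0
    · have hb : b ≠ 0 := by rintro rfl; simp [ha] at h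
      exact add_pos_of_nonneg_of_pos (sq_nonneg _) (pow_pos_of_ne (h2.ne_zero hb))
    · exact add_pos_of_pos_of_nonneg (pow_pos_of_ne (h1.ne_zero ha)) (sq_nonneg _)
  · have h3 := h1.2.2
    have h4 := h2.2.2
    induction r using Germ.inductionOn with | _ f =>
    induction s using Germ.inductionOn with | _ g =>
    have h3' : ∀ᶠ n in (hyperfilter ℕ : Filter ℕ), v (f n) = v' a := h3
    have h4' : ∀ᶠ n in (hyperfilter ℕ : Filter ℕ), v (g n) = v' b := h4
    change ∀ᶠ n in (hyperfilter ℕ : Filter ℕ), v (f n ^ 2 + g n ^ 2) = v' (a ^ 2 + b ^ 2)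
    filter_upwards [h3', h4'] with n h5 h6
    rw [hv.map_add (sq_nonneg _) (sq_nonneg _), hv'.map_add (sq_nonneg _) (sq_nonneg _),
      v.map_pow, v'.map_pow, v.map_pow, v'.map_pow, h5, h6]
where
  pow_pos_of_ne {t : Ultrapower R} (h : t ≠ 0) : 0 < t ^ 2 := by positivity

end SignValMatch

open Polynomial

/-- Over a field which is algebraically closed in a real closed field `F`, sign and value
of a polynomial at a point `x` of `F` are determined by those of its linear factors. -/
theorem signValMatch_polynomial [IsRealClosed F] (hv' : OrderCompatible v')
    (hv : OrderCompatible v) {E : Type*} [Field E] [Algebra E F]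
    (hE : ∀ z : F, IsAlgebraic E z → z ∈ (algebraMap E F).range) (φ : E →+* Ultrapower R)
    (hφ : ∀ e, SignValMatch v' v (algebraMap E F e) (φ e)) (x : F) (y : Ultrapower R)
    (hxy : ∀ e, SignValMatch v' v (x - algebraMap E F e) (y - φ e)) (P : E[X]) :
    SignValMatch v' v (aeval x P) (P.eval₂ φ y) := by
  induction hn : P.natDegree using Nat.strong_induction_on generalizing P with
  | _ N ih =>
  by_cases hdeg : P.natDegree = 0
  · obtain ⟨c, rfl⟩ := natDegree_eq_zero.1 hdeg
    simpa using hφ c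
  have hP0 : P ≠ 0 := by rintro rfl; simp at hdeg
  -- By induction on the degree and multiplicativity, it is enough to match one nonconstant factor.
  have hfac : ∀ q : E[X], 0 < q.natDegree → q ∣ P → SignValMatch v' v (aeval x q) (q.eval₂ φ y) →
      SignValMatch v' v (aeval x P) (P.eval₂ φ y) := by
    rintro q hq ⟨s, rfl⟩ hm
    rw [map_mul, eval₂_mul]
    refine hm.mul (ih s.natDegree ?_ s rfl)
    rw [natDegree_mul (left_ne_zero_of_mul hP0) (right_ne_zero_of_mul hP0)] at hn
    omega
  -- The real and imaginary parts of a root are algebraic over `E`, hence come from elements `a`,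
  -- `b` of `E`. So `P` has the factor `X - a` or `(X - a)² + b²`.
  obtain ⟨z, hz⟩ := IsAlgClosed.exists_aeval_eq_zero (Cx F) P
    (fun h => hdeg (natDegree_eq_of_degree_eq_some h))
  have hzalg : IsAlgebraic E z := ⟨P, hP0, hz⟩
  have hzint := hzalg.isIntegral
  have hzbar : IsAlgebraic E (star z) := by
    refine ⟨P, hP0, ?_⟩
    have h1 := congrArg star hz
    rw [star_zero, aeval_def, eval₂_eq_sum_range, star_sum] at h1
    rw [aeval_def, eval₂_eq_sum_range, ← h1]
    refine Finset.sum_congr rfl fun i _ => ?_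
    rw [star_mul', star_pow, IsScalarTower.algebraMap_apply E F (Cx F)]
    congr 1
    ext <;> simp
  have hcoe : ∀ t : F, IsAlgebraic E (algebraMap F (Cx F) t) → t ∈ (algebraMap E F).range :=
    fun t ht => hE t ((isAlgebraic_algebraMap_iff (algebraMap F (Cx F)).injective).1 ht)
  obtain ⟨a, ha⟩ := hcoe z.re (by
    have h1 : algebraMap F (Cx F) z.re = algebraMap E (Cx F) (1 / 2) * (z + star z) := by
      rw [IsScalarTower.algebraMap_apply E F (Cx F),
        show algebraMap E F (1 / 2) = 1 / 2 by rw [map_div₀, map_one, map_ofNat]]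
      ext <;> simp
      ring
    rw [h1]
    exact (isAlgebraic_algebraMap _).mul (hzalg.add hzbar))
  have haz : algebraMap E (Cx F) a = algebraMap F (Cx F) z.re := by
    rw [IsScalarTower.algebraMap_apply E F (Cx F), ha]
  obtain ⟨b, hb⟩ := hcoe z.im (by
    refine IsAlgebraic.of_pow two_pos ?_
    have h1 : (algebraMap F (Cx F) z.im) ^ 2 = z * star z - (algebraMap E (Cx F) a) ^ 2 := by
      rw [haz, sq, sq]
      ext <;> simp <;> ring
    rw [h1]
    exact (hzalg.mul hzbar).sub ((isAlgebraic_algebraMap _).pow 2))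
  have hbz : algebraMap E (Cx F) b = algebraMap F (Cx F) z.im := by
    rw [IsScalarTower.algebraMap_apply E F (Cx F), hb]
  by_cases hb0 : b = 0
  · have hza : z = algebraMap E (Cx F) a := by
      rw [haz]
      have : z.im = 0 := by rw [← hb, hb0, map_zero]
      ext <;> simp [this]
    refine hfac (X - C a) (by simp) ?_ (by simpa using hxy a)
    rw [dvd_iff_isRoot, IsRoot]
    rw [hza, aeval_algebraMap_apply] at hz
    have : P.eval a = aeval a P := by simp
    rw [this]
    exact (map_eq_zero _).1 hz
  · have hq : ((X - C a) ^ 2 + C b ^ 2 : E[X]).Monic := by monicity!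
    have hqd : ((X - C a) ^ 2 + C b ^ 2 : E[X]).natDegree = 2 := by compute_degree!
    have hqz : aeval z ((X - C a) ^ 2 + C b ^ 2 : E[X]) = 0 := by
      simp only [map_add, map_pow, map_sub, aeval_X, aeval_C, haz, hbz]
      simp only [sq]
      ext <;> simp
    have hirr : Irreducible ((X - C a) ^ 2 + C b ^ 2 : E[X]) := by
      refine (irreducible_iff_roots_eq_zero_of_degree_le_three hqd.ge (by omega)).2 ?_
      refine Multiset.eq_zero_of_forall_notMem fun t ht => ?_
      have h1 := (mem_roots'.1 ht).2
      simp only [IsRoot, eval_add, eval_pow, eval_sub, eval_X, eval_C] at h1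
      have h2 := congrArg (algebraMap E F) h1
      simp only [map_add, map_pow, map_sub, map_zero] at h2
      have h3 : algebraMap E F b ≠ 0 := by simpa using hb0
      have : 0 < (algebraMap E F b) ^ 2 := by positivity
      nlinarith [sq_nonneg (algebraMap E F t - algebraMap E F a)]
    refine hfac ((X - C a) ^ 2 + C b ^ 2) (by rw [hqd]; norm_num) ?_ ?_
    · rw [minpoly.eq_of_irreducible_of_monic hirr hqz hq]
      exact minpoly.dvd E z hz
    · simpa [eval₂_pow] using (hxy a).sq_add_sq hv' hv (hφ b)

/-- The transcendental step: a simple extension of a field algebraically closed in `F`. -/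
theorem exists_simple_extension [IsRealClosed F] (hv' : OrderCompatible v')
    (hv : OrderCompatible v) (hrange : ∀ a : F, ∃ b : R, v b = v' a)
    {E : Type*} [Field E] [Countable E] [Algebra E F]
    (hE : ∀ z : F, IsAlgebraic E z → z ∈ (algebraMap E F).range) (φ : E →+* Ultrapower R)
    (hφ : ∀ e, SignValMatch v' v (algebraMap E F e) (φ e)) (x : F)
    (hx : x ∉ (algebraMap E F).range) :
    ∃ (f : FractionRing E[X] →+* F) (g : FractionRing E[X] →+* Ultrapower R),
      (∀ a, SignValMatch v' v (f a) (g a)) ∧ x ∈ f.range ∧ (algebraMap E F).range ≤ f.range := by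
  choose ρ hρ using fun e => Quotient.exists_rep (φ e)
  have hρ' : ∀ e, φ e = (ρ e : Ultrapower R) := fun e => (hρ e).symm
  have hdiff : ∀ i j, SignValMatch v' v (algebraMap E F i - algebraMap E F j)
      ((ρ i : Ultrapower R) - ρ j) := by
    intro i j
    rw [← hρ', ← hρ', ← map_sub, ← map_sub]
    exact hφ _
  obtain ⟨y, hy⟩ := exists_onePoint_extension_hyperfilter hv' hv hrange (algebraMap E F) ρ
    (fun i j hij => Germ.coe_lt.1 (sub_neg.1 ((hdiff i j).2.1 (sub_neg.2 hij))))
    (fun i j => (hdiff i j).2.2) x (fun e he => hx ⟨e, he.symm⟩)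
  have hxy : ∀ e, SignValMatch v' v (x - algebraMap E F e) ((y : Ultrapower R) - φ e) := by
    intro e
    rw [hρ']
    refine ⟨fun h => ?_, fun h => ?_, ?_⟩
    · rw [sub_pos] at h ⊢
      exact Germ.coe_lt.2 ((hy e).mono fun n hn => hn.1 h)
    · rw [sub_neg] at h ⊢
      exact Germ.coe_lt.2 ((hy e).mono fun n hn => hn.2.1 h)
    · exact (hy e).mono fun n hn => hn.2.2
  have hm := signValMatch_polynomial hv' hv hE φ hφ x (y : Ultrapower R) hxy
  let f0 : E[X] →+* F := (aeval x : E[X] →ₐ[E] F).toRingHom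
  let g0 : E[X] →+* Ultrapower R := eval₂RingHom φ (y : Ultrapower R)
  -- `x` is transcendental over `E`, because `E` is algebraically closed in `F`.
  have hf0 : ∀ P, P ≠ 0 → f0 P ≠ 0 := fun P hP h => hx (hE x ⟨P, hP, h⟩)
  have hf : Function.Injective f0 := (injective_iff_map_eq_zero f0).2 fun P h => by
    by_contra hP; exact hf0 P hP h
  have hg : Function.Injective g0 := (injective_iff_map_eq_zero g0).2 fun P h => by
    by_contra hP; exact (hm P).ne_zero (hf0 P hP) h
  refine ⟨IsFractionRing.lift hf, IsFractionRing.lift hg, fun a => ?_, ?_, ?_⟩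
  · obtain ⟨p, q, hq, rfl⟩ := IsFractionRing.div_surjective (A := E[X]) a
    rw [map_div₀, map_div₀, IsFractionRing.lift_algebraMap, IsFractionRing.lift_algebraMap,
      IsFractionRing.lift_algebraMap, IsFractionRing.lift_algebraMap, div_eq_mul_inv, div_eq_mul_inv]
    exact (hm p).mul (hm q).inv
  · exact ⟨algebraMap _ _ X, by rw [IsFractionRing.lift_algebraMap]; simp [f0]⟩
  · rintro _ ⟨e, rfl⟩
    exact ⟨algebraMap _ _ (C e), by rw [IsFractionRing.lift_algebraMap]; simp [f0]⟩

end Match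

/-! ### Transfer of valuations between real closed fields -/

section Transfer

open Filter Polynomial

/-- If the least value were attained only once, it would be the value of the sum, which is infinite.
-/
theorem exists_val_eq_of_sum_eq_zero {S : Type*} [Field S] (v : AddValuation S (WithTop ℝ))
    {κ : Type*} (s : Finset κ) (hs : s.Nonempty) (t : κ → S) (ht : ∀ k ∈ s, t k ≠ 0)
    (hsum : ∑ k ∈ s, t k = 0) : ∃ j ∈ s, ∃ k ∈ s, j ≠ k ∧ v (t j) = v (t k) := by
  classical
  by_contra! hne
  obtain ⟨j, hj, hmin⟩ := s.exists_min_image (fun k => v (t k)) hs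
  have h1 : v (t j) < v (∑ k ∈ s.erase j, t k) := by
    refine v.map_lt_sum (v.ne_top_iff.2 (ht j hj)) fun k hk => ?_
    rw [Finset.mem_erase] at hk
    exact lt_of_le_of_ne (hmin k hk.2) (hne j hj k hk.2 hk.1.symm)
  have h2 := v.map_add_eq_of_lt_left h1
  rw [Finset.add_sum_erase s t hj, hsum, v.map_zero] at h2
  exact v.ne_top_iff.2 (ht j hj) h2.symm

/-- A root of a polynomial has a multiple of its value equal to the value of
a ratio of coefficients. -/
theorem exists_nsmul_val_eq {S : Type*} [Field S] (v : AddValuation S (WithTop ℝ)) (s : Finset ℕ)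
    (hs : s.Nonempty) (c : ℕ → S) (hc : ∀ k ∈ s, c k ≠ 0) {u : S} (hu : u ≠ 0)
    (h : ∑ k ∈ s, c k * u ^ k = 0) :
    ∃ p ∈ s ×ˢ s, p.1 < p.2 ∧ v (u ^ (p.2 - p.1)) = v (c p.1 / c p.2) := by
  obtain ⟨j, hj, k, hk, hjk, hv⟩ := exists_val_eq_of_sum_eq_zero v s hs (fun k => c k * u ^ k)
    (fun k hk => mul_ne_zero (hc k hk) (pow_ne_zero _ hu)) h
  wlog hlt : j < k generalizing j k
  · exact this k hk j hj hjk.symm hv.symm (lt_of_le_of_ne (not_lt.1 hlt) hjk.symm)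
  refine ⟨(j, k), by simp [hj, hk], hlt, ?_⟩
  have h1 : v (c k) ≠ ⊤ := v.ne_top_iff.2 (hc k hk)
  have h2 : v (u ^ j) ≠ ⊤ := v.ne_top_iff.2 (pow_ne_zero _ hu)
  have h3 : v (c j / c k) + v (c k) = v (c j) := by
    rw [← v.map_mul, div_mul_cancel₀ _ (hc k hk)]
  have h4 : u ^ k = u ^ (k - j) * u ^ j := by rw [← pow_add, Nat.sub_add_cancel hlt.le]
  rw [v.map_mul, v.map_mul, h4, v.map_mul, ← h3] at hv
  have h5 : (v (u ^ (k - j)) + (v (c k) + v (u ^ j))) = v (c j / c k) + (v (c k) + v (u ^ j)) := by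
    rw [add_left_comm, ← hv, add_assoc]
  exact WithTop.add_right_cancel (WithTop.add_ne_top.2 ⟨h1, h2⟩) h5

variable {F R : Type*} [Field F] [LinearOrder F] [IsStrictOrderedRing F]
  [Field R] [LinearOrder R] [IsStrictOrderedRing R]
  {v' : AddValuation F (WithTop ℝ)} {v : AddValuation R (WithTop ℝ)}

/-- Values are preserved by sign-preserving algebraic extensions of value-preserving embeddings. -/
theorem liftPred_of_isAlgebraic (hv' : OrderCompatible v') (hv : OrderCompatible v)
    {E L : Type*} [Field E] [Field L] [Algebra E L] [Algebra.IsAlgebraic E L]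
    (f : L →+* F) (g : L →+* Ultrapower R)
    (hE : ∀ e : E, SignValMatch v' v (f (algebraMap E L e)) (g (algebraMap E L e)))
    (hpos : ∀ a : L, 0 < f a → 0 < g a) (a : L) :
    (g a).LiftPred fun t => v t = v' (f a) := by
  classical
  rcases eq_or_ne a 0 with rfl | ha
  · simpa using (SignValMatch.zero (v' := v') (v := v)).2.2
  obtain ⟨P, hP0, hP⟩ := Algebra.IsAlgebraic.isAlgebraic (R := E) a
  rw [aeval_eq_sum_range] at hP
  have hsub : P.support ⊆ Finset.range (P.natDegree + 1) := supp_subset_range_natDegree_succ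
  rw [← Finset.sum_subset hsub (fun k _ hk => by rw [notMem_support_iff.1 hk, zero_smul])] at hP
  simp only [Algebra.smul_def] at hP
  have hne : ∀ k ∈ P.support, algebraMap E L (P.coeff k) ≠ 0 := fun k hk => by
    simpa using hk
  have hsupp : P.support.Nonempty := support_nonempty.2 hP0
  -- the source
  obtain ⟨⟨j, k⟩, hjk, hlt, hsrc⟩ := exists_nsmul_val_eq v' P.support hsupp
    (fun k => f (algebraMap E L (P.coeff k))) (fun k hk => (_root_.map_ne_zero f).2 (hne k hk))
    ((_root_.map_ne_zero f).2 ha) (by simpa using congrArg f hP)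
  simp only [← map_div₀] at hsrc
  set N' := k - j with hN'
  have hN'0 : 0 < N' := Nat.sub_pos_of_lt hlt
  have he'0 : P.coeff j / P.coeff k ≠ 0 := by
    simp only [Finset.mem_product, mem_support_iff] at hjk
    exact div_ne_zero hjk.1 hjk.2
  set e' := P.coeff j / P.coeff k
  -- the target
  choose rep hrep using fun x : L => Quotient.exists_rep (g x)
  have hrep' : ∀ x, g x = (rep x : Ultrapower R) := fun x => (hrep x).symm
  have hmul : ∀ x y, ∀ᶠ n in (hyperfilter ℕ : Filter ℕ), rep (x * y) n = rep x n * rep y n := by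
    intro x y
    have := map_mul g x y
    rw [hrep', hrep', hrep'] at this
    exact Germ.coe_eq.1 this
  have hpow : ∀ x m, ∀ᶠ n in (hyperfilter ℕ : Filter ℕ), rep (x ^ m) n = rep x n ^ m := by
    intro x m
    have := map_pow g x m
    rw [hrep', hrep'] at this
    exact Germ.coe_eq.1 this
  have hvalE : ∀ e : E, ∀ᶠ n in (hyperfilter ℕ : Filter ℕ),
      v (rep (algebraMap E L e) n) = v' (f (algebraMap E L e)) := by
    intro e
    have := (hE e).2.2
    rw [hrep'] at this
    exact this
  have htgt : ∀ᶠ n in (hyperfilter ℕ : Filter ℕ), ∃ p ∈ P.support ×ˢ P.support, p.1 < p.2 ∧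
      v (rep a n ^ (p.2 - p.1)) =
        v' (f (algebraMap E L (P.coeff p.1 / P.coeff p.2))) := by
    have h1 : ∀ᶠ n in (hyperfilter ℕ : Filter ℕ),
        ∑ k ∈ P.support, rep (algebraMap E L (P.coeff k)) n * rep a n ^ k = 0 := by
      have h := congrArg g hP
      rw [map_sum, map_zero] at h
      simp only [map_mul, map_pow] at h
      simp only [hrep'] at h
      have h2 : ∀ w : ℕ → R, (w : Ultrapower R) = Germ.coeRingHom _ w := fun _ => rfl
      simp only [h2, ← map_mul, ← map_pow, ← map_sum] at h
      refine (Germ.coe_eq.1 h).mono fun n hn => ?_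
      simpa using hn
    have h3 : ∀ᶠ n in (hyperfilter ℕ : Filter ℕ), ∀ k ∈ P.support,
        v (rep (algebraMap E L (P.coeff k)) n) = v' (f (algebraMap E L (P.coeff k))) :=
      (eventually_all_finset _).2 fun k _ => hvalE _
    have h4 : ∀ᶠ n in (hyperfilter ℕ : Filter ℕ), rep a n ≠ 0 := by
      have h : g a ≠ 0 := (_root_.map_ne_zero g).2 ha
      rw [hrep'] at h
      exact Ultrafilter.eventually_not.2 fun h' => h (Germ.coe_eq.2 h')
    filter_upwards [h1, h3, h4] with n h1 h3 h4
    have h5 : ∀ k ∈ P.support, rep (algebraMap E L (P.coeff k)) n ≠ 0 := fun k hk => by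
      rw [← v.ne_top_iff, h3 k hk, v'.ne_top_iff]
      exact (_root_.map_ne_zero f).2 (hne k hk)
    obtain ⟨p, hp, hlt, h⟩ := exists_nsmul_val_eq v P.support hsupp _ h5 h4 h1
    refine ⟨p, hp, hlt, ?_⟩
    rw [Finset.mem_product] at hp
    rw [h, map_div₀ (algebraMap E L), map_div₀ f, v.map_div, v'.map_div, h3 _ hp.1, h3 _ hp.2]
  -- The pair of exponents depends on the coordinate, but there are finitely many pairs, so the
  -- ultrafilter singles one out.
  have hex := (Ultrafilter.eventually_exists_mem_iff (P.support ×ˢ P.support).finite_toSet).1 htgt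
  obtain ⟨⟨j', k'⟩, hjk', htgt⟩ := hex
  have hlt' : j' < k' := by
    obtain ⟨n, hn⟩ := htgt.exists
    exact hn.1
  replace htgt := htgt.mono fun n hn => hn.2
  simp only at htgt
  set N := k' - j' with hN
  have hN0 : 0 < N := Nat.sub_pos_of_lt hlt'
  have he0 : P.coeff j' / P.coeff k' ≠ 0 := by
    simp only [SetLike.mem_coe, Finset.mem_product, mem_support_iff] at hjk'
    exact div_ne_zero hjk'.1 hjk'.2
  set e := P.coeff j' / P.coeff k'
  -- comparison
  have hreal : ∀ x : F, x ≠ 0 → ∃ r : ℝ, v' x = r := fun x hx => by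
    obtain ⟨r, hr⟩ := WithTop.ne_top_iff_exists.1 (v'.ne_top_iff.2 hx)
    exact ⟨r, hr.symm⟩
  have hf0 : ∀ e : E, e ≠ 0 → f (algebraMap E L e) ≠ 0 := fun e he =>
    (_root_.map_ne_zero f).2 ((_root_.map_ne_zero _).2 he)
  obtain ⟨π, hπ⟩ := hreal _ (hf0 _ (pow_ne_zero N' he0))
  obtain ⟨π', hπ'⟩ := hreal _ (hf0 _ (pow_ne_zero N he'0))
  obtain ⟨α, hα⟩ := hreal _ ((_root_.map_ne_zero f).2 ha)
  set b := a ^ (N * N') with hb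
  have hbF : v' (f b) = π' := by
    rw [hb, mul_comm, pow_mul, map_pow, v'.map_pow, map_pow, hsrc, ← v'.map_pow, ← map_pow,
      ← map_pow, hπ']
  have hbR : ∀ᶠ n in (hyperfilter ℕ : Filter ℕ), v (rep b n) = π := by
    filter_upwards [hpow a (N * N'), htgt] with n h1 h2
    rw [hb, h1, pow_mul, v.map_pow, h2, ← v'.map_pow, ← map_pow, ← map_pow, hπ]
  -- The test element: `c` comes from `E` and has value `π + π'` on both sides, whereas `b * b` has
  -- value `2π'` in the source and `2π` in the target. If `π ≠ π'`, these lie on opposite sides of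
  -- `π + π'`, and comparing `b * b` with `c` contradicts preservation of the order.
  set c := algebraMap E L (e ^ N' * e' ^ N) with hc
  have hcF : v' (f c) = ((π + π' : ℝ) : WithTop ℝ) := by
    rw [hc, map_mul, map_mul, v'.map_mul, hπ, hπ', WithTop.coe_add]
  have hcR : ∀ᶠ n in (hyperfilter ℕ : Filter ℕ), v (rep c n) = ((π + π' : ℝ) : WithTop ℝ) := by
    rw [← hcF]; exact hvalE _
  have hcomp : ∀ x y : L, |f x| < |f y| →
      ∀ᶠ n in (hyperfilter ℕ : Filter ℕ), v (rep y n) ≤ v (rep x n) := by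
    intro x y hxy
    have h1 : 0 < f (y ^ 2 - x ^ 2) := by
      rw [map_sub, map_pow, map_pow, sub_pos]; exact sq_lt_sq.2 hxy
    have h2 := hpos _ h1
    rw [map_sub, map_pow, map_pow, sub_pos, hrep', hrep'] at h2
    have h3 : ∀ᶠ n in (hyperfilter ℕ : Filter ℕ), rep x n ^ 2 < rep y n ^ 2 := Germ.coe_lt.1 h2
    exact h3.mono fun n hn => hv.le_of_abs_le (sq_le_sq.1 hn.le)
  have hππ' : π = π' := by
    have hb2F : v' (f (b * b)) = ((π' + π' : ℝ) : WithTop ℝ) := by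
      rw [map_mul, v'.map_mul, hbF, WithTop.coe_add]
    have hb2R : ∀ᶠ n in (hyperfilter ℕ : Filter ℕ), v (rep (b * b) n) =
        ((π + π : ℝ) : WithTop ℝ) := by
      filter_upwards [hmul b b, hbR] with n h1 h2
      rw [h1, v.map_mul, h2, WithTop.coe_add]
    rcases lt_trichotomy π π' with h | h | h
    · exfalso
      have h1 := hcomp (b * b) c (hv'.abs_lt_abs (by
        rw [hb2F, hcF, WithTop.coe_lt_coe]; linarith))
      obtain ⟨n, hn1, hn2, hn3⟩ := (h1.and (hb2R.and hcR)).exists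
      rw [hn2, hn3, WithTop.coe_le_coe] at hn1
      linarith
    · exact h
    · exfalso
      have h1 := hcomp c (b * b) (hv'.abs_lt_abs (by
        rw [hb2F, hcF, WithTop.coe_lt_coe]; linarith))
      obtain ⟨n, hn1, hn2, hn3⟩ := (h1.and (hb2R.and hcR)).exists
      rw [hn2, hn3, WithTop.coe_le_coe] at hn1
      linarith
  rw [hrep']
  change ∀ᶠ n in (hyperfilter ℕ : Filter ℕ), v (rep a n) = v' (f a)
  filter_upwards [hbR, hpow a (N * N')] with n h1 h2
  rw [hb, h2, hππ', ← hbF, hb, map_pow f, v.map_pow, v'.map_pow, hα] at h1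
  have hM : 0 < N * N' := Nat.mul_pos hN0 hN'0
  have hne0 : v (rep a n) ≠ ⊤ := by
    intro h
    rw [h, ← Nat.succ_pred_eq_of_pos hM, succ_nsmul, WithTop.add_top, ← WithTop.coe_nsmul] at h1
    exact WithTop.coe_ne_top h1.symm
  obtain ⟨β, hβ⟩ := WithTop.ne_top_iff_exists.1 hne0
  rw [← hβ, ← WithTop.coe_nsmul, ← WithTop.coe_nsmul, WithTop.coe_inj] at h1
  rw [← hβ, hα, WithTop.coe_inj]
  exact nsmul_right_injective hM.ne' h1

variable [IsRealClosed F] [IsRealClosed R]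

/-- The algebraic step: passage to the relative algebraic closure in `F`. -/
theorem exists_algebraicClosure_extension (hv' : OrderCompatible v') (hv : OrderCompatible v)
    {E : Type*} [Field E] [CharZero E] [Countable E] (f : E →+* F) (g : E →+* Ultrapower R)
    (hfg : ∀ e, SignValMatch v' v (f e) (g e)) :
    ∃ (L : Subfield F) (_ : Countable L) (φ : L →+* Ultrapower R),
      (∀ z : F, IsAlgebraic L z → z ∈ L) ∧ f.range ≤ L.toSubring ∧
      ∀ a : L, SignValMatch v' v (a : F) (φ a) := by
  let _ : Algebra E F := f.toAlgebra
  let _ : Algebra E (Ultrapower R) := g.toAlgebra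
  let A := algebraicClosure E F
  have hsign : ∀ c : E, 0 < algebraMap E F c → 0 < algebraMap E (Ultrapower R) c := fun c =>
    (hfg c).1
  have hA : Algebra.IsAlgebraic E A := algebraicClosure.isAlgebraic E F
  have hroot : ∀ x : A, ∃ y : Ultrapower R, aeval y (minpoly E x) = 0 := by
    intro x
    have h1 : minpoly E x = minpoly E (x : F) := (minpoly.algebraMap_eq
      (algebraMap A F).injective x).symm
    rw [h1]
    refine exists_aeval_minpoly_eq_zero hsign (x : F) ?_
    exact (mem_algebraicClosure_iff'.1 x.2)
  obtain ⟨φ⟩ := Field.nonempty_algHom_of_exists_root (F := E) (E := A) (K := Ultrapower R) hroot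
  have hcount : Countable A := by
    have h := Algebra.IsAlgebraic.lift_cardinalMk_le_max E A
    rw [← Cardinal.mk_le_aleph0_iff, ← Cardinal.lift_le_aleph0]
    refine h.trans (max_le ?_ le_rfl)
    rw [Cardinal.lift_le_aleph0]
    exact Cardinal.mk_le_aleph0_iff.2 inferInstance
  -- A positive element has a square root in `F`, which is algebraic and so already in `A`. Any ring
  -- homomorphism therefore preserves positivity.
  have hpos : ∀ a : A, 0 < (a : F) → 0 < φ a := by
    intro a ha
    obtain ⟨r, hr⟩ := IsSquare.of_nonneg ha.le
    have hrA : r ∈ A := by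
      rw [mem_algebraicClosure_iff]
      refine IsAlgebraic.of_pow two_pos ?_
      rw [sq, ← hr]
      exact mem_algebraicClosure_iff.1 a.2
    have h1 : a = ⟨r, hrA⟩ * ⟨r, hrA⟩ := Subtype.ext hr
    have h2 : φ ⟨r, hrA⟩ ≠ 0 := by
      rw [_root_.map_ne_zero]
      rintro h
      rw [h, mul_zero] at h1
      simp [h1] at ha
    rw [h1, map_mul, ← sq]
    positivity
  refine ⟨A.toSubfield, hcount, φ.toRingHom, ?_, ?_, ?_⟩
  · intro z hz
    change z ∈ A
    rw [mem_algebraicClosure_iff]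
    have hz' : IsAlgebraic A z := hz
    have : IsAlgebraic E z := IsAlgebraic.restrictScalars E hz'
    exact this
  · rintro _ ⟨e, rfl⟩
    exact A.algebraMap_mem e
  · intro a
    refine ⟨hpos a, fun h => ?_, ?_⟩
    · have := hpos (-a) (by simpa using h)
      rw [map_neg, neg_pos] at this
      exact this
    · refine liftPred_of_isAlgebraic (E := E) (L := A) hv' hv (algebraMap A F) φ.toRingHom ?_ hpos a
      intro e
      have h1 : algebraMap A F (algebraMap E A e) = f e :=
        (IsScalarTower.algebraMap_apply E A F e).symm
      have h2 : φ.toRingHom (algebraMap E A e) = g e := φ.commutes e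
      rw [h1, h2]
      exact hfg e

/-- Finitely many points of `F` lie in a subfield with an embedding into the ultrapower of `R`
that preserves signs and values. -/
theorem exists_embedding_ultrapower (hv' : OrderCompatible v') (hv : OrderCompatible v)
    (hrange : ∀ a : F, ∃ b : R, v b = v' a) (s : Finset F) :
    ∃ (L : Subfield F) (_ : Countable L) (φ : L →+* Ultrapower R),
      (∀ z : F, IsAlgebraic L z → z ∈ L) ∧ (∀ x ∈ s, x ∈ L) ∧
      ∀ a : L, SignValMatch v' v (a : F) (φ a) := by
  classical
  induction s using Finset.induction_on with
  | empty =>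
    -- The start is `ℚ`, on which both valuations are trivial.
    obtain ⟨L, hL, φ, h1, -, h3⟩ := exists_algebraicClosure_extension hv' hv (Rat.castHom F)
      ((Germ.coeRingHom (hyperfilter ℕ : Filter ℕ)).comp
        ((Pi.constRingHom ℕ R).comp (Rat.castHom R))) (by
      intro q
      refine ⟨fun h => ?_, fun h => ?_, ?_⟩
      · have h' : 0 < q := by simpa using h
        exact Germ.coe_lt.2 (Eventually.of_forall fun n => by simpa using h')
      · have h' : q < 0 := by simpa using h
        exact Germ.coe_lt.2 (Eventually.of_forall fun n => by simpa using h')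
      · refine Eventually.of_forall fun n => ?_
        change v (q : R) = v' (q : F)
        rcases eq_or_ne q 0 with rfl | hq
        · simp
        · rw [hv.map_ratCast hq, hv'.map_ratCast hq])
    exact ⟨L, hL, φ, h1, by simp, h3⟩
  | insert x s _ ih =>
    obtain ⟨L, hL, φ, h1, h2, h3⟩ := ih
    by_cases hx : x ∈ L
    · refine ⟨L, hL, φ, h1, ?_, h3⟩
      intro z hz
      rcases Finset.mem_insert.1 hz with rfl | hz
      · exact hx
      · exact h2 z hz
    · obtain ⟨f, g, hfg, hxf, hLf⟩ := exists_simple_extension hv' hv hrange (E := L)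
        (fun z hz => ⟨⟨z, h1 z hz⟩, rfl⟩) φ h3 x (by rintro ⟨e, rfl⟩; exact hx e.2)
      have : Countable (FractionRing L[X]) := by
        have : Countable L[X] := by
          rw [← Cardinal.mk_le_aleph0_iff]
          exact Polynomial.cardinalMk_le_max.trans
            (max_le (Cardinal.mk_le_aleph0_iff.2 inferInstance) le_rfl)
        refine (Function.Surjective.countable (α := L[X] × L[X])
          (f := fun p => algebraMap _ _ p.1 / algebraMap _ _ p.2) fun a => ?_)
        obtain ⟨p, q, -, h⟩ := IsFractionRing.div_surjective (A := L[X]) a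
        exact ⟨(p, q), h⟩
      have : CharZero (FractionRing L[X]) := charZero_of_injective_algebraMap
        (IsFractionRing.injective L[X] (FractionRing L[X]))
      obtain ⟨L', hL', φ', h1', h2', h3'⟩ := exists_algebraicClosure_extension hv' hv f g hfg
      refine ⟨L', hL', φ', h1', ?_, h3'⟩
      intro z hz
      rcases Finset.mem_insert.1 hz with rfl | hz
      · exact h2' hxf
      · exact h2' (hLf ⟨⟨z, h2 z hz⟩, rfl⟩)

/-- **Transfer principle**: the values of finitely many integral polynomials at a point over one
real closed valued field are realized over any other with at least the same value group. -/
theorem exists_point_val_eq (hv' : OrderCompatible v') (hv : OrderCompatible v)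
    (hrange : ∀ a : F, ∃ b : R, v b = v' a) {m κ : Type*} [Finite m] [Finite κ] (x : m → F)
    (f : κ → MvPolynomial m ℤ) :
    ∃ y : m → R, ∀ k, v (MvPolynomial.aeval y (f k)) = v' (MvPolynomial.aeval x (f k)) := by
  classical
  have := Fintype.ofFinite m
  obtain ⟨L, -, φ, -, h2, h3⟩ := exists_embedding_ultrapower hv' hv hrange (Finset.univ.image x)
  let e : m → L := fun i => ⟨x i, h2 _ (Finset.mem_image_of_mem x (Finset.mem_univ i))⟩
  choose y hy using fun i => Quotient.exists_rep (φ (e i))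
  have hy' : ∀ i, φ (e i) = Germ.coeRingHom (hyperfilter ℕ : Filter ℕ) (y i) := fun i => (hy i).symm
  have hev : ∀ k, ∀ᶠ n in (hyperfilter ℕ : Filter ℕ),
      v (MvPolynomial.aeval (fun i => y i n) (f k)) = v' (MvPolynomial.aeval x (f k)) := by
    intro k
    have h := (h3 (MvPolynomial.aeval e (f k))).2.2
    have h4 : φ (MvPolynomial.aeval e (f k)) =
        Germ.coeRingHom (hyperfilter ℕ : Filter ℕ) (MvPolynomial.aeval y (f k)) := by
      rw [MvPolynomial.aeval_def, MvPolynomial.aeval_def, MvPolynomial.hom_eval₂,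
        MvPolynomial.hom_eval₂, funext hy']
      congr 1
      exact RingHom.ext_int _ _
    have h5 : ((MvPolynomial.aeval e (f k) : L) : F) = MvPolynomial.aeval x (f k) := by
      change L.subtype _ = _
      rw [MvPolynomial.aeval_def, MvPolynomial.aeval_def, MvPolynomial.hom_eval₂]
      congr 1
    rw [h4, h5] at h
    have h6 : ∀ᶠ n in (hyperfilter ℕ : Filter ℕ), v (MvPolynomial.aeval y (f k) n) =
      v' (MvPolynomial.aeval x (f k)) := h
    refine h6.mono fun n hn => ?_
    rw [← hn]
    congr 1
    rw [MvPolynomial.aeval_def, MvPolynomial.aeval_def]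
    refine Eq.trans ?_ (MvPolynomial.hom_eval₂ (f k) (algebraMap ℤ (ℕ → R))
      (Pi.evalRingHom (fun _ : ℕ => R) n) y).symm
    congr 1
  -- Finitely many conditions hold almost everywhere, so a single coordinate satisfies all of them
  -- and gives the point over `R`.
  obtain ⟨n, hn⟩ := (eventually_all.2 hev).exists
  exact ⟨fun i => y i n, hn⟩

end Transfer

/-! ### Values of minors -/

section Minors

open Matrix

/-- Reordering rows and columns only changes the sign, which the valuation ignores. Minors can thus
be indexed by sets. -/
theorem val_det_submatrix_equiv {K ι κ : Type*} [Field K] [Fintype ι] [DecidableEq ι] [Fintype κ]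
    [DecidableEq κ] (w : AddValuation K (WithTop ℝ)) (A : Matrix κ κ K) (e f : ι ≃ κ) :
    w (A.submatrix e f).det = w A.det := by
  have h : A.submatrix e f = (A.submatrix f f).submatrix (e.trans f.symm) id := by
    ext i j; simp
  rw [h, det_permute, det_submatrix_equiv_self, w.map_mul]
  rcases Int.units_eq_one_or (Equiv.Perm.sign (e.trans f.symm)) with h1 | h1 <;> rw [h1]
  · simp
  · simp [w.map_neg]

theorem exists_equiv_of_image_equiv {γ ι : Type*} [DecidableEq γ] [Fintype ι] {f : ι → γ}
    (hf : Function.Injective f) {m : ℕ} (e : (Finset.univ.image f) ≃ Fin m) :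
    ∃ e' : Fin m ≃ ι, ∀ i, f (e' i) = (e.symm i : γ) := by
  have hb : Function.Bijective (fun i : ι => (⟨f i, by simp⟩ : (Finset.univ.image f))) := by
    constructor
    · intro i j h
      exact hf (congrArg Subtype.val h)
    · rintro ⟨x, hx⟩
      obtain ⟨i, -, rfl⟩ := Finset.mem_image.1 hx
      exact ⟨i, rfl⟩
  let e0 := Equiv.ofBijective _ hb
  refine ⟨e.symm.trans e0.symm, fun i => ?_⟩
  exact congrArg Subtype.val (e0.apply_symm_apply (e.symm i))

/-- The Desnanot–Jacobi identity, for an invertible corner. -/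
theorem det_mul_det_sum_elim {K α β ι : Type*} [Field K] [Fintype ι] [DecidableEq ι]
    (B : Matrix α β K)
    (g : ι → α) (s : ι → β) (hD : (B.submatrix g s).det ≠ 0) (t r : α) (i j : β) :
    (B.submatrix g s).det * (B.submatrix (Sum.elim g ![t, r]) (Sum.elim s ![i, j])).det =
      (B.submatrix (Sum.elim g fun _ : Unit => t) (Sum.elim s fun _ : Unit => i)).det *
        (B.submatrix (Sum.elim g fun _ : Unit => r) (Sum.elim s fun _ : Unit => j)).det -
      (B.submatrix (Sum.elim g fun _ : Unit => t) (Sum.elim s fun _ : Unit => j)).det *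
        (B.submatrix (Sum.elim g fun _ : Unit => r) (Sum.elim s fun _ : Unit => i)).det := by
  let D := B.submatrix g s
  have hu : IsUnit D.det := isUnit_iff_ne_zero.2 hD
  let _ : Invertible D := D.invertibleOfIsUnitDet hu
  -- The entries of the Schur complement of `D`: a bordered determinant is `det D` times the
  -- corresponding minor of `σ`.
  let σ : α → β → K := fun a b => B a b - ∑ x, ∑ y, B a (s x) * (⅟D) x y * B (g y) b
  have h1 : ∀ a b, (B.submatrix (Sum.elim g fun _ : Unit => a) (Sum.elim s fun _ : Unit => b)).det
      = D.det * σ a b := by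
    intro a b
    have : B.submatrix (Sum.elim g fun _ : Unit => a) (Sum.elim s fun _ : Unit => b) =
        fromBlocks D (B.submatrix g fun _ => b) (B.submatrix (fun _ => a) s)
          (B.submatrix (fun _ => a) fun _ => b) := by
      ext (x | x) (y | y) <;> rfl
    rw [this, det_fromBlocks₁₁]
    congr 1
    rw [det_unique]
    simp only [Matrix.sub_apply, mul_apply, submatrix_apply, σ, Finset.sum_mul]
    rw [Finset.sum_comm]
  have h2 : (B.submatrix (Sum.elim g ![t, r]) (Sum.elim s ![i, j])).det =
      D.det * (σ t i * σ r j - σ t j * σ r i) := by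
    have : B.submatrix (Sum.elim g ![t, r]) (Sum.elim s ![i, j]) =
        fromBlocks D (B.submatrix g ![i, j]) (B.submatrix ![t, r] s)
          (B.submatrix ![t, r] ![i, j]) := by
      ext (x | x) (y | y) <;> rfl
    rw [this, det_fromBlocks₁₁]
    congr 1
    have h3 : ∀ a b, (B.submatrix ![t, r] ![i, j] -
        B.submatrix ![t, r] s * ⅟D * B.submatrix g ![i, j]) a b = σ (![t, r] a) (![i, j] b) := by
      intro a b
      simp only [Matrix.sub_apply, mul_apply, submatrix_apply, σ, Finset.sum_mul]
      rw [Finset.sum_comm]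
    rw [det_fin_two, h3, h3, h3, h3]
    simp
  rw [h1, h1, h1, h1, h2]
  ring

variable {K : Type*} [Field K] (w : AddValuation K (WithTop ℝ)) {α β : Type*} [DecidableEq α]
  [DecidableEq β]

/-- The value of the minor of `B` with rows in `T` and columns in `S` (in any order). -/
noncomputable def minorVal (B : Matrix α β K) (T : Finset α) (S : Finset β) : WithTop ℝ :=
  if h : T.card = S.card then
    w (B.submatrix (fun i : Fin S.card => ((T.equivFinOfCardEq h).symm i : α))
      (fun i => (S.equivFin.symm i : β))).det
  else 0

/-- Frees the value of a minor from the enumerations in its definition: any index type and any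
injective enumerations may be used. -/
theorem minorVal_image {ι : Type*} [Fintype ι] [DecidableEq ι] (B : Matrix α β K) {g : ι → α}
    {s : ι → β} (hg : Function.Injective g) (hs : Function.Injective s) {T : Finset α}
    {S : Finset β} (hT : Finset.univ.image g = T) (hS : Finset.univ.image s = S) :
    minorVal w B T S = w (B.submatrix g s).det := by
  subst hT hS
  have hcard : (Finset.univ.image g).card = (Finset.univ.image s).card := by
    rw [Finset.card_image_of_injective _ hg, Finset.card_image_of_injective _ hs]
  rw [minorVal, dif_pos hcard]
  obtain ⟨e1, h1⟩ := exists_equiv_of_image_equiv hg ((Finset.univ.image g).equivFinOfCardEq hcard)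
  obtain ⟨e2, h2⟩ := exists_equiv_of_image_equiv hs (Finset.univ.image s).equivFin
  rw [← val_det_submatrix_equiv w (B.submatrix g s) e1 e2, submatrix_submatrix]
  congr 2
  ext i j
  simp [← h1, ← h2]

theorem exists_enumeration {m : ℕ} (S : Finset β) (h : S.card = m) :
    ∃ s : Fin m → β, Function.Injective s ∧ Finset.univ.image s = S := by
  refine ⟨fun i => ((S.equivFinOfCardEq h).symm i : β),
    Subtype.val_injective.comp (Equiv.injective _), ?_⟩
  ext x
  simp only [Finset.mem_image, Finset.mem_univ, true_and]
  constructor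
  · rintro ⟨i, rfl⟩
    exact Subtype.prop _
  · intro hx
    exact ⟨S.equivFinOfCardEq h ⟨x, hx⟩, by simp⟩

theorem minorVal_empty (B : Matrix α β K) : minorVal w B ∅ ∅ = 0 := by
  rw [minorVal_image w B (ι := Fin 0) (g := Fin.elim0) (s := Fin.elim0)
    (fun i => i.elim0) (fun i => i.elim0) (by simp) (by simp)]
  simp

theorem exists_val_ne_zero_of_minorVal {B : Matrix α β K} {T : Finset α} {S : Finset β}
    (h : minorVal w B T S ≠ ⊤) {ι : Type*} [Fintype ι] [DecidableEq ι] {g : ι → α}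
    {s : ι → β} (hg : Function.Injective g) (hs : Function.Injective s)
    (hT : Finset.univ.image g = T) (hS : Finset.univ.image s = S) :
    (B.submatrix g s).det ≠ 0 := by
  rw [minorVal_image w B hg hs hT hS] at h
  exact w.ne_top_iff.1 h

variable {T : Finset α} {W : Finset β} {t r : α} {i j : β}

theorem image_sum_elim_unit {γ ι : Type*} [Fintype ι] [DecidableEq γ] {g : ι → γ} {T : Finset γ}
    (hT : Finset.univ.image g = T) (t : γ) :
    Finset.univ.image (Sum.elim g fun _ : Unit => t) = insert t T := by
  subst hT
  ext x
  simp [eq_comm, or_comm]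

theorem image_sum_elim_pair {γ ι : Type*} [Fintype ι] [DecidableEq γ] {g : ι → γ} {T : Finset γ}
    (hT : Finset.univ.image g = T) (t r : γ) :
    Finset.univ.image (Sum.elim g ![t, r]) = insert t (insert r T) := by
  subst hT
  ext x
  simp only [Finset.mem_image, Finset.mem_univ, true_and, Sum.exists, Sum.elim_inl, Sum.elim_inr,
    Fin.exists_fin_two, cons_val_zero, cons_val_one, Finset.mem_insert]
  tauto

theorem injective_sum_elim_unit {γ ι : Type*} [Fintype ι] [DecidableEq γ] {g : ι → γ}
    (hg : Function.Injective g) {T : Finset γ}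
    (hT : Finset.univ.image g = T) {t : γ} (ht : t ∉ T) :
    Function.Injective (Sum.elim g fun _ : Unit => t) := by
  subst hT
  refine Function.Injective.sumElim hg (fun _ _ _ => rfl) fun a _ h => ht ?_
  exact Finset.mem_image.2 ⟨a, Finset.mem_univ _, h⟩

theorem injective_sum_elim_pair {γ ι : Type*} [Fintype ι] [DecidableEq γ] {g : ι → γ}
    (hg : Function.Injective g) {T : Finset γ}
    (hT : Finset.univ.image g = T) {t r : γ} (ht : t ∉ T) (hr : r ∉ T) (htr : t ≠ r) :
    Function.Injective (Sum.elim g ![t, r]) := by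
  subst hT
  refine Function.Injective.sumElim hg ?_ fun a b h => ?_
  · intro a b h
    fin_cases a <;> fin_cases b <;> simp_all
  · fin_cases b
    · exact ht (Finset.mem_image.2 ⟨a, Finset.mem_univ _, h⟩)
    · exact hr (Finset.mem_image.2 ⟨a, Finset.mem_univ _, h⟩)

/-- The three-term relation between values of minors. -/
theorem exists_three_term (B : Matrix α β K) (hcard : T.card = W.card) (ht : t ∉ T) (hr : r ∉ T)
    (htr : t ≠ r) (hi : i ∉ W) (hj : j ∉ W) (hij : i ≠ j) (hne : minorVal w B T W ≠ ⊤) :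
    ∃ x y z : K, x = y - z ∧
      w x = minorVal w B T W + minorVal w B (insert t (insert r T)) (insert i (insert j W)) ∧
      w y = minorVal w B (insert t T) (insert i W) + minorVal w B (insert r T) (insert j W) ∧
      w z = minorVal w B (insert t T) (insert j W) + minorVal w B (insert r T) (insert i W) := by
  obtain ⟨g, hg, hgT⟩ := exists_enumeration T hcard
  obtain ⟨s, hs, hsW⟩ := exists_enumeration W rfl
  refine ⟨_, _, _, det_mul_det_sum_elim B g s
    (exists_val_ne_zero_of_minorVal w hne hg hs hgT hsW) t r i j, ?_, ?_, ?_⟩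
  · rw [w.map_mul, minorVal_image w B hg hs hgT hsW,
      minorVal_image w B (injective_sum_elim_pair hg hgT ht hr htr)
        (injective_sum_elim_pair hs hsW hi hj hij) (image_sum_elim_pair hgT t r)
        (image_sum_elim_pair hsW i j)]
  all_goals
    rw [w.map_mul]
    congr 1 <;> symm <;> apply minorVal_image <;>
      first
      | exact image_sum_elim_unit hgT _
      | exact image_sum_elim_unit hsW _
      | (apply injective_sum_elim_unit hg hgT; assumption)
      | (apply injective_sum_elim_unit hs hsW; assumption)

end Minors

/-! ### Generic natural points of polynomials over a valued field -/

section GenericMixing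

open Matrix MvPolynomial

variable {K : Type*} [Field K] (w : AddValuation K (WithTop ℝ))

/-- Finitely many polynomials attain their minimal value on natural points simultaneously. -/
theorem exists_nat_point_min_val (hw : ∀ m : ℕ, m ≠ 0 → w (m : K) = 0) {σ κ : Type*} [Finite σ]
    [Finite κ] (f : κ → MvPolynomial σ K) :
    ∃ u : σ → ℕ, ∀ k, ∀ u' : σ → ℕ,
      w (MvPolynomial.eval (fun i => (u i : K)) (f k)) ≤ w (MvPolynomial.eval (fun i => (u' i : K)) (f k)) := by
  classical
  have := Fintype.ofFinite κ
  -- normalize every nonzero polynomial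
  let O : Subring K :=
    { carrier := {x | 0 ≤ w x}
      mul_mem' := fun {a b} ha hb => by
        simp only [Set.mem_ofPred_eq, w.map_mul] at ha hb ⊢; exact add_nonneg ha hb
      one_mem' := by simp
      add_mem' := fun {a b} ha hb => w.map_le_add ha hb
      zero_mem' := by simp
      neg_mem' := fun {a} ha => by simpa [w.map_neg] using ha }
  let I : Ideal O :=
    { carrier := {x | 0 < w (x : K)}
      add_mem' := fun {a b} ha hb => w.map_lt_add ha hb
      zero_mem' := by simp
      smul_mem' := fun c x hx => by
        have h1 : 0 ≤ w (c : K) := c.2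
        change 0 < w ((c : K) * x)
        rw [w.map_mul]
        exact lt_of_lt_of_le hx (le_add_of_nonneg_left h1) }
  have hI : I.IsPrime := by
    refine ⟨?_, ?_⟩
    · rw [Ideal.ne_top_iff_one]
      change ¬ (0 < w ((1 : O) : K))
      simp
    · intro x y hxy
      by_contra! h
      have hx : w (x : K) = 0 := le_antisymm (not_lt.1 h.1) x.2
      have hy : w (y : K) = 0 := le_antisymm (not_lt.1 h.2) y.2
      have : 0 < w ((x : K) * y) := hxy
      rw [w.map_mul, hx, hy, add_zero] at this
      exact lt_irrefl _ this
  let k := O ⧸ I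
  -- The quotient of the valuation ring by the elements of positive value contains infinitely many
  -- natural numbers, since nonzero integers have value `0`.
  have hchar : Function.Injective (fun m : ℕ => (m : k)) := by
    have hlt : ∀ a b : ℕ, a < b → (a : k) ≠ b := by
      intro a b hab h
      obtain ⟨d, hd, rfl⟩ := Nat.exists_eq_add_of_lt hab
      have h1 : ((d + 1 : ℕ) : k) = 0 := by
        have : ((a + d + 1 : ℕ) : k) = a + ((d + 1 : ℕ) : k) := by push_cast; ring
        rw [this] at h
        exact (left_eq_add.1 h)
      have h2 : ((d + 1 : ℕ) : k) = Ideal.Quotient.mk I ((d + 1 : ℕ) : O) := by simp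
      rw [h2, Ideal.Quotient.eq_zero_iff_mem] at h1
      have h3 : 0 < w (((d + 1 : ℕ) : O) : K) := h1
      rw [show (((d + 1 : ℕ) : O) : K) = ((d + 1 : ℕ) : K) from map_natCast O.subtype _,
        hw _ (Nat.succ_ne_zero d)] at h3
      exact lt_irrefl _ h3
    intro a b h
    by_contra hne
    rcases lt_or_gt_of_ne hne with h1 | h1
    · exact hlt _ _ h1 h
    · exact hlt _ _ h1 h.symm
  -- Dividing by a coefficient of least value gives an integral polynomial with nonzero reduction.
  -- The value of `c` is then a lower bound on all natural points.
  have hnorm : ∀ κ' : κ, f κ' ≠ 0 → ∃ (c : K) (g : MvPolynomial σ O), c ≠ 0 ∧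
      f κ' = MvPolynomial.C c * MvPolynomial.map O.subtype g ∧
      MvPolynomial.map (Ideal.Quotient.mk I) g ≠ 0 := by
    intro κ' h0
    obtain ⟨m0, hm0, hmin⟩ := (f κ').support.exists_min_image (fun m => w ((f κ').coeff m))
      (by rwa [Finset.nonempty_iff_ne_empty, ne_eq, MvPolynomial.support_eq_empty])
    set c := (f κ').coeff m0 with hc
    have hc0 : c ≠ 0 := MvPolynomial.mem_support_iff.1 hm0
    have hmem : ∀ m, (f κ').coeff m / c ∈ O := by
      intro m
      change 0 ≤ w _
      by_cases hm : m ∈ (f κ').support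
      · have h1 : w ((f κ').coeff m / c) + w c = w ((f κ').coeff m) := by
          rw [← w.map_mul, div_mul_cancel₀ _ hc0]
        have h2 := hmin m hm
        rw [← h1] at h2
        by_contra h3
        have h4 : w ((f κ').coeff m / c) < 0 := not_le.1 h3
        have h5 := WithTop.add_lt_add_right (w.ne_top_iff.2 hc0) h4
        rw [zero_add] at h5
        exact absurd h2 (not_le.2 h5)
      · rw [MvPolynomial.notMem_support_iff.1 hm]; simp
    let g : MvPolynomial σ O := ∑ m ∈ (f κ').support, MvPolynomial.monomial m ⟨_, hmem m⟩
    refine ⟨c, g, hc0, ?_, ?_⟩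
    · simp only [g, map_sum, MvPolynomial.map_monomial]
      conv_lhs => rw [(f κ').as_sum]
      rw [Finset.mul_sum]
      refine Finset.sum_congr rfl fun m _ => ?_
      rw [MvPolynomial.C_mul_monomial]
      congr 1
      change _ = c * ((f κ').coeff m / c)
      field_simp
    · intro h
      have h1 := congrArg (MvPolynomial.coeff m0) h
      rw [MvPolynomial.coeff_map, MvPolynomial.coeff_zero, Ideal.Quotient.eq_zero_iff_mem] at h1
      have h2 : (0 : WithTop ℝ) < w ((g.coeff m0 : O) : K) := h1
      have h3 : g.coeff m0 = 1 := by
        simp only [g, MvPolynomial.coeff_sum, MvPolynomial.coeff_monomial]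
        rw [Finset.sum_ite_eq' (f κ').support m0, if_pos hm0]
        exact Subtype.ext (div_self hc0)
      rw [h3] at h2
      simp at h2
  choose c g hc hfg hg using hnorm
  -- The product of all reductions, with `1` standing in for zero polynomials, is nonzero. A natural
  -- point where it does not vanish attains every lower bound simultaneously.
  have hprod : (∏ κ' : κ, if h : f κ' ≠ 0 then MvPolynomial.map (Ideal.Quotient.mk I) (g κ' h)
      else 1 : MvPolynomial σ k) ≠ 0 := by
    refine Finset.prod_ne_zero_iff.2 fun κ' _ => ?_
    split_ifs with h
    · exact hg κ' h
    · exact one_ne_zero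
  have hex : ∃ u : σ → ℕ, MvPolynomial.eval (fun i => (u i : k))
      (∏ κ' : κ, if h : f κ' ≠ 0 then MvPolynomial.map (Ideal.Quotient.mk I) (g κ' h)
      else 1 : MvPolynomial σ k) ≠ 0 := by
    by_contra! h
    refine hprod (MvPolynomial.funext_set (fun _ => Set.range fun m : ℕ => (m : k))
      (fun _ => Set.infinite_range_of_injective hchar) fun x hx => ?_)
    choose u hu using fun i => hx i (Set.mem_univ i)
    rw [map_zero, ← h u]
    congr 1
    exact congrArg _ (funext fun i => (hu i).symm)
  obtain ⟨u, hu⟩ := hex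
  refine ⟨u, fun κ' u' => ?_⟩
  by_cases h : f κ' ≠ 0
  · rw [map_prod] at hu
    have h1 := Finset.prod_ne_zero_iff.1 hu κ' (Finset.mem_univ _)
    rw [dif_pos h] at h1
    have hev : ∀ u : σ → ℕ, MvPolynomial.eval (fun i => (u i : K)) (f κ') =
        c κ' h * (MvPolynomial.eval (fun i => (u i : O)) (g κ' h) : O) := by
      intro u
      rw [hfg κ' h, map_mul, MvPolynomial.eval_C, MvPolynomial.eval_map]
      congr 1
      have := MvPolynomial.eval₂_comp_left O.subtype (RingHom.id O) (fun i => (u i : O)) (g κ' h)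
      simp only [RingHom.comp_id] at this
      refine Eq.trans ?_ this.symm
      congr 1
    rw [hev, hev, w.map_mul, w.map_mul]
    have h2 : w ((MvPolynomial.eval (fun i => (u i : O)) (g κ' h) : O) : K) = 0 := by
      refine le_antisymm (not_lt.1 fun h3 => h1 ?_)
        (MvPolynomial.eval (fun i => (u i : O)) (g κ' h)).2
      have h4 : (MvPolynomial.eval (fun i => (u i : O)) (g κ' h) : O) ∈ I := h3
      rw [← Ideal.Quotient.eq_zero_iff_mem] at h4
      rw [MvPolynomial.eval_map, ← h4]
      have := MvPolynomial.eval₂_comp_left (Ideal.Quotient.mk I) (RingHom.id O) (fun i => (u i : O)) (g κ' h)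
      simp only [RingHom.comp_id] at this
      refine Eq.trans ?_ this.symm
      congr 1
    rw [h2]
    exact add_le_add le_rfl (MvPolynomial.eval (fun i => (u' i : O)) (g κ' h)).2
  · rw [not_not.1 h]; simp

end GenericMixing

/-! ### Generic mixing of rows -/

section RowMixing

open Matrix

/-- Multilinearity in the rows. Summing over all maps instead of subsets avoids orderings; maps that
are not injective give vanishing minors. -/
theorem det_mul_eq_sum {K ι α : Type*} [CommRing K] [Fintype ι] [DecidableEq ι] [Fintype α]
    [DecidableEq α] (U : Matrix ι α K) (B : Matrix α ι K) :
    (U * B).det = ∑ g : ι → α, (∏ i, U i (g i)) * (B.submatrix g id).det := by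
  have h : (U * B) = fun i => ∑ a, U i a • B a := by
    ext i j
    simp [mul_apply, Finset.sum_apply]
  have h1 := (detRowAlternating (n := ι) (R := K)).toMultilinearMap.map_sum
    (fun i a => U i a • B a)
  change (detRowAlternating (n := ι) (R := K)) _ = _
  rw [h]
  refine h1.trans (Finset.sum_congr rfl fun g _ => ?_)
  rw [MultilinearMap.map_smul_univ, smul_eq_mul]
  rfl

variable {K : Type*} [Field K] (w : AddValuation K (WithTop ℝ)) {α β : Type*} [DecidableEq α]
  [DecidableEq β]

theorem val_nat_nonneg (hw : ∀ m : ℕ, m ≠ 0 → w (m : K) = 0) (m : ℕ) : 0 ≤ w (m : K) := by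
  rcases eq_or_ne m 0 with rfl | h
  · simp
  · exact (hw m h).ge

theorem val_prod {ι : Type*} (s : Finset ι) (f : ι → K) : w (∏ i ∈ s, f i) = ∑ i ∈ s, w (f i) := by
  classical
  induction s using Finset.induction_on with
  | empty => simp
  | insert a s ha ih => rw [Finset.prod_insert ha, Finset.sum_insert ha, w.map_mul, ih]

variable [Fintype α]

/-- Lower bounds on minors survive multiplication by a matrix with integral entries. -/
theorem le_minorVal_mul (U : Matrix α α K) (hU : ∀ a b, 0 ≤ w (U a b)) (B : Matrix α β K)
    {T : Finset α} {S : Finset β} (hTS : T.card = S.card) {c : WithTop ℝ}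
    (hc : ∀ T' : Finset α, T'.card = S.card → c ≤ minorVal w B T' S) :
    c ≤ minorVal w (U * B) T S := by
  obtain ⟨g, hg, hgT⟩ := exists_enumeration T hTS
  obtain ⟨s, hs, hsS⟩ := exists_enumeration S rfl
  rw [minorVal_image w _ hg hs hgT hsS]
  have h1 : (U * B).submatrix g s = U.submatrix g id * B.submatrix id s := by
    rw [submatrix_mul_equiv (e₂ := Equiv.refl α) U B g s |>.symm]
    rfl
  rw [h1, det_mul_eq_sum]
  refine w.map_le_sum fun g' _ => ?_
  rw [w.map_mul, submatrix_submatrix]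
  have h2 : 0 ≤ w (∏ i, (U.submatrix g id) i (g' i)) := by
    rw [val_prod]
    exact Finset.sum_nonneg fun i _ => hU _ _
  by_cases hinj : Function.Injective g'
  · refine le_trans ?_ (le_add_of_nonneg_left h2)
    have h3 := minorVal_image w B hinj hs rfl hsS
    change c ≤ w (B.submatrix g' s).det
    rw [← h3]
    exact hc _ (by rw [Finset.card_image_of_injective _ hinj]; simp)
  · have h4 : (B.submatrix g' s).det = 0 := by
      rw [Function.not_injective_iff] at hinj
      obtain ⟨a, b, hab, hne⟩ := hinj
      exact det_zero_of_row_eq hne (by ext j; simp [hab])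
    change c ≤ _ + w (B.submatrix g' s).det
    rw [h4]
    simp

/-- After multiplication by a generic invertible integral matrix, the value of every minor is the
minimal one among all minors on the same columns. -/
theorem exists_generic_mixing [Fintype β] (hw : ∀ m : ℕ, m ≠ 0 → w (m : K) = 0)
    (B : Matrix α β K) :
    ∃ U : Matrix α α K, w U.det = 0 ∧
      (∀ (T : Finset α) (S : Finset β), T.card = S.card → ∀ T' : Finset α, T'.card = S.card →
        minorVal w (U * B) T S ≤ minorVal w B T' S) ∧
      ∀ (T : Finset α) (S : Finset β), T.card = S.card → ∀ c : WithTop ℝ,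
        (∀ T' : Finset α, T'.card = S.card → c ≤ minorVal w B T' S) →
        c ≤ minorVal w (U * B) T S := by
  classical
  let UX : Matrix α α (MvPolynomial (α × α) K) := Matrix.of fun a b => MvPolynomial.X (a, b)
  choose g hg hgT using fun p : {p : Finset α × Finset β // p.1.card = p.2.card} =>
    exists_enumeration p.1.1 p.2
  choose s hs hsS using fun p : {p : Finset α × Finset β // p.1.card = p.2.card} =>
    exists_enumeration p.1.2 rfl
  let f : Option {p : Finset α × Finset β // p.1.card = p.2.card} → MvPolynomial (α × α) K :=
    fun o => o.elim UX.det fun p => ((UX * B.map MvPolynomial.C).submatrix (g p) (s p)).det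
  obtain ⟨u, hu⟩ := exists_nat_point_min_val w hw f
  let mat : (α × α → ℕ) → Matrix α α K := fun u => Matrix.of fun a b => (u (a, b) : K)
  have hUX : ∀ u : α × α → ℕ, (MvPolynomial.eval (fun i => (u i : K))).mapMatrix UX = mat u := by
    intro u
    ext a b
    simp [UX, mat]
  have hev0 : ∀ u : α × α → ℕ, MvPolynomial.eval (fun i => (u i : K)) (f none) = (mat u).det := by
    intro u
    rw [← hUX, ← RingHom.map_det]
    rfl
  have hev : ∀ (u : α × α → ℕ) p, w (MvPolynomial.eval (fun i => (u i : K)) (f (some p))) =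
      minorVal w (mat u * B) p.1.1 p.1.2 := by
    intro u p
    rw [minorVal_image w (mat u * B) (hg p) (hs p) (hgT p) (hsS p)]
    change w (MvPolynomial.eval _ (Matrix.det _)) = _
    rw [RingHom.map_det]
    congr 2
    ext a b
    change MvPolynomial.eval _ (∑ j, UX (g p a) j * (B.map MvPolynomial.C) j (s p b)) =
      ∑ j, mat u (g p a) j * B j (s p b)
    simp [UX, mat]
  refine ⟨mat u, ?_, ?_, ?_⟩
  -- The identity matrix is a competitor, so the least value of the determinant is at most `0`. A
  -- determinant with integer entries has nonnegative value.
  · have h1 := hu none fun p => if p.1 = p.2 then 1 else 0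
    rw [hev0, hev0] at h1
    have h2 : mat (fun p => if p.1 = p.2 then 1 else 0) = 1 := by
      ext a b
      simp [mat, Matrix.one_apply]
    rw [h2, det_one, w.map_one] at h1
    refine le_antisymm h1 ?_
    have h3 : (mat u).det = ((Matrix.det (Matrix.of fun a b => (u (a, b) : ℤ)) : ℤ) : K) := by
      refine Eq.trans (congrArg det ?_)
        (RingHom.map_det (Int.castRingHom K) (Matrix.of fun a b => (u (a, b) : ℤ))).symm
      ext a b
      simp [mat]
    rw [h3]
    rcases Int.natAbs_eq (Matrix.det (Matrix.of fun a b => (u (a, b) : ℤ))) with h | h <;> rw [h]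
    · rw [Int.cast_natCast]; exact val_nat_nonneg w hw _
    · rw [Int.cast_neg, Int.cast_natCast, w.map_neg]; exact val_nat_nonneg w hw _
  · intro T S hTS T' hT'
    obtain ⟨g', hg', hgT'⟩ := exists_enumeration T' hT'
    set p : {p : Finset α × Finset β // p.1.card = p.2.card} := ⟨(T, S), hTS⟩ with hp
    -- The competitor is a `0`-`1` matrix carrying the rows of `T'` to the positions of `T`; its
    -- minor on `T` is the minor of `B` on `T'`.
    let u' : α × α → ℕ := fun q => if ∃ i, g p i = q.1 ∧ g' i = q.2 then 1 else 0
    have h1 := hu (some p) u'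
    rw [hev, hev] at h1
    refine h1.trans (le_of_eq ?_)
    rw [minorVal_image w (mat u' * B) (hg p) (hs p) (hgT p) (hsS p),
      minorVal_image w B hg' (hs p) hgT' (hsS p)]
    congr 2
    ext i j
    rw [submatrix_apply, submatrix_apply, mul_apply, Finset.sum_eq_single (g' i)]
    · have : ∃ i', g p i' = g p i ∧ g' i' = g' i := ⟨i, rfl, rfl⟩
      simp [mat, u', this]
    · intro b _ hb
      have : ¬ ∃ i', g p i' = g p i ∧ g' i' = b := by
        rintro ⟨i', h2, h3⟩
        rw [hg p h2] at h3
        exact hb h3.symm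
      simp only [mat, u', of_apply, if_neg this, Nat.cast_zero, zero_mul]
    · simp
  · intro T S hTS c hc
    exact le_minorVal_mul w (mat u) (fun a b => val_nat_nonneg w hw _) B hTS hc

end RowMixing

/-! ### Uniform realizability and the Grassmannian -/

section Uniform

open Matrix

theorem mem_interL_iff {n : ℕ} {X : Set (KSubset (n + n) n → ℝ)} {F : Finset (Fin n) → ℝ} :
    F ∈ interL X ↔ (fun C : KSubset (n + n) n => F (lowPart C.1)) ∈ X := by
  constructor
  · rintro ⟨p, hp, rfl⟩
    have : (fun C : KSubset (n + n) n => phiL n p (lowPart C.1)) = p := by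
      funext C
      exact p.2 _ _ (lowPart_fillUp _)
    rw [this]
    exact hp
  · intro h
    refine ⟨(phiL n).symm F, h, (phiL n).apply_symm_apply F⟩

theorem exists_kSubset {n : ℕ} (T S : Finset (Fin n)) (h : T.card = S.card) :
    ∃ C : KSubset (n + n) n, lowPart C.1 = S ∧ ∀ j, Fin.natAdd n j ∈ C.1 ↔ j ∉ T := by
  have hdis : Disjoint (S.map (Fin.castAddEmb n)) (Tᶜ.map (Fin.natAddEmb n)) := by
    rw [Finset.disjoint_left]
    intro x hx hy
    simp only [Finset.mem_map] at hx hy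
    obtain ⟨a, _, rfl⟩ := hx
    obtain ⟨b, _, hb⟩ := hy
    have := congrArg Fin.val hb
    simp at this
    omega
  refine ⟨⟨(S.map (Fin.castAddEmb n)).disjUnion (Tᶜ.map (Fin.natAddEmb n)) hdis, ?_⟩, ?_, ?_⟩
  · rw [Finset.card_disjUnion, Finset.card_map, Finset.card_map, ← h, Finset.card_add_card_compl,
      Fintype.card_fin]
  · ext i
    simp only [lowPart, Finset.mem_filter, Finset.mem_univ, true_and, Finset.mem_disjUnion,
      Finset.mem_map]
    constructor
    · rintro (⟨a, ha, h⟩ | ⟨b, _, h⟩)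
      · have := congrArg Fin.val h
        simp at this
        rwa [← Fin.ext this]
      · have := congrArg Fin.val h
        simp at this
        omega
    · exact fun h => Or.inl ⟨i, h, rfl⟩
  · intro j
    simp only [Finset.mem_disjUnion, Finset.mem_map, Finset.mem_compl]
    constructor
    · rintro (⟨a, _, h⟩ | ⟨b, hb, h⟩)
      · have := congrArg Fin.val h
        simp at this
        omega
      · have := congrArg Fin.val h
        simp at this
        rwa [← Fin.ext this]
    · exact fun h => Or.inr ⟨j, h, rfl⟩

/-- The rows of `[B | 1]` not needed for the columns of `C` in the identity block. -/
def highCompl {n : ℕ} (C : Finset (Fin (n + n))) : Finset (Fin n) :=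
  Finset.univ.filter fun j => Fin.natAdd n j ∉ C

theorem card_highCompl {n : ℕ} (C : KSubset (n + n) n) :
    (highCompl C.1).card = (lowPart C.1).card := by
  have h1 : C.1 = (lowPart C.1).map (Fin.castAddEmb n) ∪ (highCompl C.1)ᶜ.map (Fin.natAddEmb n) := by
    ext x
    refine Fin.addCases (fun i => ?_) (fun i => ?_) x
    · simp only [Finset.mem_union, Finset.mem_map, lowPart, Finset.mem_filter, Finset.mem_univ,
        true_and]
      constructor
      · exact fun h => Or.inl ⟨i, h, rfl⟩
      · rintro (⟨a, ha, h⟩ | ⟨b, _, h⟩)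
        · exact h ▸ ha
        · have := congrArg Fin.val h
          simp at this
          omega
    · simp only [Finset.mem_union, Finset.mem_map, highCompl, Finset.mem_compl, Finset.mem_filter,
        Finset.mem_univ, true_and, not_not]
      constructor
      · exact fun h => Or.inr ⟨i, h, rfl⟩
      · rintro (⟨a, _, h⟩ | ⟨b, hb, h⟩)
        · have := congrArg Fin.val h
          simp at this
          omega
        · exact h ▸ hb
  have h2 := congrArg Finset.card h1
  rw [Finset.card_union_of_disjoint, Finset.card_map, Finset.card_map, C.2, Finset.card_compl,
    Fintype.card_fin] at h2
  · have := (highCompl C.1).card_le_univ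
    rw [Fintype.card_fin] at this
    omega
  · rw [Finset.disjoint_left]
    intro x hx hy
    simp only [Finset.mem_map] at hx hy
    obtain ⟨a, _, rfl⟩ := hx
    obtain ⟨b, _, hb⟩ := hy
    have := congrArg Fin.val hb
    simp at this
    omega

/-- The matrix `[B | 1]`. -/
def appendOne {K : Type*} [CommRing K] {n : ℕ} (B : Matrix (Fin n) (Fin n) K) :
    Matrix (Fin n) (Fin (n + n)) K :=
  Matrix.of fun i => Fin.addCases (B i) ((1 : Matrix (Fin n) (Fin n) K) i)

theorem maxMinor_mul {K : Type*} [CommRing K] {k m : ℕ} (N : Matrix (Fin k) (Fin k) K)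
    (M : Matrix (Fin k) (Fin m) K) (S : KSubset m k) :
    maxMinor (N * M) S = N.det * maxMinor M S := by
  rw [maxMinor, maxMinor, ← det_mul]
  rfl

variable {K : Type*} [Field K] (w : AddValuation K (WithTop ℝ))

theorem val_maxMinor {k m : ℕ} (M : Matrix (Fin k) (Fin m) K) (S : KSubset m k) :
    w (maxMinor M S) = minorVal w M Finset.univ S.1 := by
  rw [maxMinor, minorVal_image w M (g := id) (s := S.1.orderEmbOfFin S.2) Function.injective_id
    (S.1.orderEmbOfFin S.2).injective Finset.image_id]
  simp

/-- Listing first the rows not met by the chosen identity columns makes the selected submatrix block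
triangular, with an identity block. -/
theorem val_maxMinor_appendOne {n : ℕ} (B : Matrix (Fin n) (Fin n) K) (C : KSubset (n + n) n) :
    w (maxMinor (appendOne B) C) = minorVal w B (highCompl C.1) (lowPart C.1) := by
  obtain ⟨g, hg, hgT⟩ := exists_enumeration (highCompl C.1) (card_highCompl C)
  obtain ⟨s, hs, hsS⟩ := exists_enumeration (lowPart C.1) rfl
  rw [val_maxMinor, minorVal_image w B hg hs hgT hsS]
  have hgm : ∀ i, Fin.natAdd n (g i) ∉ C.1 := by
    intro i
    have : g i ∈ highCompl C.1 := hgT ▸ Finset.mem_image_of_mem _ (Finset.mem_univ i)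
    simpa [highCompl] using this
  have hsm : ∀ i, Fin.castAdd n (s i) ∈ C.1 := by
    intro i
    have : s i ∈ lowPart C.1 := hsS ▸ Finset.mem_image_of_mem _ (Finset.mem_univ i)
    simpa [lowPart] using this
  let J := {j : Fin n // Fin.natAdd n j ∈ C.1}
  let e : Fin (lowPart C.1).card ⊕ J → Fin n := Sum.elim g Subtype.val
  let f : Fin (lowPart C.1).card ⊕ J → Fin (n + n) :=
    Sum.elim (fun i => Fin.castAdd n (s i)) (fun j => Fin.natAdd n j.1)
  have he : Function.Injective e := by
    refine Function.Injective.sumElim hg Subtype.val_injective fun i j h => hgm i ?_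
    rw [h]
    exact j.2
  have hf : Function.Injective f := by
    refine Function.Injective.sumElim ((Fin.castAdd_injective n n).comp hs)
      (fun a b h => Subtype.ext (Fin.natAdd_injective n n h)) fun i j h => ?_
    have := congrArg Fin.val h
    simp at this
    omega
  have heT : Finset.univ.image e = Finset.univ := by
    refine Finset.eq_univ_iff_forall.2 fun j => ?_
    by_cases hj : Fin.natAdd n j ∈ C.1
    · exact Finset.mem_image.2 ⟨Sum.inr ⟨j, hj⟩, Finset.mem_univ _, rfl⟩
    · have : j ∈ highCompl C.1 := by simpa [highCompl] using hj
      rw [← hgT] at this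
      obtain ⟨i, _, hi⟩ := Finset.mem_image.1 this
      exact Finset.mem_image.2 ⟨Sum.inl i, Finset.mem_univ _, hi⟩
  have hfC : Finset.univ.image f = C.1 := by
    ext x
    simp only [Finset.mem_image, Finset.mem_univ, true_and]
    constructor
    · rintro ⟨i | j, rfl⟩
      · exact hsm i
      · exact j.2
    · refine Fin.addCases (fun i hi => ?_) (fun i hi => ⟨Sum.inr ⟨i, hi⟩, rfl⟩) x
      have : i ∈ lowPart C.1 := by simpa [lowPart] using hi
      rw [← hsS] at this
      obtain ⟨l, _, hl⟩ := Finset.mem_image.1 this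
      exact ⟨Sum.inl l, congrArg (Fin.castAdd n) hl⟩
  rw [minorVal_image w (appendOne B) he hf heT hfC]
  have hblock : (appendOne B).submatrix e f = fromBlocks (B.submatrix g s) 0
      (B.submatrix Subtype.val s) (1 : Matrix J J K) := by
    ext (i | i) (j | j)
    · simp [appendOne, e, f]
    · have : g i ≠ j.1 := fun h => hgm i (h ▸ j.2)
      simp [-Fin.natAdd_eq_addNat, appendOne, e, f, this]
    · simp [appendOne, e, f]
    · rcases eq_or_ne i j with rfl | hij
      · simp [-Fin.natAdd_eq_addNat, appendOne, e, f]
      · have : i.1 ≠ j.1 := fun h => hij (Subtype.ext h)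
        simp [-Fin.natAdd_eq_addNat, appendOne, e, f, hij, this]
  rw [hblock, det_fromBlocks_zero₁₂, det_one, mul_one]

/-- `F` is, up to sign and a common shift, the value of each minor of some square matrix as a
function of the columns of the minor. -/
def IsUniform {n : ℕ} (F : Finset (Fin n) → ℝ) : Prop :=
  ∃ (B : Matrix (Fin n) (Fin n) K) (c : K), ∀ T S : Finset (Fin n), T.card = S.card →
    w c + minorVal w B T S = ((-F S : ℝ) : WithTop ℝ)

/-- The standard chart: the coordinate at `fillUp ∅` is a multiple of the minor on the last `n`
columns, so that block is invertible and can be normalized to `1`. -/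
theorem exists_eq_maxMinor_appendOne {n : ℕ} {p : KSubset (n + n) n → K}
    (hp : p ∈ grassmannian K n (n + n)) (hp0 : p (fillUp ∅) ≠ 0) :
    ∃ (B : Matrix (Fin n) (Fin n) K) (c : K), c ≠ 0 ∧ ∀ C, p C = c * maxMinor (appendOne B) C := by
  obtain ⟨L, M, -, -, c, hc, hpM⟩ := hp
  have he : ⇑((fillUp (∅ : Finset (Fin n))).1.orderEmbOfFin (fillUp (∅ : Finset (Fin n))).2) =
      Fin.natAdd n := by
    refine (Finset.orderEmbOfFin_unique _ (fun i => ?_) (Fin.strictMono_natAdd n)).symm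
    simp [fillUp]
  have hdet : (M.submatrix id (Fin.natAdd n)).det ≠ 0 := by
    intro h
    refine hp0 ?_
    rw [hpM, maxMinor, he, h, mul_zero]
  set N := M.submatrix id (Fin.natAdd n) with hN
  have hu : IsUnit N.det := isUnit_iff_ne_zero.2 hdet
  refine ⟨(N⁻¹ * M).submatrix id (Fin.castAdd n), c * N.det, mul_ne_zero hc hdet, fun C => ?_⟩
  have h1 : appendOne ((N⁻¹ * M).submatrix id (Fin.castAdd n)) = N⁻¹ * M := by
    ext i j
    refine Fin.addCases (fun j => ?_) (fun j => ?_) j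
    · simp [appendOne]
    · have h2 : N⁻¹ * N = 1 := nonsing_inv_mul N hu
      have h3 := congrFun (congrFun h2 i) j
      rw [mul_apply] at h3
      simp only [appendOne, of_apply, Fin.addCases_right]
      rw [mul_apply, ← h3]
      rfl
  rw [h1, hpM, mul_assoc, ← maxMinor_mul, ← Matrix.mul_assoc, mul_nonsing_inv N hu, Matrix.one_mul]

theorem linearIndependent_appendOne {n : ℕ} (B : Matrix (Fin n) (Fin n) K) :
    LinearIndependent K fun i => appendOne B i := by
  rw [Fintype.linearIndependent_iff]
  intro g hg i
  have h := congrFun hg (Fin.natAdd n i)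
  simpa [-Fin.natAdd_eq_addNat, Finset.sum_apply, appendOne, one_apply] using h

theorem maxMinor_appendOne_mem {n : ℕ} (B : Matrix (Fin n) (Fin n) K) {c : K} (hc : c ≠ 0) :
    (fun C => c * maxMinor (appendOne B) C) ∈ grassmannian K n (n + n) :=
  ⟨_, appendOne B, linearIndependent_appendOne B, rfl, c, hc, fun _ => rfl⟩

variable {w} in
-- The empty minor is `1`, which forces `w c = -F ∅`. In particular the shift is finite and can be
-- subtracted.
theorem IsUniform.exists_real {n : ℕ} {F : Finset (Fin n) → ℝ} (h : IsUniform w F) :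
    ∃ (B : Matrix (Fin n) (Fin n) K) (c : K) (a : ℝ), w c = a ∧ c ≠ 0 ∧
      ∀ T S : Finset (Fin n), T.card = S.card →
        minorVal w B T S = ((-F S - a : ℝ) : WithTop ℝ) := by
  obtain ⟨B, c, h⟩ := h
  have h0 := h ∅ ∅ rfl
  rw [minorVal_empty, add_zero] at h0
  have hc : c ≠ 0 := by
    rw [← w.ne_top_iff, h0]
    exact WithTop.coe_ne_top
  refine ⟨B, c, -F ∅, h0, hc, fun T S hTS => ?_⟩
  have h1 := h T S hTS
  rw [h0] at h1
  cases hx : minorVal w B T S with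
  | top => rw [hx, WithTop.add_top] at h1; exact absurd h1 WithTop.top_ne_coe
  | coe x =>
    rw [hx, ← WithTop.coe_add, WithTop.coe_inj] at h1
    rw [WithTop.coe_inj]
    linarith

/-- An `n`-subset of `[2n]` amounts to a pair of row and column sets of equal size, with value given
by a minor of `B`. Pulling back along `lowPart` forgets the row set. -/
theorem mem_interL_nuImage_grassmannian_iff {n : ℕ} {F : Finset (Fin n) → ℝ} :
    F ∈ interL (nuImage w (grassmannian K n (n + n))) ↔ IsUniform w F := by
  rw [mem_interL_iff]
  constructor
  · rintro ⟨p, hp, hpF⟩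
    have hp0 : p (fillUp ∅) ≠ 0 := by
      rw [← w.ne_top_iff, hpF]
      exact WithTop.coe_ne_top
    obtain ⟨B, c, -, hB⟩ := exists_eq_maxMinor_appendOne hp hp0
    refine ⟨B, c, fun T S hTS => ?_⟩
    obtain ⟨C, hCS, hCT⟩ := exists_kSubset T S hTS
    have hT : highCompl C.1 = T := by
      ext j
      simp [-Fin.natAdd_eq_addNat, highCompl, hCT]
    have h1 : w (p C) = ((-F (lowPart C.1) : ℝ) : WithTop ℝ) := hpF C
    rwa [hB, w.map_mul, val_maxMinor_appendOne, hT, hCS] at h1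
  · rintro h
    obtain ⟨B, c, a, ha, hc, hB⟩ := h.exists_real
    refine ⟨_, maxMinor_appendOne_mem B hc, fun C => ?_⟩
    rw [w.map_mul, val_maxMinor_appendOne, ha, hB _ _ (card_highCompl C), ← WithTop.coe_add]
    congr 1
    ring

/-- The flag is spanned by the leading rows of `B`, so only the minors on initial row sets enter. -/
theorem IsUniform.mem_nuImage_affineFlagVariety {n : ℕ} {F : Finset (Fin n) → ℝ}
    (h : IsUniform w F) : F ∈ nuImage w (affineFlagVariety K n) := by
  obtain ⟨B, c, a, ha, hc, hB⟩ := h.exists_real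
  have hdet : B.det ≠ 0 := by
    have h1 := hB Finset.univ Finset.univ rfl
    rw [minorVal_image w B (g := id) (s := id) Function.injective_id Function.injective_id
      Finset.image_id Finset.image_id, submatrix_id_id] at h1
    rw [← w.ne_top_iff, h1]
    exact WithTop.coe_ne_top
  have hind : LinearIndependent K fun i => B i := linearIndependent_rows_of_det_ne_zero hdet
  have hle : ∀ S : Finset (Fin n), S.card ≤ n := fun S => by
    simpa using S.card_le_univ
  refine ⟨fun S => c * maxMinor (B.submatrix (Fin.castLE (hle S)) id) ⟨S, rfl⟩,
    ⟨fun k => Submodule.span K (Set.range fun i : Fin k => B (Fin.castLE k.is_le i)), ?_, ?_⟩, ?_⟩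
  · intro k l hkl
    refine Submodule.span_mono ?_
    rintro _ ⟨i, rfl⟩
    exact ⟨Fin.castLE hkl i, rfl⟩
  · intro k
    refine ⟨B.submatrix (Fin.castLE k.is_le) id, ?_, rfl, c, hc, ?_⟩
    · exact hind.comp _ (Fin.castLE_injective _)
    · have : ∀ (k : ℕ) (hk : k ≤ n) (S : KSubset n k),
          c * maxMinor (B.submatrix (Fin.castLE (hle S.1)) id) ⟨S.1, rfl⟩ =
          c * maxMinor (B.submatrix (Fin.castLE hk) id) S := by
        rintro k hk ⟨S, rfl⟩
        rfl
      exact this k k.is_le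
  · intro S
    have h1 : w (maxMinor (B.submatrix (Fin.castLE (hle S)) id) ⟨S, rfl⟩) =
        minorVal w B (Finset.univ.image (Fin.castLE (hle S))) S := by
      rw [maxMinor, submatrix_submatrix]
      symm
      refine minorVal_image w B (Fin.castLE_injective _) (S.orderEmbOfFin rfl).injective rfl ?_
      simp
    rw [w.map_mul, h1, ha, hB, ← WithTop.coe_add]
    · congr 1
      ring
    · rw [Finset.card_image_of_injective _ (Fin.castLE_injective _)]
      simp

end Uniform

/-! ### Submodular functions -/

section Submodular

/-- The local inequality says that marginal gains decrease when one element is added. Induction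
extends this first to a larger base set, then to gains from several elements. -/
theorem mem_submodularCone_of_local {n : ℕ} {F : Finset (Fin n) → ℝ}
    (h : ∀ (W : Finset (Fin n)) (i j : Fin n), i ∉ W → j ∉ W → i ≠ j →
      F W + F (insert i (insert j W)) ≤ F (insert i W) + F (insert j W)) :
    F ∈ submodularCone n := by
  have h1 : ∀ (i : Fin n) (A D : Finset (Fin n)), Disjoint A D → i ∉ A → i ∉ D →
      F (insert i (A ∪ D)) - F (A ∪ D) ≤ F (insert i A) - F A := by
    intro i A D
    induction D using Finset.induction_on with
    | empty => simp
    | insert d D hd ih =>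
      intro hdis hiA hiD
      rw [Finset.disjoint_insert_right] at hdis
      rw [Finset.mem_insert, not_or] at hiD
      have h2 := ih hdis.2 hiA hiD.2
      have h3 := h (A ∪ D) i d (by simp [hiA, hiD.2]) (by simp [hdis.1, hd]) hiD.1
      rw [Finset.union_insert]
      linarith
  have h2 : ∀ A S D : Finset (Fin n), A ⊆ S → Disjoint S D →
      F (S ∪ D) - F S ≤ F (A ∪ D) - F A := by
    intro A S D hAS
    induction D using Finset.induction_on with
    | empty => simp
    | insert d D hd ih =>
      intro hdis
      rw [Finset.disjoint_insert_right] at hdis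
      have h3 := ih hdis.2
      have h4 := h1 d (A ∪ D) (S \ A) ?_ ?_ ?_
      · have h5 : A ∪ D ∪ S \ A = S ∪ D := by
          rw [Finset.union_right_comm, Finset.union_sdiff_of_subset hAS]
        rw [h5] at h4
        rw [Finset.union_insert, Finset.union_insert]
        linarith
      · rw [Finset.disjoint_union_left]
        exact ⟨Finset.disjoint_sdiff, hdis.2.symm.mono_right Finset.sdiff_subset⟩
      · rw [Finset.mem_union, not_or]
        exact ⟨fun h => hdis.1 (hAS h), hd⟩
      · exact fun h => hdis.1 (Finset.sdiff_subset h)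
  intro S T
  have h3 := h2 (S ∩ T) S (T \ S) Finset.inter_subset_left Finset.disjoint_sdiff
  rw [Finset.union_sdiff_self_eq_union, Finset.inter_comm S T, Finset.union_comm (T ∩ S),
    Finset.sdiff_union_inter] at h3
  rw [Finset.inter_comm]
  linarith

theorem submodularCone_local {n : ℕ} {F : Finset (Fin n) → ℝ} (h : F ∈ submodularCone n)
    {W : Finset (Fin n)} {i j : Fin n} (hi : i ∉ W) (hij : i ≠ j) :
    F W + F (insert i (insert j W)) ≤ F (insert i W) + F (insert j W) := by
  have h1 := h (insert i W) (insert j W)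
  have h2 : insert i W ∩ insert j W = W := by
    ext x
    simp only [Finset.mem_inter, Finset.mem_insert]
    constructor
    · rintro ⟨rfl | h, h' | h'⟩ <;> first | assumption | exact absurd h' hij
    · exact fun h => ⟨Or.inr h, Or.inr h⟩
  have h3 : insert i W ∪ insert j W = insert i (insert j W) := by
    ext x
    simp only [Finset.mem_union, Finset.mem_insert]
    tauto
  rwa [h2, h3] at h1

/-- In the three-term identity with rows and columns `W`, `i`, `j`, uniformity gives both products
on the right the same value. The ultrametric inequality for their difference is the local submodular
inequality. -/
theorem IsUniform.mem_submodularCone {K : Type*} [Field K] {w : AddValuation K (WithTop ℝ)} {n : ℕ}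
    {F : Finset (Fin n) → ℝ} (h : IsUniform w F) : F ∈ submodularCone n := by
  obtain ⟨B, c, a, -, -, hB⟩ := h.exists_real
  refine mem_submodularCone_of_local fun W i j hi hj hij => ?_
  obtain ⟨x, y, z, hxyz, hx, hy, hz⟩ := exists_three_term w B (T := W) (W := W) rfl hi hj hij hi hj
    hij (by rw [hB _ _ rfl]; exact WithTop.coe_ne_top)
  have hci : (insert i W).card = W.card + 1 := Finset.card_insert_of_notMem hi
  have hcj : (insert j W).card = W.card + 1 := Finset.card_insert_of_notMem hj
  rw [hB _ _ rfl, hB _ _ rfl, ← WithTop.coe_add] at hx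
  rw [hB _ _ rfl, hB _ _ rfl, ← WithTop.coe_add] at hy
  rw [hB _ _ (hci.trans hcj.symm), hB _ _ (hcj.trans hci.symm), ← WithTop.coe_add] at hz
  have h1 : (((-F (insert i W) - a) + (-F (insert j W) - a) : ℝ) : WithTop ℝ) ≤ w x := by
    rw [hxyz]
    refine w.map_le_sub hy.ge ?_
    rw [hz]
    refine WithTop.coe_le_coe.2 (le_of_eq ?_)
    ring
  rw [hx, WithTop.coe_le_coe] at h1
  linarith

end Submodular

/-! ### From submodular points of the flag variety to uniform matrices -/

section Flags

open Matrix

/-- Sets of equal size are joined by single exchanges, each reducing the difference with `S₀`. -/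
theorem exchange_induction {β : Type*} [DecidableEq β] {P : Finset β → Prop} {S₀ : Finset β}
    (h₀ : P S₀)
    (step : ∀ (W : Finset β) (i j : β), i ∉ W → j ∉ W → i ≠ j → W.card + 1 = S₀.card →
      P (insert i W) → P (insert j W)) :
    ∀ S : Finset β, S.card = S₀.card → P S := by
  suffices h : ∀ (d : ℕ) (S : Finset β), (S \ S₀).card = d → S.card = S₀.card → P S from
    fun S hS => h _ S rfl hS
  intro d
  induction d with
  | zero =>
    intro S hd hS
    rw [Finset.card_eq_zero, Finset.sdiff_eq_empty_iff_subset] at hd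
    rwa [Finset.eq_of_subset_of_card_le hd hS.ge]
  | succ d ih =>
    intro S hd hS
    obtain ⟨j, hj⟩ : (S \ S₀).Nonempty := by
      rw [← Finset.card_pos]; omega
    obtain ⟨i, hi⟩ : (S₀ \ S).Nonempty := by
      rw [← Finset.card_pos, Finset.card_sdiff_comm hS.symm]; omega
    rw [Finset.mem_sdiff] at hi hj
    have hij : i ≠ j := fun h => hi.2 (h ▸ hj.1)
    have hiW : i ∉ S.erase j := fun h => hi.2 (Finset.mem_of_mem_erase h)
    have hcard : (S.erase j).card + 1 = S.card := Finset.card_erase_add_one hj.1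
    have h1 := step (S.erase j) i j hiW (Finset.notMem_erase j S) hij (hcard.trans hS) ?_
    · rwa [Finset.insert_erase hj.1] at h1
    · refine ih _ ?_ ?_
      · have h2 : insert i (S.erase j) \ S₀ = (S \ S₀).erase j := by
          ext x
          simp only [Finset.mem_sdiff, Finset.mem_insert, Finset.mem_erase]
          constructor
          · rintro ⟨rfl | h, h'⟩
            · exact absurd hi.1 h'
            · exact ⟨h.1, h.2, h'⟩
          · exact fun h => ⟨Or.inr ⟨h.1, h.2.1⟩, h.2.2⟩
        rw [h2, Finset.card_erase_of_mem (Finset.mem_sdiff.2 hj), hd]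
        rfl
      · rw [Finset.card_insert_of_notMem hiW, hcard, hS]

theorem WithTop.coe_le_of_coe_le_coe_add {a b : ℝ} {x : WithTop ℝ} (h : ((b + a : ℝ) : WithTop ℝ) ≤ b + x) :
    (a : WithTop ℝ) ≤ x := by
  cases x with
  | top => exact le_top
  | coe x =>
    rw [← WithTop.coe_add, WithTop.coe_le_coe] at h
    rw [WithTop.coe_le_coe]
    linarith

variable {K : Type*} [Field K] (w : AddValuation K (WithTop ℝ)) {α : Type*} [DecidableEq α]

theorem minorVal_submatrix_rows {γ β : Type*} [DecidableEq γ] [DecidableEq β] (M : Matrix α β K)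
    {e : γ → α} (he : Function.Injective e) {T : Finset γ} {S : Finset β} (h : T.card = S.card) :
    minorVal w (M.submatrix e id) T S = minorVal w M (T.image e) S := by
  obtain ⟨g, hg, hgT⟩ := exists_enumeration T h
  obtain ⟨s, hs, hsS⟩ := exists_enumeration S rfl
  rw [minorVal_image w _ hg hs hgT hsS, minorVal_image w M (he.comp hg) hs _ hsS]
  · rfl
  · rw [← hgT, Finset.image_image]

variable [Fintype α]

/-- If the minors of `M` avoiding the row `ρ`, and the maximal ones, have the values prescribed by
a submodular function, then this function bounds all minors involving the row `ρ`. -/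
theorem le_minorVal_of_submodular {n : ℕ} (M : Matrix α (Fin n) K) (ρ : α)
    {F : Finset (Fin n) → ℝ} (hF : F ∈ submodularCone n)
    (h1 : ∀ T S, ρ ∉ T → T.card = S.card → minorVal w M T S = ((-F S : ℝ) : WithTop ℝ))
    (h2 : ∀ S, (Finset.univ : Finset α).card = S.card →
      minorVal w M Finset.univ S = ((-F S : ℝ) : WithTop ℝ))
    (h3 : ∀ T, ρ ∈ T → T ≠ Finset.univ → ∃ S, T.card = S.card ∧ minorVal w M T S = ⊤) :
    ∀ (d : ℕ) (T S), Tᶜ.card = d → ρ ∈ T → T.card = S.card →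
      ((-F S : ℝ) : WithTop ℝ) ≤ minorVal w M T S := by
  intro d
  induction d with
  | zero =>
    intro T S hT _ hTS
    rw [Finset.card_eq_zero, Finset.compl_eq_empty_iff] at hT
    subst hT
    exact (h2 S hTS).ge
  | succ d ih =>
    intro T S hT hρ hTS
    obtain ⟨t, ht⟩ : Tᶜ.Nonempty := by
      rw [← Finset.card_pos]; omega
    rw [Finset.mem_compl] at ht
    -- The induction goes down from the full row set. For fixed rows it starts at a vanishing minor,
    -- where the bound is trivial, and spreads by exchanges of columns.
    obtain ⟨S₀, hS₀, hS₀T⟩ := h3 T hρ (fun h => ht (h ▸ Finset.mem_univ t))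
    refine exchange_induction (P := fun S => ((-F S : ℝ) : WithTop ℝ) ≤ minorVal w M T S)
      (S₀ := S₀) (by rw [hS₀T]; exact le_top) ?_ S (hTS.symm.trans hS₀)
    intro W i j hi hj hij hW hP
    have hcardT : (T.erase ρ).card + 1 = T.card := Finset.card_erase_add_one hρ
    have htρ : t ≠ ρ := fun h => ht (h ▸ hρ)
    have htE : t ∉ T.erase ρ := fun h => ht (Finset.mem_of_mem_erase h)
    have hρE : ρ ∉ T.erase ρ := Finset.notMem_erase ρ T
    have hTW : (T.erase ρ).card = W.card := by omega
    have hρt : ρ ∉ insert t (T.erase ρ) := by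
      rw [Finset.mem_insert, not_or]
      exact ⟨htρ.symm, hρE⟩
    have hci : (insert i W).card = W.card + 1 := Finset.card_insert_of_notMem hi
    have hcj : (insert j W).card = W.card + 1 := Finset.card_insert_of_notMem hj
    have hct : (insert t (T.erase ρ)).card = W.card + 1 := by
      rw [Finset.card_insert_of_notMem htE, hTW]
    -- `x` is bounded using the larger row set and submodularity, `z` using the previous column set.
    -- Hence `y` is bounded, and its other factor is a minor of known value avoiding `ρ`.
    obtain ⟨x, y, z, hxyz, hx, hy, hz⟩ := exists_three_term w M hTW htE hρE htρ hi hj hij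
      (by rw [h1 _ _ hρE hTW]; exact WithTop.coe_ne_top)
    rw [Finset.insert_erase hρ] at hx hy hz
    rw [h1 _ _ hρE hTW] at hx
    rw [h1 _ _ hρt (hct.trans hci.symm)] at hy
    rw [h1 _ _ hρt (hct.trans hcj.symm)] at hz
    have h4 : ((-F (insert i (insert j W)) : ℝ) : WithTop ℝ) ≤
        minorVal w M (insert t T) (insert i (insert j W)) := by
      refine ih _ _ ?_ (Finset.mem_insert_of_mem hρ) ?_
      · rw [Finset.compl_insert, Finset.card_erase_of_mem (Finset.mem_compl.2 ht), hT]
        rfl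
      · rw [Finset.card_insert_of_notMem ht, Finset.card_insert_of_notMem, hcj]
        · omega
        · rw [Finset.mem_insert, not_or]
          exact ⟨hij, hi⟩
    have hsub := submodularCone_local hF hi hij (j := j)
    have hx' : ((-F (insert i W) + -F (insert j W) : ℝ) : WithTop ℝ) ≤ w x := by
      rw [hx]
      refine le_trans ?_ (add_le_add_right h4 _)
      rw [← WithTop.coe_add, WithTop.coe_le_coe]
      linarith
    have hz' : ((-F (insert i W) + -F (insert j W) : ℝ) : WithTop ℝ) ≤ w z := by
      rw [hz]
      refine le_trans ?_ (add_le_add_right hP _)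
      rw [← WithTop.coe_add, add_comm]
    have hy' : ((-F (insert i W) + -F (insert j W) : ℝ) : WithTop ℝ) ≤ w y := by
      rw [show y = x + z by rw [hxyz]; ring]
      exact w.map_le_add hx' hz'
    rw [hy] at hy'
    exact WithTop.coe_le_of_coe_le_coe_add hy'

theorem exists_eq_mul_of_rows_mem_span {k n : ℕ} {M M₀ : Matrix (Fin k) (Fin n) K}
    (h : ∀ i, M i ∈ Submodule.span K (Set.range fun i => M₀ i)) :
    ∃ P : Matrix (Fin k) (Fin k) K, M = P * M₀ := by
  choose P hP using fun i => (Submodule.mem_span_range_iff_exists_fun K).1 (h i)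
  refine ⟨Matrix.of P, ?_⟩
  ext i j
  rw [← hP i]
  simp [mul_apply]

/-- The flags whose Plücker values form a submodular function come from a uniform matrix. -/
theorem exists_uniform_rows {n : ℕ} {F : Finset (Fin n) → ℝ} (hF : F ∈ submodularCone n)
    (hw : ∀ m : ℕ, m ≠ 0 → w (m : K) = 0) (hF0 : F ∅ = 0) {q : Finset (Fin n) → K}
    (hq : ∀ S, w (q S) = ((-F S : ℝ) : WithTop ℝ))
    {L : Fin (n + 1) → Submodule K (Fin n → K)} (hL : Monotone L)
    (hqL : ∀ k : Fin (n + 1), IsPluckerVector (k := (k : ℕ)) (L k) fun S => q S.1) :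
    ∀ (k : ℕ) (hk : k < n + 1), ∃ B : Matrix (Fin k) (Fin n) K, (∀ i, B i ∈ L ⟨k, hk⟩) ∧
      ∀ T S, T.card = S.card → minorVal w B T S = ((-F S : ℝ) : WithTop ℝ) := by
  intro k
  induction k with
  | zero =>
    intro hk
    refine ⟨Matrix.of fun i => i.elim0, fun i => i.elim0, fun T S hTS => ?_⟩
    have hT : T = ∅ := Finset.eq_empty_of_isEmpty T
    subst hT
    have hS : S = ∅ := Finset.card_eq_zero.1 hTS.symm
    subst hS
    rw [minorVal_empty, hF0]
    simp
  | succ k ih =>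
    intro hk
    obtain ⟨B, hBL, hB⟩ := ih (Nat.lt_of_succ_lt hk)
    obtain ⟨M₀, -, hspan, c, hc, hM₀⟩ := hqL ⟨k + 1, hk⟩
    change ∀ S : KSubset n (k + 1), q S.1 = c * maxMinor M₀ S at hM₀
    let s : Fin (k + 1) → Fin n := Fin.castLE (by omega)
    have hs : Function.Injective s := Fin.castLE_injective _
    have hsc : (Finset.univ.image s).card = k + 1 := by
      rw [Finset.card_image_of_injective _ hs]; simp
    have hqne : ∀ S, q S ≠ 0 := fun S => by
      rw [← w.ne_top_iff, hq]
      exact WithTop.coe_ne_top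
    have hN : (M₀.submatrix id s).det ≠ 0 := by
      have h1 : w (maxMinor M₀ ⟨_, hsc⟩) = w (M₀.submatrix id s).det := by
        rw [val_maxMinor, minorVal_image w M₀ Function.injective_id hs Finset.image_id rfl]
      rw [← w.ne_top_iff, ← h1, w.ne_top_iff]
      intro h2
      have h3 := hM₀ ⟨_, hsc⟩
      rw [h2, mul_zero] at h3
      exact hqne _ h3
    set N := M₀.submatrix id s with hNdef
    have hu : IsUnit N.det := isUnit_iff_ne_zero.2 hN
    -- With the first `k + 1` columns normalized to the identity, the last row is a vector of
    -- `L_{k+1}` that vanishes on the first `k` columns and is `1` on the next.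
    have hinv : (N⁻¹ * M₀).submatrix id s = 1 := by
      rw [← nonsing_inv_mul N hu]
      rfl
    -- rows of multiples of `M₀` lie in the subspace
    have hrow : ∀ (P : Matrix (Fin (k + 1)) (Fin (k + 1)) K) i, (P * M₀) i ∈ L ⟨k + 1, hk⟩ := by
      intro P i
      rw [← hspan]
      refine (Submodule.mem_span_range_iff_exists_fun K).2 ⟨P i, ?_⟩
      ext j
      simp [mul_apply]
    -- the flag extended by a row vanishing on the first `k` columns
    let M₁ : K → Matrix (Fin (k + 1)) (Fin n) K := fun μ =>
      Matrix.of fun i => Fin.lastCases (motive := fun _ => Fin n → K)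
        (μ • (N⁻¹ * M₀) (Fin.last k)) (fun i => B i) i
    have hM₁last : ∀ μ, M₁ μ (Fin.last k) = μ • (N⁻¹ * M₀) (Fin.last k) := fun μ => by
      ext j
      simp [M₁]
    have hM₁cast : ∀ μ (i : Fin k), M₁ μ i.castSucc = B i := fun μ i => by
      ext j
      simp [M₁]
    have hM₁row : ∀ μ i, M₁ μ i ∈ L ⟨k + 1, hk⟩ := by
      intro μ i
      refine Fin.lastCases ?_ (fun i => ?_) i
      · rw [hM₁last]
        exact Submodule.smul_mem _ _ (hrow _ _)
      · rw [hM₁cast]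
        exact hL (Fin.mk_le_mk.2 (Nat.le_succ k)) (hBL i)
    have hM₁B : ∀ μ, (M₁ μ).submatrix Fin.castSucc id = B := by
      intro μ
      ext i j
      simp [M₁]
    have hM₁s : ∀ μ (i : Fin (k + 1)), M₁ μ (Fin.last k) (s i) = if i = Fin.last k then μ else 0 := by
      intro μ i
      have h1 := congrFun (congrFun hinv (Fin.last k)) i
      rw [submatrix_apply, id, one_apply] at h1
      rw [hM₁last, Pi.smul_apply, h1, smul_eq_mul]
      by_cases h2 : i = Fin.last k
      · rw [if_pos h2, if_pos h2.symm, mul_one]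
      · rw [if_neg h2, if_neg (Ne.symm h2), mul_zero]
    have hM₁B' : ∀ μ T S, Fin.last k ∉ T → T.card = S.card →
        minorVal w (M₁ μ) T S = ((-F S : ℝ) : WithTop ℝ) := by
      intro μ T S hT hTS
      have h1 : (Finset.univ.filter fun i : Fin k => i.castSucc ∈ T).image Fin.castSucc = T := by
        ext x
        simp only [Finset.mem_image, Finset.mem_filter, Finset.mem_univ, true_and]
        constructor
        · rintro ⟨i, hi, rfl⟩; exact hi
        · refine Fin.lastCases (fun h => absurd h hT) (fun i hi => ⟨i, hi, rfl⟩) x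
      have h2 : (Finset.univ.filter fun i : Fin k => i.castSucc ∈ T).card = S.card := by
        rw [← hTS, ← Finset.card_image_of_injective _ (Fin.castSucc_injective k), h1]
      have h3 := minorVal_submatrix_rows w (M₁ μ) (Fin.castSucc_injective k) h2
      rw [h1, hM₁B, hB _ _ h2] at h3
      exact h3.symm
    -- Expansion along the new row leaves a maximal minor of `B`, whose value is finite. So the
    -- enlarged matrix is again a basis of the subspace.
    have hdet1 : ((M₁ 1).submatrix id s).det ≠ 0 := by
      have h1 : ((M₁ 1).submatrix id s).det =
          (B.submatrix id fun i => s i.castSucc).det := by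
        rw [det_succ_row _ (Fin.last k), Finset.sum_eq_single (Fin.last k)]
        · rw [submatrix_apply, id, hM₁s, if_pos rfl, submatrix_submatrix]
          have h2 : (M₁ 1).submatrix (id ∘ (Fin.last k).succAbove) (s ∘ (Fin.last k).succAbove) =
              B.submatrix id fun i => s i.castSucc := by
            ext i j
            simp [M₁]
          rw [h2]
          simp [← two_mul]
        · intro i _ hi
          rw [submatrix_apply, id, hM₁s, if_neg hi]
          simp
        · simp
      rw [h1]
      have hs' : Function.Injective fun i : Fin k => s i.castSucc :=
        hs.comp (Fin.castSucc_injective k)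
      rw [← w.ne_top_iff, ← minorVal_image w B Function.injective_id hs' Finset.image_id rfl,
        hB _ _ (by rw [Finset.card_image_of_injective _ hs'])]
      exact WithTop.coe_ne_top
    obtain ⟨P, hP⟩ := exists_eq_mul_of_rows_mem_span (M := M₁ 1) (M₀ := M₀)
      (fun i => by rw [hspan]; exact hM₁row 1 i)
    have hPdet : P.det ≠ 0 := by
      intro h
      refine hdet1 ?_
      have : (M₁ 1).submatrix id s = P * N := by rw [hP]; rfl
      rw [this, det_mul, h, zero_mul]
    have hmax1 : ∀ S : KSubset n (k + 1), maxMinor (M₁ 1) S = P.det * c⁻¹ * q S.1 := by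
      intro S
      rw [hP, maxMinor_mul, hM₀]
      field_simp
    have hmaxμ : ∀ μ (S : KSubset n (k + 1)), maxMinor (M₁ μ) S = μ * maxMinor (M₁ 1) S := by
      intro μ S
      have h1 : M₁ μ = updateRow (M₁ 1) (Fin.last k) (μ • M₁ 1 (Fin.last k)) := by
        ext i j
        refine Fin.lastCases ?_ (fun i => ?_) i
        · simp [M₁]
        · rw [updateRow_ne (Fin.castSucc_lt_last i).ne]
          simp [M₁]
      have h2 : (M₁ μ).submatrix id (S.1.orderEmbOfFin S.2) =
          updateRow ((M₁ 1).submatrix id (S.1.orderEmbOfFin S.2)) (Fin.last k)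
            (μ • (M₁ 1).submatrix id (S.1.orderEmbOfFin S.2) (Fin.last k)) := by
        rw [h1]
        ext i j
        by_cases hi : i = Fin.last k
        · subst hi
          simp
        · rw [updateRow_ne hi, submatrix_apply, id, updateRow_ne hi]
          rfl
      rw [maxMinor, h2, det_updateRow_smul, updateRow_eq_self]
      rfl
    -- This scaling of the new row makes the maximal minors equal to the Plücker coordinates `q`.
    set μ : K := (P.det * c⁻¹)⁻¹ with hμ
    have hM₁top : ∀ S, (Finset.univ : Finset (Fin (k + 1))).card = S.card →
        minorVal w (M₁ μ) Finset.univ S = ((-F S : ℝ) : WithTop ℝ) := by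
      intro S hS
      have hS' : S.card = k + 1 := by rw [← hS]; simp
      rw [← val_maxMinor w (M₁ μ) ⟨S, hS'⟩, hmaxμ, hmax1, hμ, inv_mul_cancel_left₀, hq]
      exact mul_ne_zero hPdet (inv_ne_zero hc)
    have hdom := le_minorVal_of_submodular w (M₁ μ) (Fin.last k) hF (hM₁B' μ) hM₁top ?_
    -- The bound `-F(S)` is attained by rows avoiding the new one, or by the full row set for
    -- maximal minors. So it is the minimum that mixing makes common to all row sets.
    · obtain ⟨U, -, hU1, hU2⟩ := exists_generic_mixing w hw (M₁ μ)
      refine ⟨U * M₁ μ, fun i => ?_, fun T S hTS => le_antisymm ?_ (hU2 T S hTS _ ?_)⟩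
      · refine (?_ : (U * M₁ μ) i = ∑ l, U i l • M₁ μ l) ▸ Submodule.sum_mem _ fun l _ =>
          Submodule.smul_mem _ _ (hM₁row μ l)
        ext j
        simp [mul_apply]
      · by_cases hSk : S.card = k + 1
        · rw [← hM₁top S (by simp [hSk])]
          exact hU1 T S hTS _ (by simp [hSk])
        · have hle : S.card ≤ k := by
            have := T.card_le_univ
            rw [Fintype.card_fin] at this
            omega
          obtain ⟨T', -, hT'⟩ := Finset.exists_subset_card_eq
            (s := (Finset.univ : Finset (Fin k))) (n := S.card) (by simpa using hle)
          have hc' : (T'.image Fin.castSucc).card = S.card := by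
            rw [Finset.card_image_of_injective _ (Fin.castSucc_injective k), hT']
          have hl : Fin.last k ∉ T'.image Fin.castSucc := by
            simp [(Fin.castSucc_lt_last _).ne]
          rw [← hM₁B' μ _ S hl hc']
          exact hU1 T S hTS _ hc'
      · intro T' hT'
        by_cases hl : Fin.last k ∈ T'
        · exact hdom _ T' S rfl hl hT'
        · exact (hM₁B' μ T' S hl hT').ge
    -- A proper row set has at most `k` elements; on as many initial columns the new row is zero, so
    -- that minor vanishes.
    · intro T hT hTu
      have hTk : T.card ≤ k := by
        have h1 := (Finset.card_lt_iff_ne_univ T).2 hTu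
        rw [Fintype.card_fin] at h1
        omega
      let f : Fin T.card → Fin n := fun i => s (Fin.castLE (by omega) i)
      have hf : Function.Injective f := hs.comp (Fin.castLE_injective _)
      refine ⟨Finset.univ.image f, by rw [Finset.card_image_of_injective _ hf]; simp, ?_⟩
      obtain ⟨g, hg, hgT⟩ := exists_enumeration T rfl
      rw [minorVal_image w _ hg hf hgT rfl]
      rw [← hgT] at hT
      obtain ⟨i, _, hi⟩ := Finset.mem_image.1 hT
      rw [det_eq_zero_of_row_eq_zero i, w.map_zero]
      intro j
      rw [submatrix_apply, hi, hM₁s, if_neg]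
      intro h
      have h1 := congrArg Fin.val h
      have h2 := j.2
      simp at h1
      omega

theorem IsUniform.of_mem_nuImage_affineFlagVariety {n : ℕ} {F : Finset (Fin n) → ℝ}
    (hw : ∀ m : ℕ, m ≠ 0 → w (m : K) = 0)
    (h : F ∈ nuImage w (affineFlagVariety K n)) (hF : F ∈ submodularCone n) : IsUniform w F := by
  obtain ⟨q, ⟨L, hL, hqL⟩, hq⟩ := h
  have hq0 : q ∅ ≠ 0 := by
    rw [← w.ne_top_iff, hq]
    exact WithTop.coe_ne_top
  -- The inductive construction has no scalar and the empty minor is `1`, so `F` is first normalized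
  -- at `∅`.
  have hF' : (fun S => F S - F ∅) ∈ submodularCone n := by
    intro S T
    have := hF S T
    simp only
    linarith
  have hq' : ∀ S, w ((q ∅)⁻¹ * q S) = ((-(F S - F ∅) : ℝ) : WithTop ℝ) := by
    intro S
    have h1 : w (q ∅) + w ((q ∅)⁻¹ * q S) = w (q S) := by
      rw [← w.map_mul, mul_inv_cancel_left₀ hq0]
    rw [hq, hq] at h1
    cases hx : w ((q ∅)⁻¹ * q S) with
    | top => rw [hx, WithTop.add_top] at h1; exact absurd h1 WithTop.top_ne_coe
    | coe x =>
      rw [hx, ← WithTop.coe_add, WithTop.coe_inj] at h1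
      rw [WithTop.coe_inj]
      linarith
  have hqL' : ∀ k : Fin (n + 1),
      IsPluckerVector (k := (k : ℕ)) (L k) fun S => (q ∅)⁻¹ * q S.1 := by
    intro k
    obtain ⟨M, hM, hspan, c, hc, hMq⟩ := hqL k
    refine ⟨M, hM, hspan, (q ∅)⁻¹ * c, mul_ne_zero (inv_ne_zero hq0) hc, fun S => ?_⟩
    rw [mul_assoc, ← hMq S]
  obtain ⟨B, -, hB⟩ := exists_uniform_rows w hF' hw (sub_self _) hq' hL hqL' n
    (Nat.lt_succ_self n)
  refine ⟨B, q ∅, fun T S hTS => ?_⟩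
  rw [hB T S hTS, hq, ← WithTop.coe_add]
  congr 1
  ring

end Flags

/-! ### Gram matrices and principal minors -/

section Gram

open Matrix

/-- A valued field `K` with conjugation over the real closed field `R`: norms are nonnegative
elements of `R` with the expected value, and the values of polynomials at points of `K` can be
doubled and halved by a change of the point. -/
structure IsConjValued {R K : Type*} [Field R] [LinearOrder R] [Field K] [StarRing K]
    [Algebra R K] (v : AddValuation R (WithTop ℝ)) (w : AddValuation K (WithTop ℝ)) : Prop where
  map_algebraMap : ∀ r, w (algebraMap R K r) = v r
  star_algebraMap : ∀ r, star (algebraMap R K r) = algebraMap R K r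
  star_mul_self : ∀ z : K, ∃ r : R, 0 ≤ r ∧ star z * z = algebraMap R K r ∧ v r = w z + w z
  exists_double : ∀ {m κ : Type} [Finite m] [Finite κ] (x : m → K) (f : κ → MvPolynomial m ℤ),
    ∃ y : m → K, ∀ k, w (MvPolynomial.aeval y (f k)) =
      w (MvPolynomial.aeval x (f k)) + w (MvPolynomial.aeval x (f k))
  exists_half : ∀ {m κ : Type} [Finite m] [Finite κ] (x : m → K) (f : κ → MvPolynomial m ℤ),
    ∃ y : m → K, ∀ k, w (MvPolynomial.aeval y (f k)) + w (MvPolynomial.aeval y (f k)) =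
      w (MvPolynomial.aeval x (f k))

/-- Principal-minor vectors of positive definite Hermitian matrices over `K`. -/
def PMOver (R K : Type*) [Field R] [LinearOrder R] [Field K] [StarRing K] [Algebra R K] (n : ℕ) :
    Set (Finset (Fin n) → R) :=
  {a | ∃ A : Matrix (Fin n) (Fin n) K, A.IsHermitian ∧
    ∀ S, 0 < a S ∧ principalMinor A S = algebraMap R K (a S)}

/-- The Cauchy–Binet formula for Gram determinants, summed over all maps. -/
theorem factorial_mul_det_conjTranspose_mul_self {K ι α : Type*} [Field K] [StarRing K] [Fintype ι]
    [DecidableEq ι] [Fintype α] [DecidableEq α] (C : Matrix α ι K) :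
    ((Fintype.card ι).factorial : K) * (Cᴴ * C).det =
      ∑ g : ι → α, star (C.submatrix g id).det * (C.submatrix g id).det := by
  -- Each permutation in the expansion of the conjugated determinant contributes the full Gram
  -- determinant, after reindexing the maps; this explains the factorial.
  have h1 : ∀ σ : Equiv.Perm ι, ∑ g : ι → α,
      ((Equiv.Perm.sign σ : ℤ) : K) * (∏ i, star (C (g (σ i)) i)) * (C.submatrix g id).det =
      (Cᴴ * C).det := by
    intro σ
    rw [det_mul_eq_sum]
    refine Fintype.sum_equiv (Equiv.arrowCongr σ.symm (Equiv.refl α)) _ _ fun g => ?_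
    have h2 : C.submatrix (Equiv.arrowCongr σ.symm (Equiv.refl α) g) id =
        (C.submatrix g id).submatrix σ id := by
      ext i j
      simp [Equiv.arrowCongr]
    rw [h2, det_permute]
    have h3 : ∏ i, Cᴴ i ((Equiv.arrowCongr σ.symm (Equiv.refl α)) g i) =
        ∏ i, star (C (g (σ i)) i) := by
      refine Finset.prod_congr rfl fun i _ => ?_
      simp [Equiv.arrowCongr]
    rw [h3]
    ring
  have h4 : ∀ g : ι → α, star (C.submatrix g id).det =
      ∑ σ : Equiv.Perm ι, ((Equiv.Perm.sign σ : ℤ) : K) * ∏ i, star (C (g (σ i)) i) := by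
    intro g
    rw [det_apply', star_sum]
    refine Finset.sum_congr rfl fun σ _ => ?_
    rw [star_mul', star_intCast, star_prod]
    rfl
  simp_rw [h4, Finset.sum_mul]
  rw [Finset.sum_comm]
  simp_rw [h1]
  rw [Finset.sum_const, nsmul_eq_mul, Finset.card_univ, Fintype.card_perm]

theorem WithTop.eq_coe_of_add_coe {a b : ℝ} {x : WithTop ℝ} (h : (a : WithTop ℝ) + x = (b : ℝ)) :
    x = ((b - a : ℝ) : WithTop ℝ) := by
  cases x with
  | top => rw [WithTop.add_top] at h; exact absurd h WithTop.top_ne_coe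
  | coe x =>
    rw [← WithTop.coe_add, WithTop.coe_inj] at h
    rw [WithTop.coe_inj]
    linarith

theorem WithTop.coe_half_le {a : ℝ} {x : WithTop ℝ} (h : (a : WithTop ℝ) ≤ x + x) :
    ((a / 2 : ℝ) : WithTop ℝ) ≤ x := by
  cases x with
  | top => exact le_top
  | coe x =>
    rw [← WithTop.coe_add, WithTop.coe_le_coe] at h
    rw [WithTop.coe_le_coe]
    linarith

theorem WithTop.le_coe_half {a : ℝ} {x : WithTop ℝ} (h : x + x ≤ (a : WithTop ℝ)) :
    x ≤ ((a / 2 : ℝ) : WithTop ℝ) := by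
  cases x with
  | top => rw [WithTop.add_top] at h; exact absurd h (not_le.2 (WithTop.coe_lt_top a))
  | coe x =>
    rw [← WithTop.coe_add, WithTop.coe_le_coe] at h
    rw [WithTop.coe_le_coe]
    linarith

theorem principalMinor_image {K : Type*} [CommRing K] {n k : ℕ} (A : Matrix (Fin n) (Fin n) K) {f : Fin k → Fin n}
    (hf : Function.Injective f) :
    principalMinor A (Finset.univ.image f) = (A.submatrix f f).det := by
  let e : Fin k ≃ (Finset.univ.image f) := Equiv.ofBijective (fun i => ⟨f i, by simp⟩)
    ⟨fun i j h => hf (congrArg Subtype.val h), by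
      rintro ⟨x, hx⟩
      obtain ⟨i, -, rfl⟩ := Finset.mem_image.1 hx
      exact ⟨i, rfl⟩⟩
  rw [principalMinor, ← det_submatrix_equiv_self e, submatrix_submatrix]
  rfl

/-- Presents a uniform matrix as a point with prescribed values of integral polynomials. The extra
variable `none` carries the scalar of `IsUniform`. -/
theorem exists_minor_polynomials {K : Type*} [Field K] (w : AddValuation K (WithTop ℝ)) (n : ℕ) :
    ∃ f : Option {p : Finset (Fin n) × Finset (Fin n) // p.1.card = p.2.card} →
        MvPolynomial (Option (Fin n × Fin n)) ℤ,
      ∀ x : Option (Fin n × Fin n) → K, w (MvPolynomial.aeval x (f none)) = w (x none) ∧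
        ∀ p, w (MvPolynomial.aeval x (f (some p))) =
          minorVal w (Matrix.of fun i j => x (some (i, j))) p.1.1 p.1.2 := by
  choose g hg hgT using fun p : {p : Finset (Fin n) × Finset (Fin n) // p.1.card = p.2.card} =>
    exists_enumeration p.1.1 p.2
  choose s hs hsS using fun p : {p : Finset (Fin n) × Finset (Fin n) // p.1.card = p.2.card} =>
    exists_enumeration p.1.2 rfl
  refine ⟨fun o => o.elim (MvPolynomial.X none) fun p =>
    Matrix.det (Matrix.of fun i j => MvPolynomial.X (some (g p i, s p j))), fun x => ⟨?_, ?_⟩⟩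
  · simp
  · intro p
    rw [minorVal_image w _ (hg p) (hs p) (hgT p) (hsS p)]
    change w (MvPolynomial.aeval x (Matrix.det _)) = _
    rw [AlgHom.map_det]
    congr 2
    ext i j
    simp

/-- Uniformity only concerns values of integral polynomials, and these can be doubled or halved all
at once. -/
theorem IsConjValued.isUniform_half_iff {R K : Type*} [Field R] [LinearOrder R]
    [Field K] [StarRing K] [Algebra R K] {v : AddValuation R (WithTop ℝ)}
    {w : AddValuation K (WithTop ℝ)} (h : IsConjValued v w) {n : ℕ} {F : Finset (Fin n) → ℝ} :
    IsUniform w (fun S => F S / 2) ↔ IsUniform w F := by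
  obtain ⟨f, hf⟩ := exists_minor_polynomials w n
  have hpt : ∀ (B : Matrix (Fin n) (Fin n) K) (c : K), ∃ x : Option (Fin n × Fin n) → K,
      c = x none ∧ B = Matrix.of fun i j => x (some (i, j)) :=
    fun B c => ⟨fun o => o.elim c fun p => B p.1 p.2, rfl, rfl⟩
  constructor
  · rintro ⟨B, c, hB⟩
    obtain ⟨x, rfl, rfl⟩ := hpt B c
    obtain ⟨y, hy⟩ := h.exists_double x f
    refine ⟨Matrix.of fun i j => y (some (i, j)), y none, fun T S hTS => ?_⟩
    have h1 := hB T S hTS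
    rw [← (hf y).1, ← (hf y).2 ⟨(T, S), hTS⟩, hy, hy, (hf x).1, (hf x).2, add_add_add_comm, h1,
      ← WithTop.coe_add]
    congr 1
    ring
  · rintro ⟨B, c, hB⟩
    obtain ⟨x, rfl, rfl⟩ := hpt B c
    obtain ⟨y, hy⟩ := h.exists_half x f
    refine ⟨Matrix.of fun i j => y (some (i, j)), y none, fun T S hTS => ?_⟩
    have h1 := hB T S hTS
    rw [← (hf x).1, ← (hf x).2 ⟨(T, S), hTS⟩, ← hy, ← hy, (hf y).1, (hf y).2,
      add_add_add_comm] at h1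
    refine (le_antisymm (WithTop.le_coe_half h1.le) (WithTop.coe_half_le h1.ge)).trans ?_
    congr 1
    ring

variable {R K : Type*} [Field R] [LinearOrder R] [IsStrictOrderedRing R] [Field K] [StarRing K]
  [Algebra R K] {v : AddValuation R (WithTop ℝ)} {w : AddValuation K (WithTop ℝ)}

theorem IsConjValued.map_natCast (h : IsConjValued v w) (hv : OrderCompatible v) (m : ℕ)
    (hm : m ≠ 0) : w (m : K) = 0 := by
  rw [← _root_.map_natCast (algebraMap R K), h.map_algebraMap, hv.map_natCast hm]

/-- The principal minors of a Gram matrix and their values. -/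
theorem IsConjValued.exists_principalMinor_eq (h : IsConjValued v w) (hv : OrderCompatible v)
    {n : ℕ} (B : Matrix (Fin n) (Fin n) K) (S : Finset (Fin n)) :
    ∃ r : R, 0 ≤ r ∧ principalMinor (Bᴴ * B) S = algebraMap R K r ∧
      (∀ T : Finset (Fin n), T.card = S.card → v r ≤ minorVal w B T S + minorVal w B T S) ∧
      ∀ c : WithTop ℝ, (∀ T : Finset (Fin n), T.card = S.card →
        c ≤ minorVal w B T S + minorVal w B T S) → c ≤ v r := by
  let C : Matrix (Fin n) S K := B.submatrix id Subtype.val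
  have hpm : principalMinor (Bᴴ * B) S = (Cᴴ * C).det := rfl
  choose r hr0 hr hrv using fun g : S → Fin n => h.star_mul_self (C.submatrix g id).det
  have hfac : ((Fintype.card S).factorial : R) ≠ 0 := Nat.cast_ne_zero.2 (Nat.factorial_ne_zero _)
  have hfac0 : (0 : R) < (Fintype.card S).factorial := Nat.cast_pos.2 (Nat.factorial_pos _)
  have hval : v ((∑ g, r g) / (Fintype.card S).factorial) = v (∑ g, r g) := by
    conv_rhs => rw [← div_mul_cancel₀ (∑ g, r g) hfac]
    rw [v.map_mul, hv.map_natCast (Nat.factorial_ne_zero _), add_zero]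
  have himg : Finset.univ.image (Subtype.val : S → Fin n) = S := by
    ext x
    simp
  have hinj : ∀ g : S → Fin n, Function.Injective g →
      minorVal w B (Finset.univ.image g) S = w (C.submatrix g id).det := fun g hg =>
    minorVal_image w B hg Subtype.val_injective rfl himg
  refine ⟨(∑ g, r g) / (Fintype.card S).factorial, ?_, ?_, ?_, ?_⟩
  · exact div_nonneg (Finset.sum_nonneg fun g _ => hr0 g) hfac0.le
  · have h1 := factorial_mul_det_conjTranspose_mul_self C
    rw [map_div₀, map_sum, _root_.map_natCast, eq_div_iff, hpm, mul_comm, h1]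
    · exact Finset.sum_congr rfl fun g _ => hr g
    · rw [← _root_.map_natCast (algebraMap R K)]
      exact (map_ne_zero _).2 hfac
  -- A sum of nonnegative norms dominates each of them, so no cancellation can raise its value.
  · intro T hT
    rw [hval]
    obtain ⟨g, hg, rfl⟩ : ∃ g : S → Fin n, Function.Injective g ∧ Finset.univ.image g = T := by
      obtain ⟨g, hg, hgT⟩ := exists_enumeration T hT
      refine ⟨g ∘ S.equivFin, hg.comp S.equivFin.injective, ?_⟩
      rw [← hgT, ← Finset.image_image, Finset.image_univ_equiv]
    rw [hinj g hg, ← hrv]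
    refine hv.le_of_abs_le ?_
    rw [abs_of_nonneg (hr0 g), abs_of_nonneg (Finset.sum_nonneg fun g _ => hr0 g)]
    exact Finset.single_le_sum (fun g _ => hr0 g) (Finset.mem_univ g)
  · intro c hc
    rw [hval]
    refine v.map_le_sum fun g _ => ?_
    rw [hrv]
    by_cases hg : Function.Injective g
    · rw [← hinj g hg]
      refine hc _ ?_
      rw [Finset.card_image_of_injective _ hg]
      simp
    · have h4 : (C.submatrix g id).det = 0 := by
        rw [Function.not_injective_iff] at hg
        obtain ⟨a, b, hab, hne⟩ := hg
        exact det_zero_of_row_eq hne (by ext j; simp [hab])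
      rw [h4]
      simp

/-- The Cholesky decomposition. -/
theorem IsConjValued.exists_eq_conjTranspose_mul_self [IsRealClosed R] (h : IsConjValued v w) :
    ∀ (n : ℕ) (A : Matrix (Fin n) (Fin n) K), A.IsHermitian →
      (∀ k (hk : k ≤ n), ∃ r : R, 0 < r ∧
        (A.submatrix (Fin.castLE hk) (Fin.castLE hk)).det = algebraMap R K r) →
      ∃ B : Matrix (Fin n) (Fin n) K, A = Bᴴ * B := by
  intro n
  induction n with
  | zero => exact fun A _ _ => ⟨0, Subsingleton.elim _ _⟩
  | succ n ih =>
    intro A hA hpos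
    let e : Fin n ⊕ Fin 1 ≃ Fin (n + 1) := finSumFinEquiv
    let D : Matrix (Fin n) (Fin n) K := A.submatrix Fin.castSucc Fin.castSucc
    let u : Matrix (Fin n) (Fin 1) K := A.submatrix Fin.castSucc fun _ => Fin.last n
    let d : Matrix (Fin 1) (Fin 1) K := A.submatrix (fun _ => Fin.last n) fun _ => Fin.last n
    have hel : ∀ i, e (Sum.inl i) = i.castSucc := fun i => rfl
    have her : ∀ i, e (Sum.inr i) = Fin.last n := fun i => by
      ext
      simp [e]
    have hA' : A.submatrix e e = fromBlocks D u uᴴ d := by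
      ext (i | i) (j | j)
      · simp [hel, D]
      · simp [hel, her, u]
      · simp [hel, her, u, hA.apply]
      · simp [her, d]
    obtain ⟨C, hC⟩ := ih D (hA.submatrix _) fun k hk => hpos k (hk.trans (Nat.le_succ n))
    obtain ⟨rD, hrD, hDdet⟩ : ∃ r : R, 0 < r ∧ D.det = algebraMap R K r := hpos n (Nat.le_succ n)
    obtain ⟨rA, hrA, hAdet⟩ : ∃ r : R, 0 < r ∧ A.det = algebraMap R K r := hpos (n + 1) le_rfl
    have hDu : IsUnit D.det := by
      rw [hDdet]
      exact isUnit_iff_ne_zero.2 ((map_ne_zero _).2 hrD.ne')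
    have hCu : IsUnit C.det ∧ IsUnit Cᴴ.det := by
      rw [hC, det_mul] at hDu
      exact ⟨isUnit_of_mul_isUnit_right hDu, isUnit_of_mul_isUnit_left hDu⟩
    -- Last column of the new factor above the diagonal, forced by the block equation `Cᴴ * y = u`.
    obtain ⟨y, hy⟩ : ∃ y : Matrix (Fin n) (Fin 1) K, Cᴴ * y = u :=
      ⟨Cᴴ⁻¹ * u, mul_nonsing_inv_cancel_left _ _ hCu.2⟩
    have hy' : yᴴ * C = uᴴ := by
      rw [← hy, conjTranspose_mul, conjTranspose_conjTranspose]
    let _ : Invertible D := D.invertibleOfIsUnitDet hDu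
    have hinv : uᴴ * ⅟D * u = yᴴ * y := by
      have h1 : D * (C⁻¹ * y) = u := by
        rw [hC, Matrix.mul_assoc, mul_nonsing_inv_cancel_left _ _ hCu.1, hy]
      have h2 : ⅟D * u = C⁻¹ * y := by
        rw [← h1, ← Matrix.mul_assoc, invOf_mul_self, Matrix.one_mul]
      rw [Matrix.mul_assoc, h2, ← hy', Matrix.mul_assoc,
        mul_nonsing_inv_cancel_left _ _ hCu.1]
    -- The Schur complement is the ratio of two consecutive leading minors, hence positive with a
    -- square root in `R`.
    have hs : (d - yᴴ * y) 0 0 = algebraMap R K (rA / rD) := by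
      have h1 : (fromBlocks D u uᴴ d).det = algebraMap R K rA := by
        rw [← hA', det_submatrix_equiv_self, hAdet]
      rw [det_fromBlocks₁₁, hinv, hDdet, det_fin_one] at h1
      rw [map_div₀, eq_div_iff ((map_ne_zero _).2 hrD.ne'), mul_comm, h1]
    obtain ⟨t, ht⟩ := IsRealClosed.exists_eq_pow_of_nonneg (div_pos hrA hrD).le two_ne_zero
    let E : Matrix (Fin 1) (Fin 1) K := Matrix.of fun _ _ => algebraMap R K t
    have hE : yᴴ * y + Eᴴ * E = d := by
      have h1 : Eᴴ * E = d - yᴴ * y := by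
        ext i j
        rw [Subsingleton.elim i 0, Subsingleton.elim j 0, hs, ht, mul_apply]
        simp [E, h.star_algebraMap, pow_two]
      rw [h1, add_sub_cancel]
    refine ⟨(fromBlocks C y 0 E).submatrix e.symm e.symm, ?_⟩
    have h1 : fromBlocks D u uᴴ d = (fromBlocks C y 0 E)ᴴ * fromBlocks C y 0 E := by
      rw [fromBlocks_conjTranspose, fromBlocks_multiply]
      simp [← hC, hy, hy', hE]
    rw [conjTranspose_submatrix, submatrix_mul_equiv, ← h1, ← hA', submatrix_submatrix]
    simp

/-- In the Gram matrix of a uniform `B`, all minors on the columns `S` have the same value, and each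
principal minor gets exactly twice that value. The scalar is squared accordingly. -/
theorem IsConjValued.mem_nuImage_coneOver_of_isUniform (h : IsConjValued v w)
    (hv : OrderCompatible v) {n : ℕ} {F : Finset (Fin n) → ℝ}
    (hF : IsUniform w fun S => F S / 2) : F ∈ nuImage w (coneOver K (PMOver R K n)) := by
  obtain ⟨B, c, a, ha, -, hB⟩ := hF.exists_real
  choose r hr0 hr hr1 hr2 using fun S => h.exists_principalMinor_eq hv B S
  have hrv : ∀ S, v (r S) = ((-F S - 2 * a : ℝ) : WithTop ℝ) := by
    have hmv : ∀ T S : Finset (Fin n), T.card = S.card → minorVal w B T S + minorVal w B T S =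
        ((-F S - 2 * a : ℝ) : WithTop ℝ) := by
      intro T S hTS
      rw [hB T S hTS, ← WithTop.coe_add]
      congr 1
      ring
    refine fun S => le_antisymm ?_ (hr2 S _ fun T hT => (hmv T S hT).ge)
    rw [← hmv S S rfl]
    exact hr1 S S rfl
  refine ⟨_, ⟨c * c, r, ⟨Bᴴ * B, isHermitian_conjTranspose_mul_self B, fun S => ⟨?_, hr S⟩⟩, rfl⟩,
    fun S => ?_⟩
  · refine (hr0 S).lt_of_ne' ?_
    rw [← v.ne_top_iff, hrv]
    exact WithTop.coe_ne_top
  · rw [w.map_mul, w.map_mul, h.map_algebraMap, hrv, ha, ← WithTop.coe_add, ← WithTop.coe_add]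
    congr 1
    ring

/-- Principal minors see only the least value of the minors of the Cholesky factor on the given
columns. Mixing its rows turns this minimum into a common value. -/
theorem IsConjValued.isUniform_of_mem_nuImage_coneOver [IsRealClosed R] (h : IsConjValued v w)
    (hv : OrderCompatible v) {n : ℕ} {F : Finset (Fin n) → ℝ}
    (hF : F ∈ nuImage w (coneOver K (PMOver R K n))) : IsUniform w fun S => F S / 2 := by
  obtain ⟨_, ⟨l, a, ⟨A, hA, hAa⟩, rfl⟩, hl⟩ := hF
  have hempty : principalMinor A ∅ = 1 := det_isEmpty
  have hwl : w l = ((-F ∅ : ℝ) : WithTop ℝ) := by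
    have h1 : w (l * algebraMap R K (a ∅)) = ((-F ∅ : ℝ) : WithTop ℝ) := hl ∅
    rwa [← (hAa ∅).2, hempty, mul_one] at h1
  have hav : ∀ S, v (a S) = ((-F S - -F ∅ : ℝ) : WithTop ℝ) := by
    intro S
    have h1 := hl S
    rw [w.map_mul, hwl, h.map_algebraMap] at h1
    exact WithTop.eq_coe_of_add_coe h1
  obtain ⟨B, hAB⟩ := h.exists_eq_conjTranspose_mul_self n A hA fun k hk =>
    ⟨a _, (hAa _).1, (principalMinor_image A (Fin.castLE_injective hk)).symm.trans (hAa _).2⟩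
  obtain ⟨U, -, hU1, hU2⟩ := exists_generic_mixing w (h.map_natCast hv) B
  obtain ⟨r, hr0, -, hrv⟩ := h.star_mul_self l
  -- A scalar with half the value of `l` is needed, and `l` may be negative or not real. Its norm is
  -- nonnegative of value `2 w(l)`, so a fourth root does it.
  obtain ⟨t, ht⟩ := IsRealClosed.exists_eq_pow_of_nonneg hr0 (n := 4) (by norm_num)
  have htv : v t = ((-F ∅ / 2 : ℝ) : WithTop ℝ) := by
    rw [ht, v.map_pow, hwl] at hrv
    cases hx : v t with
    | top =>
      rw [hx, succ_nsmul, WithTop.add_top, ← WithTop.coe_add] at hrv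
      exact absurd hrv WithTop.top_ne_coe
    | coe x =>
      rw [hx, ← WithTop.coe_nsmul, ← WithTop.coe_add, WithTop.coe_inj] at hrv
      rw [WithTop.coe_inj]
      simp only [nsmul_eq_mul, Nat.cast_ofNat] at hrv
      linarith
  refine ⟨U * B, algebraMap R K t, fun T S hTS => ?_⟩
  obtain ⟨r', hr'0, hr', hr'1, hr'2⟩ := h.exists_principalMinor_eq hv B S
  have hra : r' = a S := by
    refine (algebraMap R K).injective ?_
    rw [← hr', ← hAB, (hAa S).2]
  rw [hra, hav] at hr'1 hr'2
  have h1 : minorVal w (U * B) T S = (((-F S - -F ∅) / 2 : ℝ) : WithTop ℝ) := by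
    refine le_antisymm (WithTop.le_coe_half (hr'2 _ fun T' hT' => ?_))
      (hU2 T S hTS _ fun T' hT' => WithTop.coe_half_le (hr'1 T' hT'))
    exact add_le_add (hU1 T S hTS T' hT') (hU1 T S hTS T' hT')
  rw [h.map_algebraMap, htv, h1, ← WithTop.coe_add]
  congr 1
  ring

end Gram

/-! ### Tropicalizations -/

section Closures

open Matrix

theorem interL_eq_preimage {n : ℕ} (X : Set (KSubset (n + n) n → ℝ)) :
    interL X = (fun (F : Finset (Fin n) → ℝ) (C : KSubset (n + n) n) => F (lowPart C.1)) ⁻¹' X :=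
  Set.ext fun _ => mem_interL_iff

theorem closure_interL_subset {n : ℕ} (X : Set (KSubset (n + n) n → ℝ)) :
    closure (interL X) ⊆ interL (closure X) := by
  rw [interL_eq_preimage, interL_eq_preimage]
  exact Continuous.closure_preimage_subset (by fun_prop) X

theorem isClosed_submodularCone (n : ℕ) : IsClosed (submodularCone n) := by
  have h : submodularCone n = ⋂ (S : Finset (Fin n)) (T : Finset (Fin n)),
      {F | F (S ∩ T) + F (S ∪ T) ≤ F S + F T} := by
    ext F
    simp [submodularCone]
  rw [h]
  exact isClosed_iInter fun S => isClosed_iInter fun T => isClosed_le (by fun_prop) (by fun_prop)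

variable {K : Type*} [Field K] (w : AddValuation K (WithTop ℝ))

/-- Closure need not commute with intersecting a subspace. Here, near `L_n`, the minors on the same
columns have nearly equal values; mixing replaces them by their minimum, which is equally close and
lies in `L_n`. -/
theorem interL_closure_subset {n : ℕ} (hw : ∀ m : ℕ, m ≠ 0 → w (m : K) = 0) :
    interL (closure (nuImage w (grassmannian K n (n + n)))) ⊆
      closure (interL (nuImage w (grassmannian K n (n + n)))) := by
  intro F hF
  rw [mem_interL_iff, Metric.mem_closure_iff] at hF
  rw [Metric.mem_closure_iff]
  intro ε hε
  obtain ⟨p', ⟨p, hp, hpp'⟩, hdist⟩ := hF (ε / 2) (half_pos hε)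
  rw [dist_pi_lt_iff (half_pos hε)] at hdist
  have hp0 : p (fillUp ∅) ≠ 0 := by
    rw [← w.ne_top_iff, hpp']
    exact WithTop.coe_ne_top
  obtain ⟨B, c, hc, hB⟩ := exists_eq_maxMinor_appendOne hp hp0
  obtain ⟨a, ha⟩ := WithTop.ne_top_iff_exists.1 (w.ne_top_iff.2 hc)
  have hmv : ∀ T S : Finset (Fin n), T.card = S.card →
      ∃ x : ℝ, minorVal w B T S = x ∧ |x + a + F S| < ε / 2 := by
    intro T S hTS
    obtain ⟨C, hCS, hCT⟩ := exists_kSubset T S hTS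
    have hT : highCompl C.1 = T := by
      ext j
      simp [-Fin.natAdd_eq_addNat, highCompl, hCT]
    have h1 := hpp' C
    rw [hB, w.map_mul, val_maxMinor_appendOne, hT, hCS, ← ha] at h1
    refine ⟨_, WithTop.eq_coe_of_add_coe h1, ?_⟩
    have h2 : dist (F (lowPart C.1)) (p' C) < ε / 2 := hdist C
    rw [hCS, Real.dist_eq] at h2
    rwa [show -p' C - a + a + F S = F S - p' C by ring]
  obtain ⟨U, -, hU1, hU2⟩ := exists_generic_mixing w hw B
  have hmix : ∀ S : Finset (Fin n), ∃ y : ℝ, (∀ T, T.card = S.card →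
      minorVal w (U * B) T S = y) ∧ |y + a + F S| ≤ ε / 2 := by
    intro S
    obtain ⟨x, hx, hxF⟩ := hmv S S rfl
    have hle : minorVal w (U * B) S S ≤ x := hx ▸ hU1 S S rfl S rfl
    have hge : ((-(ε / 2) - a - F S : ℝ) : WithTop ℝ) ≤ minorVal w (U * B) S S := by
      refine hU2 S S rfl _ fun T hT => ?_
      obtain ⟨z, hz, hzF⟩ := hmv T S hT
      rw [hz, WithTop.coe_le_coe]
      linarith [(abs_lt.1 hzF).1]
    obtain ⟨y, hy⟩ := WithTop.ne_top_iff_exists.1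
      (ne_top_of_le_ne_top WithTop.coe_ne_top hle)
    refine ⟨y, fun T hT => ?_, ?_⟩
    · rw [hy]
      exact le_antisymm (hU2 S S rfl _ fun T' hT' => hU1 T S hT T' hT')
        (hU2 T S hT _ fun T' hT' => hU1 S S rfl T' hT')
    · rw [← hy, WithTop.coe_le_coe] at hle hge
      rw [abs_le]
      constructor <;> linarith [(abs_lt.1 hxF).2]
  choose y hy hyF using hmix
  refine ⟨fun S => -(a + y S), ?_, ?_⟩
  · rw [mem_interL_nuImage_grassmannian_iff]
    refine ⟨U * B, c, fun T S hTS => ?_⟩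
    rw [hy S T hTS, ← ha, ← WithTop.coe_add, neg_neg]
  · refine lt_of_le_of_lt ((dist_pi_le_iff (half_pos hε).le).2 fun S => ?_) (half_lt_self hε)
    rw [Real.dist_eq, show F S - -(a + y S) = y S + a + F S by ring]
    exact hyF S

/-- The components of the affine flag variety can be rescaled independently. -/
theorem nuImage_affineFlagVariety_sub {n : ℕ} {p : Finset (Fin n) → ℝ}
    (hp : p ∈ nuImage w (affineFlagVariety K n)) {d : K} {δ : ℝ} (hd : w d = δ) :
    (fun S => p S - (S.card : ℝ) ^ 2 * δ) ∈ nuImage w (affineFlagVariety K n) := by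
  obtain ⟨q, ⟨L, hL, hqL⟩, hq⟩ := hp
  have hd0 : d ≠ 0 := by
    rw [← w.ne_top_iff, hd]
    exact WithTop.coe_ne_top
  refine ⟨fun S => d ^ (S.card ^ 2) * q S, ⟨L, hL, fun k => ?_⟩, fun S => ?_⟩
  · obtain ⟨M, hM, hspan, c, hc, hMq⟩ := hqL k
    refine ⟨M, hM, hspan, d ^ ((k : ℕ) ^ 2) * c, mul_ne_zero (pow_ne_zero _ hd0) hc, fun S => ?_⟩
    rw [mul_assoc, ← hMq S]
    change d ^ (S.1.card ^ 2) * q S.1 = d ^ ((k : ℕ) ^ 2) * q S.1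
    rw [S.2]
  · rw [w.map_mul, w.map_pow, hd, hq, ← WithTop.coe_nsmul, ← WithTop.coe_add, nsmul_eq_mul]
    congr 1
    push_cast
    ring

/-- Subtracting `δ|S|²` is allowed by independent scaling in each degree and makes a submodular
function strictly so, leaving room for the approximation error. -/
theorem closure_inter_submodularCone_subset {n : ℕ}
    (hd : ∀ ε : ℝ, 0 < ε → ∃ (d : K) (δ : ℝ), w d = δ ∧ 0 < δ ∧ δ < ε) :
    closure (nuImage w (affineFlagVariety K n)) ∩ submodularCone n ⊆
      closure (nuImage w (affineFlagVariety K n) ∩ submodularCone n) := by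
  rintro F ⟨hF, hFs⟩
  rw [Metric.mem_closure_iff] at hF ⊢
  intro ε hε
  have hn : (0 : ℝ) < (n : ℝ) ^ 2 + 1 := by positivity
  obtain ⟨d, δ, hdδ, hδ, hδε⟩ := hd (ε / ((n : ℝ) ^ 2 + 1)) (div_pos hε hn)
  rw [lt_div_iff₀ hn] at hδε
  -- The second difference of squares is `2`, so the perturbation gains `2δ`, which outweighs four
  -- errors below `δ / 2`. The total displacement is less than `(n² + 1)δ < ε`.
  obtain ⟨p, hp, hFp⟩ := hF (δ / 2) (half_pos hδ)
  rw [dist_pi_lt_iff (half_pos hδ)] at hFp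
  have hFp' : ∀ S, |F S - p S| < δ / 2 := fun S => by
    rw [← Real.dist_eq]
    exact hFp S
  refine ⟨_, ⟨nuImage_affineFlagVariety_sub w hp hdδ, mem_submodularCone_of_local ?_⟩, ?_⟩
  · intro W i j hi hj hij
    have h1 := submodularCone_local hFs hi hij (j := j)
    have hij' : i ∉ insert j W := by
      rw [Finset.mem_insert, not_or]
      exact ⟨hij, hi⟩
    rw [Finset.card_insert_of_notMem hij', Finset.card_insert_of_notMem hi,
      Finset.card_insert_of_notMem hj]
    push_cast
    have h2 := abs_lt.1 (hFp' W)
    have h3 := abs_lt.1 (hFp' (insert i W))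
    have h4 := abs_lt.1 (hFp' (insert j W))
    have h5 := abs_lt.1 (hFp' (insert i (insert j W)))
    linarith [h2.1, h2.2, h3.1, h3.2, h4.1, h4.2, h5.1, h5.2]
  · refine lt_of_le_of_lt ((dist_pi_le_iff (by positivity)).2 fun S => ?_) hδε
    have h1 : (S.card : ℝ) ^ 2 ≤ (n : ℝ) ^ 2 := by
      have : S.card ≤ n := by simpa using S.card_le_univ
      gcongr
    have h2 := abs_lt.1 (hFp' S)
    have h3 : 0 ≤ (S.card : ℝ) ^ 2 * δ := by positivity
    have h4 : (S.card : ℝ) ^ 2 * δ ≤ (n : ℝ) ^ 2 * δ := by gcongr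
    rw [Real.dist_eq, abs_le]
    constructor <;> linarith [h2.1, h2.2]

/-- Roots of positive elements make the value group divisible, so a nontrivial one has arbitrarily
small positive values. -/
theorem exists_small_val {R : Type*} [Field R] [LinearOrder R] [IsStrictOrderedRing R]
    [IsRealClosed R] (v : AddValuation R (WithTop ℝ)) (hv : ∃ a : R, a ≠ 0 ∧ v a ≠ 0) {ε : ℝ}
    (hε : 0 < ε) : ∃ (d : R) (δ : ℝ), v d = δ ∧ 0 < δ ∧ δ < ε := by
  obtain ⟨b, r, hbr, hr⟩ : ∃ (b : R) (r : ℝ), v b = r ∧ 0 < r := by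
    obtain ⟨a, ha, hva⟩ := hv
    obtain ⟨r, hr⟩ := WithTop.ne_top_iff_exists.1 (v.ne_top_iff.2 ha)
    have hr0 : r ≠ 0 := fun h => hva (by rw [← hr, h, WithTop.coe_zero])
    rcases lt_or_gt_of_ne hr0 with h | h
    · refine ⟨a⁻¹, -r, ?_, neg_pos.2 h⟩
      have h1 : v a + v a⁻¹ = ((0 : ℝ) : WithTop ℝ) := by
        rw [← v.map_mul, mul_inv_cancel₀ ha, v.map_one, WithTop.coe_zero]
      rw [← hr] at h1
      rw [WithTop.eq_coe_of_add_coe h1, zero_sub]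
    · exact ⟨a, r, hr.symm, h⟩
  obtain ⟨N, hN⟩ := exists_nat_gt (r / ε)
  have hN0 : 0 < N := by
    have : (0 : ℝ) < N := (div_pos hr hε).trans hN
    exact_mod_cast this
  obtain ⟨d, hd⟩ := IsRealClosed.exists_eq_pow_of_nonneg (abs_nonneg b) hN0.ne'
  have hN' : (0 : ℝ) < N := Nat.cast_pos.2 hN0
  refine ⟨d, r / N, ?_, div_pos hr hN', ?_⟩
  · have h1 : v (d ^ N) = r := by rw [← hd, v.map_abs, hbr]
    rw [v.map_pow] at h1
    cases hx : v d with
    | top =>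
      rw [hx, ← Nat.succ_pred_eq_of_pos hN0, succ_nsmul, WithTop.add_top] at h1
      exact absurd h1 WithTop.top_ne_coe
    | coe x =>
      rw [hx, ← WithTop.coe_nsmul, WithTop.coe_inj, nsmul_eq_mul] at h1
      rw [WithTop.coe_inj, ← h1]
      field_simp
  · rw [div_lt_iff₀ hN']
    rw [div_lt_iff₀ hε] at hN
    linarith

/-- The three descriptions of the tropicalization of positive definite principal minors. -/
theorem IsConjValued.nuImage_and_tropicalization_eq {R K : Type*} [Field R] [LinearOrder R]
    [IsStrictOrderedRing R] [IsRealClosed R] [Field K] [StarRing K] [Algebra R K]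
    {v : AddValuation R (WithTop ℝ)} {w : AddValuation K (WithTop ℝ)} (h : IsConjValued v w)
    (hv : OrderCompatible v) (hv0 : ∃ a : R, a ≠ 0 ∧ v a ≠ 0) (n : ℕ) :
    nuImage w (coneOver K (PMOver R K n)) = interL (nuImage w (grassmannian K n (n + n))) ∧
      interL (nuImage w (grassmannian K n (n + n))) =
        nuImage w (affineFlagVariety K n) ∩ submodularCone n ∧
      tropicalization w (coneOver K (PMOver R K n)) =
        interL (tropicalization w (grassmannian K n (n + n))) ∧
      interL (tropicalization w (grassmannian K n (n + n))) =
        tropicalization w (affineFlagVariety K n) ∩ submodularCone n := by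
  have hw := h.map_natCast hv
  have h1 : nuImage w (coneOver K (PMOver R K n)) =
      interL (nuImage w (grassmannian K n (n + n))) := by
    ext F
    rw [mem_interL_nuImage_grassmannian_iff, ← h.isUniform_half_iff]
    exact ⟨h.isUniform_of_mem_nuImage_coneOver hv, h.mem_nuImage_coneOver_of_isUniform hv⟩
  have h2 : interL (nuImage w (grassmannian K n (n + n))) =
      nuImage w (affineFlagVariety K n) ∩ submodularCone n := by
    ext F
    rw [mem_interL_nuImage_grassmannian_iff]
    exact ⟨fun hF => ⟨hF.mem_nuImage_affineFlagVariety, hF.mem_submodularCone⟩,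
      fun hF => IsUniform.of_mem_nuImage_affineFlagVariety w hw hF.1 hF.2⟩
  have h3 : closure (interL (nuImage w (grassmannian K n (n + n)))) =
      interL (closure (nuImage w (grassmannian K n (n + n)))) :=
    (closure_interL_subset _).antisymm (interL_closure_subset w hw)
  have h4 : closure (nuImage w (affineFlagVariety K n) ∩ submodularCone n) =
      closure (nuImage w (affineFlagVariety K n)) ∩ submodularCone n := by
    refine Set.Subset.antisymm ?_ (closure_inter_submodularCone_subset w fun ε hε => ?_)
    · refine Set.subset_inter (closure_mono Set.inter_subset_left) ?_
      exact closure_minimal Set.inter_subset_right (isClosed_submodularCone n)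
    · obtain ⟨d, δ, hd, hδ⟩ := exists_small_val v hv0 hε
      exact ⟨algebraMap R K d, δ, by rw [h.map_algebraMap, hd], hδ⟩
  refine ⟨h1, h2, ?_, ?_⟩
  · rw [tropicalization, tropicalization, h1, h3]
  · rw [tropicalization, tropicalization, ← h3, h2, h4]

end Closures

/-! ### The real and the complex case -/

section Instances

open MvPolynomial

theorem WithTop.add_self_injective {x y : WithTop ℝ} (h : x + x = y + y) : x = y := by
  cases x with
  | top =>
    cases y with
    | top => rfl
    | coe y => rw [WithTop.add_top, ← WithTop.coe_add] at h; exact absurd h WithTop.top_ne_coe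
  | coe x =>
    cases y with
    | top => rw [WithTop.add_top, ← WithTop.coe_add] at h; exact absurd h WithTop.coe_ne_top
    | coe y =>
      rw [← WithTop.coe_add, ← WithTop.coe_add, WithTop.coe_inj] at h
      rw [WithTop.coe_inj]
      linarith

/-- Division of values by two. -/
noncomputable def WithTop.halfHom : WithTop ℝ →+ WithTop ℝ :=
  (AddMonoidHom.mulLeft (1 / 2 : ℝ)).withTopMap

theorem WithTop.halfHom_add_self (x : WithTop ℝ) : halfHom x + halfHom x = x := by
  cases x with
  | top => rfl
  | coe x =>
    change (((1 / 2 : ℝ) * x : ℝ) : WithTop ℝ) + ((1 / 2 : ℝ) * x : ℝ) = x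
    rw [← WithTop.coe_add]
    congr 1
    ring

theorem WithTop.monotone_halfHom : Monotone WithTop.halfHom :=
  WithTop.monotone_map_iff.2 fun _ _ h => mul_le_mul_of_nonneg_left h (by norm_num)

theorem exists_val_eq_double {R : Type*} [Field R] (v : AddValuation R (WithTop ℝ)) (a : R) :
    ∃ b : R, v b = nsmulAddMonoidHom 2 (v a) :=
  ⟨a * a, by rw [v.map_mul, nsmulAddMonoidHom_apply, two_nsmul]⟩

theorem nsmulAddMonoidHom_two_top : nsmulAddMonoidHom 2 (⊤ : WithTop ℝ) = ⊤ := by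
  rw [nsmulAddMonoidHom_apply, two_nsmul, WithTop.add_top]

theorem monotone_nsmulAddMonoidHom_two :
    Monotone (nsmulAddMonoidHom 2 : WithTop ℝ →+ WithTop ℝ) := by
  intro x y h
  rw [nsmulAddMonoidHom_apply, nsmulAddMonoidHom_apply, two_nsmul, two_nsmul]
  exact add_le_add h h

theorem PMOver_self {R : Type*} [Field R] [LinearOrder R] (n : ℕ) :
    letI : StarRing R := starRingOfComm
    PMOver R R n = PMReal R n := by
  let _ : StarRing R := starRingOfComm
  ext a
  refine exists_congr fun A => and_congr ?_ Iff.rfl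
  exact Iff.rfl

theorem norm_cx {R : Type*} [Field R] (z : Cx R) : z.norm = z.re * z.re + z.im * z.im := by
  rw [QuadraticAlgebra.norm_def]
  ring

variable {R : Type*} [Field R] [LinearOrder R] [IsStrictOrderedRing R]
  {v : AddValuation R (WithTop ℝ)}

/-- Transfer from `R` with the valuation `θ ∘ v` to the same field with `v`; monotonicity of `θ`
keeps the source compatible with the order. -/
theorem OrderCompatible.exists_point_map_val [IsRealClosed R] (hv : OrderCompatible v)
    (θ : WithTop ℝ →+ WithTop ℝ) (hθ : θ ⊤ = ⊤) (hmono : Monotone θ)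
    (hrange : ∀ a : R, ∃ b : R, v b = θ (v a)) {m κ : Type} [Finite m] [Finite κ] (x : m → R)
    (f : κ → MvPolynomial m ℤ) :
    ∃ y : m → R, ∀ k, v (aeval y (f k)) = θ (v (aeval x (f k))) :=
  exists_point_val_eq (v' := v.map θ hθ hmono) (fun a b h h' => hmono (hv a b h h')) hv hrange x f

theorem exists_val_eq_half [IsRealClosed R] (v : AddValuation R (WithTop ℝ)) (a : R) :
    ∃ b : R, v b = WithTop.halfHom (v a) := by
  obtain ⟨b, hb⟩ := IsRealClosed.exists_eq_pow_of_nonneg (abs_nonneg a) two_ne_zero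
  refine ⟨b, WithTop.add_self_injective ?_⟩
  rw [WithTop.halfHom_add_self, ← v.map_mul, ← pow_two, ← hb, v.map_abs]

/-- A real closed field with trivial conjugation. -/
theorem isConjValued_self [IsRealClosed R] (hv : OrderCompatible v) :
    letI : StarRing R := starRingOfComm
    IsConjValued (K := R) v v :=
  letI : StarRing R := starRingOfComm
  { map_algebraMap := fun _ => rfl
    star_algebraMap := fun _ => rfl
    star_mul_self := fun z => ⟨z * z, mul_self_nonneg z, rfl, v.map_mul z z⟩
    exists_double := fun x f => by
      obtain ⟨y, hy⟩ := hv.exists_point_map_val (nsmulAddMonoidHom 2) nsmulAddMonoidHom_two_top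
        monotone_nsmulAddMonoidHom_two (exists_val_eq_double v) x f
      exact ⟨y, fun k => by rw [hy, nsmulAddMonoidHom_apply, two_nsmul]⟩
    exists_half := fun x f => by
      obtain ⟨y, hy⟩ := hv.exists_point_map_val WithTop.halfHom rfl WithTop.monotone_halfHom
        (exists_val_eq_half v) x f
      exact ⟨y, fun k => by rw [hy, WithTop.halfHom_add_self]⟩ }

theorem OrderCompatible.val_norm_cx (hv : OrderCompatible v) (z : Cx R) :
    v z.norm = cxVal v z + cxVal v z := by
  rw [norm_cx, hv.map_add (mul_self_nonneg _) (mul_self_nonneg _), v.map_mul, v.map_mul, cxVal]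
  rcases le_total (v z.re) (v z.im) with h | h
  · rw [min_eq_left h, min_eq_left (add_le_add h h)]
  · rw [min_eq_right h, min_eq_right (add_le_add h h)]

/-- The extension of the valuation to `R(i)`. -/
noncomputable def OrderCompatible.cxValuation (hv : OrderCompatible v) : AddValuation (Cx R) (WithTop ℝ) :=
  AddValuation.of (cxVal v) (by simp [cxVal])
    (by
      change min (v 1) (v 0) = 0
      rw [v.map_one, v.map_zero, min_top_right])
    (fun x y => by
      refine le_min ?_ ?_
      · exact (min_le_min (min_le_left _ _) (min_le_left _ _)).trans (v.map_add _ _)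
      · exact (min_le_min (min_le_right _ _) (min_le_right _ _)).trans (v.map_add _ _))
    -- Multiplicativity comes from the norm, whose value is twice that of the element; the norm is a
    -- sum of squares and so does not cancel.
    fun x y => WithTop.add_self_injective (by
      rw [← hv.val_norm_cx, map_mul, v.map_mul, hv.val_norm_cx, hv.val_norm_cx]
      exact add_add_add_comm _ _ _ _)

/-- The point of `R(i)^m` with given real and imaginary parts. -/
def cxPoint {m : Type*} (y : m ⊕ m → R) (i : m) : Cx R := ⟨y (Sum.inl i), y (Sum.inr i)⟩

/-- Reduces the complex transfer to the real one: values in `R(i)` are minima over real and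
imaginary parts, and monotone maps commute with minima. -/
theorem exists_re_im_polynomials {m : Type*} (f : MvPolynomial m ℤ) :
    ∃ p q : MvPolynomial (m ⊕ m) ℤ, ∀ y : m ⊕ m → R,
      aeval (cxPoint y) f = (⟨aeval y p, aeval y q⟩ : Cx R) := by
  induction f using MvPolynomial.induction_on with
  | C a =>
    refine ⟨C a, 0, fun y => ?_⟩
    rw [aeval_C, aeval_C, map_zero]
    ext <;> simp
  | add f g hf hg =>
    obtain ⟨p, q, h⟩ := hf
    obtain ⟨p', q', h'⟩ := hg
    refine ⟨p + p', q + q', fun y => ?_⟩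
    rw [_root_.map_add, h, h', _root_.map_add, _root_.map_add]
    rfl
  | mul_X f i hf =>
    obtain ⟨p, q, h⟩ := hf
    refine ⟨p * X (Sum.inl i) - q * X (Sum.inr i), p * X (Sum.inr i) + q * X (Sum.inl i),
      fun y => ?_⟩
    rw [map_mul, h, aeval_X, cxPoint, QuadraticAlgebra.mk_mul_mk]
    ext
    · simp; ring
    · simp

theorem OrderCompatible.exists_point_map_cxVal [IsRealClosed R] (hv : OrderCompatible v)
    (θ : WithTop ℝ →+ WithTop ℝ) (hθ : θ ⊤ = ⊤) (hmono : Monotone θ)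
    (hrange : ∀ a : R, ∃ b : R, v b = θ (v a)) {m κ : Type} [Finite m] [Finite κ] (x : m → Cx R)
    (f : κ → MvPolynomial m ℤ) :
    ∃ y : m → Cx R, ∀ k, cxVal v (aeval y (f k)) = θ (cxVal v (aeval x (f k))) := by
  choose p q hpq using fun k => exists_re_im_polynomials (R := R) (f k)
  obtain ⟨x, rfl⟩ : ∃ x' : m ⊕ m → R, cxPoint x' = x :=
    ⟨Sum.elim (fun i => (x i).re) fun i => (x i).im, rfl⟩
  obtain ⟨y, hy⟩ := hv.exists_point_map_val θ hθ hmono hrange x (Sum.elim p q)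
  refine ⟨cxPoint y, fun k => ?_⟩
  have h1 := hy (Sum.inl k)
  have h2 := hy (Sum.inr k)
  simp only [Sum.elim_inl, Sum.elim_inr] at h1 h2
  rw [hpq, hpq, cxVal, cxVal, hmono.map_min]
  exact congrArg₂ min h1 h2

theorem isConjValued_cx [IsRealClosed R] (hv : OrderCompatible v) :
    IsConjValued v hv.cxValuation where
  map_algebraMap r := by
    change min (v r) (v 0) = v r
    rw [v.map_zero, min_top_right]
  star_algebraMap r := by
    ext <;> simp
  star_mul_self z := by
    refine ⟨z.norm, ?_, ?_, hv.val_norm_cx z⟩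
    · rw [norm_cx]
      exact add_nonneg (mul_self_nonneg _) (mul_self_nonneg _)
    · rw [QuadraticAlgebra.algebraMap_norm_eq_mul_star, mul_comm]
  exists_double x f := by
    obtain ⟨y, hy⟩ := hv.exists_point_map_cxVal (nsmulAddMonoidHom 2) nsmulAddMonoidHom_two_top
      monotone_nsmulAddMonoidHom_two (exists_val_eq_double v) x f
    exact ⟨y, fun k => (hy k).trans (two_nsmul _)⟩
  exists_half x f := by
    obtain ⟨y, hy⟩ := hv.exists_point_map_cxVal WithTop.halfHom rfl WithTop.monotone_halfHom
      (exists_val_eq_half v) x f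
    exact ⟨y, fun k => (congrArg₂ (· + ·) (hy k) (hy k)).trans (WithTop.halfHom_add_self _)⟩

end Instances

theorem mainTheorem1 {R : Type*} [Field R] [LinearOrder R] [IsStrictOrderedRing R]
    [IsRealClosed R] (val : AddValuation R (WithTop ℝ))
    (hnontrivial : ∃ a : R, a ≠ 0 ∧ val a ≠ 0)
    (hcompat : ∀ a b : R, 0 < a → a < b → val b ≤ val a)
    (n : ℕ) (hn : 0 < n) :
    -- the case `K = R`
    (nuImage val (coneOver R (PMReal R n)) = interL (nuImage val (grassmannian R n (n + n))) ∧
      interL (nuImage val (grassmannian R n (n + n))) =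
        nuImage val (affineFlagVariety R n) ∩ submodularCone n ∧
      tropicalization val (coneOver R (PMReal R n)) =
        interL (tropicalization val (grassmannian R n (n + n))) ∧
      interL (tropicalization val (grassmannian R n (n + n))) =
        tropicalization val (affineFlagVariety R n) ∩ submodularCone n) ∧
    -- the case `K = R(i)`
    (nuImage (cxVal val) (coneOver (Cx R) (PMComplex R n)) =
        interL (nuImage (cxVal val) (grassmannian (Cx R) n (n + n))) ∧
      interL (nuImage (cxVal val) (grassmannian (Cx R) n (n + n))) =
        nuImage (cxVal val) (affineFlagVariety (Cx R) n) ∩ submodularCone n ∧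
      tropicalization (cxVal val) (coneOver (Cx R) (PMComplex R n)) =
        interL (tropicalization (cxVal val) (grassmannian (Cx R) n (n + n))) ∧
      interL (tropicalization (cxVal val) (grassmannian (Cx R) n (n + n))) =
        tropicalization (cxVal val) (affineFlagVariety (Cx R) n) ∩ submodularCone n) := by
  refine ⟨?_, (isConjValued_cx hcompat).nuImage_and_tropicalization_eq hcompat hnontrivial n⟩
  -- With the identity as conjugation, Hermitian matrices over `R` are the symmetric ones.
  let _ : StarRing R := starRingOfComm
  rw [← PMOver_self]
  exact (isConjValued_self hcompat).nuImage_and_tropicalization_eq hcompat hnontrivial n
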